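/- **Setting.** Let $\mathcal O\subset\mathbb R^d$ be open and bounded, $H=L^2(\mathcal O)$ (infinite-dimensional), $T\ge 1$. Let $A:D(A)\subset H\to H$ be a strictly positive self-adjoint operator whose domain (with the graph norm) is compactly embedded in $H$, with eigenvalues $0<\lambda_1\le\lambda_2\le\dots$ and an orthonormal basis $(\tilde e_k)$ of eigenvectors; $A^r$ and $S(t)=e^{-tA}$ are defined spectrally. Let $Q\in L(H)$ be symmetric and nonnegative with nonnegative square root $Q^{1/2}$, and assume that there are $\alpha>0$, $\beta\in(\alpha-1,\alpha]$ with $\mathrm{Tr}(A^{-\alpha})=\sum_k\lambda_k^{-\alpha}<\infty$ and $A^\beta Q\in L(H)$. Let $U=H^{-s}(\mathcal O)$ for some $s>d/2$, i.e. the dual of the completion $H_0^s(\mathcal O)$ of $C_c^\infty(\mathcal O)$ for the norm of $H^s(\mathbb R^d)$; then $H\subset U$ and $\delta_\xi\in U$ for $\xi\in\mathcal O$. Assume that $Q^{1/2}$ has a continuous linear extension $Q^{1/2}:U\to H$. For every $h>0$ let $V_h\subset D(A^{1/2})$ be a finite-dimensional subspace, $P_h:H\to V_h$ the orthogonal projection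 in $H$, $A_h:V_h\to V_h$ the operator with $\langle A_hu,v\rangle=\langle A^{1/2}u,A^{1/2}v\rangle$, and $S_h(t)=e^{-tA_h}$. Assume that for every $q\in[0,2]$ there are $\kappa_1,\kappa_2>0$ such that for all $h,t>0$ $$\|S_h(t)P_h-S(t)\|_{L(H)}\le\kappa_1h^qt^{-q/2},\qquad \|S_h(t)P_h-S(t)\|_{L(H,D(A^{1/2}))}\le\kappa_2ht^{-1}.$$ **Noise.** Let $\nu$ be a $\sigma$-finite measure on $\mathbb R$ with $\nu(\{0\})=0$ and $\int\min(|\sigma|,1)\,\nu(d\sigma)<\infty$, and let $\pi$ be a Poisson random measure on $[0,\infty)\times\mathcal O\times\mathbb R$ with reference measure $dt\,d\xi\,\nu(d\sigma)$, $\hat\pi=\pi-dt\,d\xi\,\nu(d\sigma)$, with atoms $(T_j,\Xi_j,\Sigma_j)$. For an orthonormal basis $(e_k)$ of $H$ put $M^{(k)}_t=\int_0^t\!\int_{\mathcal O\times[-1,1]}e_k(\xi)\sigma\,\hat\pi(ds,d\xi,d\sigma)$, $M_t=\sum_kM^{(k)}_te_k$ (limit in $L^2(\mathbb P;U)$), $\int_0^t\Phi\,dM=\sum_k\int_0^t\Phi(s)e_k\,dM_s^{(k)}$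 (limit in $L^2(\mathbb P;H)$), and $P_t=\sum_{T_j\le t,\,|\Sigma_j|>1}\Sigma_j\delta_{\Xi_j}\in U$. Let $x_0\in H$ and let $X$ be the mild solution of $dX_t+AX_t\,dt=Q^{1/2}(dM_t+dP_t)$, $X_0=x_0$, i.e. $$X_t=S(t)x_0+\int_0^tS(t-r)Q^{1/2}\,dM_r+\sum_{T_j\le t,\ |\Sigma_j|>1}S(t-T_j)Q^{1/2}(\Sigma_j\delta_{\Xi_j}),\qquad t\in[0,T].$$ **Scheme.** For $m\in\mathbb N$, $m\ge1$, let $P^{[m]}$ be either the process $P$ stopped at the first time in $[0,T]$ at which a jump with $|\Sigma_j|>m$ occurs, or the process obtained from $P$ by removing all jumps with $|\Sigma_j|>m$ (the result holds for both choices). Put $u_m=\int_{\mathcal O\times([-m,m]\setminus[-1,1])}\sigma\delta_\xi\,d\xi\,\nu(d\sigma)\in U$ and $M^{[m]}_t=P^{[m]}_t-tu_m$. Fix $\theta\in(1/2,1]$; for $N\ge1$ let $\Delta t=T/N$, $t_k=k\Delta t$, $T_{h,\Delta t}=(I+\theta\Delta tA_h)^{-1}$, $S_{h,\Delta t}=T_{h,\Delta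 t}(I-(1-\theta)\Delta tA_h)$ and $$X_h^{N,[m]}=S_{h,\Delta t}^NP_hx_0+\sum_{k=0}^{N-1}S_{h,\Delta t}^{N-k-1}T_{h,\Delta t}P_hQ^{1/2}\Big(\Delta t\,u_m+(M_{t_{k+1}}-M_{t_k})+(M^{[m]}_{t_{k+1}}-M^{[m]}_{t_k})\Big).$$ **Theorem.** Let $\varphi\in C_b^2(H;\mathbb R)$ be such that $D^2\varphi(x)$ is Hilbert–Schmidt for every $x\in H$ and $x\mapsto D^2\varphi(x)$ is uniformly continuous on bounded sets in Hilbert–Schmidt norm. Then for every $\gamma<1-\alpha+\beta$ and every $\rho\in\mathbb R$ there is a constant $C>0$, which may depend on $T,\varphi,A,Q,\gamma,\rho$ and on the fixed data $\mathcal O$, $\theta$, $(V_h)$, but not on $x_0,\nu,h,N,m$ or the realisation of the noise, such that whenever $|x_0|_H\le\rho$, $h>0$, $m\ge1$, $N\ge1$ and $\Delta t=T/N\le1$, $$\big|\mathbb E\varphi(X_h^{N,[m]})-\mathbb E\varphi(X_T)\big|\le C\Big(1+\int_{[-m,m]}|\sigma|\,\nu(d\sigma)\Big)\big(h^{2\gamma}+(\Delta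 t)^\gamma\big)+2\|\varphi\|_\infty\min\big(T\,\lambda(\mathcal O)\,\nu(\mathbb R\setminus[-m,m]),\,1\big),$$ where $\|\varphi\|_\infty=\sup_{x\in H}|\varphi(x)|$ and $\lambda$ is Lebesgue measure. -/

import Mathlib

open MeasureTheory ProbabilityTheory Filter Topology TopologicalSpace
open scoped ENNReal NNReal InnerProductSpace Distributions FourierTransform

/-- The physical space `ℝ^d` with the Euclidean norm. -/
abbrev Pt (d : ℕ) : Type := EuclideanSpace ℝ (Fin d)

/-- `H = L²(𝒪)`. -/
abbrev L2 {d : ℕ} (O : Opens (Pt d)) : Type := Lp ℝ 2 (volume.restrict (O : Set (Pt d)))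

noncomputable section

/-- A real test function on `O`, extended by zero, seen as a complex Schwartz function on `ℝ^d`. -/
def testToSchwartz {d : ℕ} {O : Opens (Pt d)} (ψ : 𝓓(O, ℝ)) : SchwartzMap (Pt d) ℂ :=
  HasCompactSupport.toSchwartzMap (f := fun x => ((ψ x : ℝ) : ℂ))
    (ψ.hasCompactSupport.comp_left (g := fun y : ℝ => (y : ℂ)) Complex.ofReal_zero)
    (Complex.ofRealCLM.contDiff.comp (TestFunction.contDiff ψ))

@[simp] theorem testToSchwartz_apply {d : ℕ} {O : Opens (Pt d)} (ψ : 𝓓(O, ℝ)) (x : Pt d) :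
    testToSchwartz ψ x = ((ψ x : ℝ) : ℂ) := rfl

/-- The Schwartz function `k ↦ (1 + |k|²)^{s/2} 𝓕ψ(k)`. -/
def weightedFourier {d : ℕ} {O : Opens (Pt d)} (s : ℝ) (ψ : 𝓓(O, ℝ)) : SchwartzMap (Pt d) ℂ :=
  SchwartzMap.smulLeftCLM ℂ (fun k : Pt d => (1 + ‖k‖ ^ 2) ^ (s / 2))
    (𝓕 (testToSchwartz ψ))

theorem hasTemperateGrowth_weight {d : ℕ} (s : ℝ) :
    (fun k : Pt d => (1 + ‖k‖ ^ 2) ^ (s / 2)).HasTemperateGrowth := by fun_prop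

/-- The linear map `ψ ↦ (1 + |k|²)^{s/2} 𝓕ψ ∈ L²(ℝ^d; ℂ)`. -/
def weightedFourierL2 {d : ℕ} (O : Opens (Pt d)) (s : ℝ) :
    𝓓(O, ℝ) →ₗ[ℝ] Lp ℂ 2 (volume : Measure (Pt d)) where
  toFun ψ := (weightedFourier s ψ).toLp 2
  map_add' ψ χ := by
    have h : testToSchwartz (ψ + χ) = testToSchwartz ψ + testToSchwartz χ := by
      ext x; simp
    simp only [weightedFourier, h, FourierTransform.fourier_add, map_add]
    rfl
  map_smul' c ψ := by
    have h : testToSchwartz (c • ψ) = c • testToSchwartz ψ := by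
      ext x; simp
    simp only [weightedFourier, h, FourierTransform.fourier_smul, map_smul]
    rfl

/-- `C_c^∞(O)` carrying the norm of the Sobolev space `H^s(ℝ^d)`,
`‖ψ‖_s = (∫ (1 + |k|²)^s |𝓕ψ(k)|² dk)^{1/2}`; its completion is `H^s_0(O)`. -/
def SobolevTest {d : ℕ} (O : Opens (Pt d)) (_s : ℝ) : Type := 𝓓(O, ℝ)

instance {d : ℕ} (O : Opens (Pt d)) (s : ℝ) : AddCommGroup (SobolevTest O s) :=
  inferInstanceAs (AddCommGroup 𝓓(O, ℝ))

instance {d : ℕ} (O : Opens (Pt d)) (s : ℝ) : Module ℝ (SobolevTest O s) :=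
  inferInstanceAs (Module ℝ 𝓓(O, ℝ))

/-- The identity, as a linear map. -/
def SobolevTest.toTest {d : ℕ} (O : Opens (Pt d)) (s : ℝ) : SobolevTest O s →ₗ[ℝ] 𝓓(O, ℝ) :=
  LinearMap.id

theorem weightedFourierL2_injective {d : ℕ} (O : Opens (Pt d)) (s : ℝ) :
    Function.Injective ((weightedFourierL2 O s).comp (SobolevTest.toTest O s)) := by
  intro ψ χ h
  have h1 : weightedFourier s (SobolevTest.toTest O s ψ) =
      weightedFourier s (SobolevTest.toTest O s χ) := SchwartzMap.injective_toLp 2 volume h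
  have h2 : 𝓕 (testToSchwartz (SobolevTest.toTest O s ψ)) =
      𝓕 (testToSchwartz (SobolevTest.toTest O s χ)) := by
    ext k
    have h3 := DFunLike.congr_fun h1 k
    simp only [weightedFourier, SchwartzMap.smulLeftCLM_apply_apply (hasTemperateGrowth_weight s)]
      at h3
    exact smul_right_injective ℂ (Real.rpow_pos_of_pos (by positivity) _).ne' h3
  have h4 : testToSchwartz (SobolevTest.toTest O s ψ) =
      testToSchwartz (SobolevTest.toTest O s χ) := by
    have h5 : ∀ f : SchwartzMap (Pt d) ℂ, 𝓕⁻ (𝓕 f) = f := fun f =>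
      FourierTransform.fourierInv_fourier_eq f
    rw [← h5 (testToSchwartz (SobolevTest.toTest O s ψ)), h2, h5]
  have h6 : SobolevTest.toTest O s ψ = SobolevTest.toTest O s χ := by
    refine TestFunction.ext fun x => ?_
    have h7 := DFunLike.congr_fun h4 x
    simpa using h7
  exact h6

instance {d : ℕ} (O : Opens (Pt d)) (s : ℝ) : NormedAddCommGroup (SobolevTest O s) :=
  NormedAddCommGroup.induced (SobolevTest O s) (Lp ℂ 2 (volume : Measure (Pt d)))
    ((weightedFourierL2 O s).comp (SobolevTest.toTest O s)) (weightedFourierL2_injective O s)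

instance {d : ℕ} (O : Opens (Pt d)) (s : ℝ) : NormedSpace ℝ (SobolevTest O s) :=
  NormedSpace.induced ℝ (SobolevTest O s) (Lp ℂ 2 (volume : Measure (Pt d)))
    ((weightedFourierL2 O s).comp (SobolevTest.toTest O s))

theorem SobolevTest.norm_def {d : ℕ} {O : Opens (Pt d)} {s : ℝ} (ψ : SobolevTest O s) :
    ‖ψ‖ = ‖(weightedFourier s (SobolevTest.toTest O s ψ)).toLp 2‖ := rfl

/-- `H^{-s}(O)`, the dual space of `H^s_0(O)`. -/
abbrev NegSobolev {d : ℕ} (O : Opens (Pt d)) (s : ℝ) : Type := StrongDual ℝ (SobolevTest O s)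

theorem SobolevTest.memLp {d : ℕ} {O : Opens (Pt d)} {s : ℝ} (ψ : SobolevTest O s) :
    MemLp (SobolevTest.toTest O s ψ) 2 (volume.restrict (O : Set (Pt d))) :=
  (TestFunction.continuous (SobolevTest.toTest O s ψ)).memLp_of_hasCompactSupport
    (TestFunction.hasCompactSupport (SobolevTest.toTest O s ψ))

/-- Restriction of a test function to `O`, as an element of `L²(O)`. -/
def SobolevTest.toL2Lin {d : ℕ} (O : Opens (Pt d)) (s : ℝ) : SobolevTest O s →ₗ[ℝ] L2 O where
  toFun ψ := (SobolevTest.memLp ψ).toLp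
  map_add' _ _ := rfl
  map_smul' _ _ := rfl

theorem SobolevTest.norm_toL2Lin_le {d : ℕ} {O : Opens (Pt d)} {s : ℝ} (hs : 0 ≤ s)
    (ψ : SobolevTest O s) : ‖SobolevTest.toL2Lin O s ψ‖ ≤ ‖ψ‖ := by
  set χ := SobolevTest.toTest O s ψ with hχ
  have h1 : ‖SobolevTest.toL2Lin O s ψ‖ ≤ ‖(testToSchwartz χ).toLp 2‖ := by
    rw [SchwartzMap.norm_toLp]
    change ‖(SobolevTest.memLp ψ).toLp‖ ≤ _
    rw [Lp.norm_toLp]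
    refine ENNReal.toReal_mono ((testToSchwartz χ).memLp 2 volume).eLpNorm_ne_top ?_
    refine (eLpNorm_mono_measure _ Measure.restrict_le_self).trans (le_of_eq ?_)
    refine eLpNorm_congr_norm_ae (Eventually.of_forall fun x => ?_)
    simp [hχ]
  refine h1.trans ?_
  rw [← SchwartzMap.norm_fourier_toL2_eq, SobolevTest.norm_def, SchwartzMap.norm_toLp,
    SchwartzMap.norm_toLp]
  refine ENNReal.toReal_mono (SchwartzMap.memLp _ 2 volume).eLpNorm_ne_top ?_
  refine eLpNorm_mono fun k => ?_
  have hw : (1 : ℝ) ≤ (1 + ‖k‖ ^ 2) ^ (s / 2) :=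
    Real.one_le_rpow (by nlinarith [sq_nonneg ‖k‖]) (by linarith)
  rw [weightedFourier, SchwartzMap.smulLeftCLM_apply_apply (hasTemperateGrowth_weight s),
    norm_smul, Real.norm_of_nonneg (by linarith)]
  nlinarith [norm_nonneg ((𝓕 (testToSchwartz χ)) k)]

theorem half_dim_nonneg {d : ℕ} {s : ℝ} (hs : (d : ℝ) / 2 < s) : 0 ≤ s :=
  le_trans (by positivity) hs.le

/-- The embedding `L²(O) → H^{-s}(O)`, `u ↦ (ψ ↦ ∫_O ψ u)`. -/
def toNegSobolev {d : ℕ} (O : Opens (Pt d)) {s : ℝ} (hs : (d : ℝ) / 2 < s) (u : L2 O) :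
    NegSobolev O s :=
  (innerSL ℝ u).comp ((SobolevTest.toL2Lin O s).mkContinuous 1 fun ψ => by
    simpa using SobolevTest.norm_toL2Lin_le (half_dim_nonneg hs) ψ)

theorem toNegSobolev_apply {d : ℕ} (O : Opens (Pt d)) {s : ℝ} (hs : (d : ℝ) / 2 < s) (u : L2 O)
    (ψ : SobolevTest O s) :
    toNegSobolev O hs u ψ = ∫ x in (O : Set (Pt d)), SobolevTest.toTest O s ψ x * u x := by
  change ⟪u, SobolevTest.toL2Lin O s ψ⟫_ℝ = _
  rw [L2.inner_def]
  refine integral_congr_ae ?_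
  filter_upwards [(SobolevTest.memLp ψ).coeFn_toLp] with x hx
  have h : (SobolevTest.toL2Lin O s ψ) x = SobolevTest.toTest O s ψ x := hx
  rw [h]
  simp

/-- Point evaluations are bounded with respect to `‖·‖_s` for `s > d/2`. -/
theorem exists_bound_eval {d : ℕ} (O : Opens (Pt d)) {s : ℝ} (hs : (d : ℝ) / 2 < s) (ξ : Pt d) :
    ∃ C : ℝ, ∀ ψ : SobolevTest O s, ‖SobolevTest.toTest O s ψ ξ‖ ≤ C * ‖ψ‖ := by
  have hs2 : (Module.finrank ℝ (Pt d) : ℝ) < 2 * s := by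
    rw [finrank_euclideanSpace_fin]; linarith
  refine ⟨(∫ k : Pt d, ((1 + ‖k‖ ^ 2) ^ (-s / 2)) ^ (2 : ℝ)) ^ (1 / 2 : ℝ), fun ψ => ?_⟩
  set χ := SobolevTest.toTest O s ψ with hχ
  set g : SchwartzMap (Pt d) ℂ := 𝓕 (testToSchwartz χ) with hg
  have hpos : ∀ k : Pt d, (0 : ℝ) < 1 + ‖k‖ ^ 2 := fun k => by positivity
  have hw : ∀ k, ‖weightedFourier s χ k‖ = (1 + ‖k‖ ^ 2) ^ (s / 2) * ‖g k‖ := fun k => by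
    rw [weightedFourier, SchwartzMap.smulLeftCLM_apply_apply (hasTemperateGrowth_weight s),
      norm_smul, Real.norm_of_nonneg (Real.rpow_nonneg (hpos k).le _)]
  have h1 : ‖χ ξ‖ ≤ ∫ k, ‖g k‖ := by
    have h2 : ‖χ ξ‖ = ‖testToSchwartz χ ξ‖ := by simp
    have h3 : testToSchwartz χ = 𝓕⁻ g := by rw [hg, FourierTransform.fourierInv_fourier_eq]
    rw [h2, h3, SchwartzMap.fourierInv_coe, Real.fourierInv_eq]
    refine (norm_integral_le_integral_norm _).trans (le_of_eq ?_)
    simp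
  have h4 : ∀ k, ‖g k‖ = (1 + ‖k‖ ^ 2) ^ (-s / 2) * ‖weightedFourier s χ k‖ := fun k => by
    rw [hw, ← mul_assoc, ← Real.rpow_add (hpos k)]
    simp [neg_div]
  have h5 : ∀ k : Pt d, ((1 + ‖k‖ ^ 2) ^ (-s / 2) : ℝ) ^ (2 : ℝ) = (1 + ‖k‖ ^ 2) ^ (-(2 * s) / 2) :=
    fun k => by rw [← Real.rpow_mul (hpos k).le]; congr 1; ring
  have hmeas : AEStronglyMeasurable (fun k : Pt d => ((1 + ‖k‖ ^ 2) ^ (-s / 2) : ℝ)) volume :=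
    (hasTemperateGrowth_weight (-s)).1.continuous.aestronglyMeasurable
  have h6 : MemLp (fun k : Pt d => ((1 + ‖k‖ ^ 2) ^ (-s / 2) : ℝ)) (ENNReal.ofReal 2) volume := by
    rw [← integrable_norm_rpow_iff hmeas (by simp) (by simp)]
    refine (integrable_rpow_neg_one_add_norm_sq (μ := (volume : Measure (Pt d))) hs2).congr
      (Eventually.of_forall fun k => ?_)
    simp only [ENNReal.toReal_ofReal (zero_le_two : (0 : ℝ) ≤ 2)]
    rw [Real.norm_of_nonneg (Real.rpow_nonneg (hpos k).le _), h5]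
  have h7 : MemLp (fun k : Pt d => ‖weightedFourier s χ k‖) (ENNReal.ofReal 2) volume :=
    ((weightedFourier s χ).memLp _ volume).norm
  have h8 := integral_mul_le_Lp_mul_Lq_of_nonneg Real.HolderConjugate.two_two
    (Eventually.of_forall fun k => Real.rpow_nonneg (hpos k).le _)
    (Eventually.of_forall fun k => norm_nonneg _) h6 h7
  have h9 : ‖ψ‖ = (∫ k : Pt d, ‖weightedFourier s χ k‖ ^ (2 : ℝ)) ^ (1 / 2 : ℝ) := by
    rw [SobolevTest.norm_def, SchwartzMap.norm_toLp' (by simp) (by simp)]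
    simp [hχ]
  rw [h9]
  refine h1.trans (le_trans (le_of_eq ?_) h8)
  exact integral_congr_ae (Eventually.of_forall h4)

/-- The Dirac functional `δ_ξ ∈ H^{-s}(O)`, `s > d/2`. -/
def diracDelta {d : ℕ} (O : Opens (Pt d)) {s : ℝ} (hs : (d : ℝ) / 2 < s) (ξ : Pt d) :
    NegSobolev O s :=
  LinearMap.mkContinuousOfExistsBound
    { toFun := fun ψ => SobolevTest.toTest O s ψ ξ
      map_add' := fun _ _ => rfl
      map_smul' := fun _ _ => rfl }
    (exists_bound_eval O hs ξ)

theorem diracDelta_apply {d : ℕ} (O : Opens (Pt d)) {s : ℝ} (hs : (d : ℝ) / 2 < s) (ξ : Pt d)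
    (ψ : SobolevTest O s) : diracDelta O hs ξ ψ = SobolevTest.toTest O s ψ ξ := rfl


/-! ### Spectral operators, fractional powers, semigroup -/

section Spectral

variable {H : Type*} [NormedAddCommGroup H] [InnerProductSpace ℝ H]

/-- The (unbounded) operator `u ↦ ∑ₖ aₖ ⟨eₖ, u⟩ eₖ` with its maximal domain
`{u | ∑ₖ (aₖ ⟨eₖ, u⟩)² < ∞}`. -/
def specOp (e : HilbertBasis ℕ ℝ H) (a : ℕ → ℝ) : H →ₗ.[ℝ] H where
  domain :=
    { carrier := {u | Memℓp (fun k => a k * ⟪e k, u⟫_ℝ) 2}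
      zero_mem' := by
        have h2 : (fun k => a k * ⟪e k, (0 : H)⟫_ℝ) = 0 := by ext k; simp
        simpa only [Set.mem_ofPred_eq, h2] using (zero_memℓp : Memℓp (0 : ℕ → ℝ) 2)
      add_mem' := fun {u v} hu hv => by
        have h := Memℓp.add hu hv
        have h2 : (fun k => a k * ⟪e k, u + v⟫_ℝ) =
            (fun k => a k * ⟪e k, u⟫_ℝ) + fun k => a k * ⟪e k, v⟫_ℝ := by
          ext k; simp [inner_add_right, mul_add]
        simpa only [Set.mem_ofPred_eq, h2] using h
      smul_mem' := fun c u hu => by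
        have h := Memℓp.const_smul hu c
        have h2 : (fun k => a k * ⟪e k, c • u⟫_ℝ) = c • fun k => a k * ⟪e k, u⟫_ℝ := by
          ext k; simp [inner_smul_right]; ring
        simpa only [Set.mem_ofPred_eq, h2] using h }
  toFun :=
    { toFun := fun u => e.repr.symm ⟨fun k => a k * ⟪e k, (u : H)⟫_ℝ, u.2⟩
      map_add' := fun u v => by
        rw [← map_add]; congr 1; ext k
        change a k * ⟪e k, (u : H) + (v : H)⟫_ℝ = a k * ⟪e k, (u : H)⟫_ℝ + a k * ⟪e k, (v : H)⟫_ℝ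
        rw [inner_add_right, mul_add]
      map_smul' := fun c u => by
        rw [RingHom.id_apply, ← map_smul]; congr 1; ext k
        change a k * ⟪e k, c • (u : H)⟫_ℝ = c * (a k * ⟪e k, (u : H)⟫_ℝ)
        rw [inner_smul_right]; ring }

theorem mem_specOp_domain (e : HilbertBasis ℕ ℝ H) (a : ℕ → ℝ) (u : H) :
    u ∈ (specOp e a).domain ↔ Summable fun k => (a k * ⟪e k, u⟫_ℝ) ^ 2 := by
  change Memℓp _ 2 ↔ _
  rw [memℓp_gen_iff (by simp)]
  simp [mul_pow]

theorem specOp_hasSum (e : HilbertBasis ℕ ℝ H) (a : ℕ → ℝ) (u : (specOp e a).domain) :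
    HasSum (fun k => (a k * ⟪e k, (u : H)⟫_ℝ) • e k) (specOp e a u) :=
  e.hasSum_repr_symm ⟨fun k => a k * ⟪e k, (u : H)⟫_ℝ, u.2⟩

/-- The fractional power `A^r` of the operator with eigenvalues `lam k` and eigenvectors `e k`. -/
def fracPow (e : HilbertBasis ℕ ℝ H) (lam : ℕ → ℝ) (r : ℝ) : H →ₗ.[ℝ] H :=
  specOp e fun k => lam k ^ r

theorem specOp_bound (e : HilbertBasis ℕ ℝ H) (a : ℕ → ℝ) {C : ℝ} (hC : ∀ k, |a k| ≤ C) (u : H) :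
    (Summable fun k => (a k * ⟪e k, u⟫_ℝ) ^ 2) ∧
      ∑' k, (a k * ⟪e k, u⟫_ℝ) ^ 2 ≤ (C * ‖u‖) ^ 2 := by
  have h1 : HasSum (fun k => ⟪e k, u⟫_ℝ ^ 2) (‖u‖ ^ 2) := by
    have h := e.hasSum_inner_mul_inner u u
    rw [real_inner_self_eq_norm_sq] at h
    have h0 : (fun k => ⟪e k, u⟫_ℝ ^ 2) = fun k => ⟪u, e k⟫_ℝ * ⟪e k, u⟫_ℝ := by
      ext k; rw [real_inner_comm, sq]
    rwa [h0]
  have h2 := h1.mul_left (C ^ 2)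
  have h3 : ∀ k, (a k * ⟪e k, u⟫_ℝ) ^ 2 ≤ C ^ 2 * ⟪e k, u⟫_ℝ ^ 2 := fun k => by
    rw [mul_pow]
    exact mul_le_mul_of_nonneg_right (sq_le_sq' (by linarith [abs_le.1 (hC k)]) (abs_le.1 (hC k)).2)
      (sq_nonneg _)
  have h4 := Summable.of_nonneg_of_le (fun k => sq_nonneg _) h3 h2.summable
  refine ⟨h4, ?_⟩
  rw [mul_pow, ← h2.tsum_eq]
  exact h4.tsum_le_tsum h3 h2.summable

theorem specOp_norm_sq (e : HilbertBasis ℕ ℝ H) (a : ℕ → ℝ) (u : (specOp e a).domain) :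
    ‖specOp e a u‖ ^ 2 = ∑' k, (a k * ⟪e k, (u : H)⟫_ℝ) ^ 2 := by
  have h1 : ‖specOp e a u‖ = ‖(⟨fun k => a k * ⟪e k, (u : H)⟫_ℝ, u.2⟩ : lp (fun _ : ℕ => ℝ) 2)‖ :=
    LinearIsometryEquiv.norm_map e.repr.symm _
  have h2 := lp.norm_rpow_eq_tsum (p := 2) (by simp)
    (⟨fun k => a k * ⟪e k, (u : H)⟫_ℝ, u.2⟩ : lp (fun _ : ℕ => ℝ) 2)
  rw [h1]
  simpa [mul_pow] using h2

open Classical in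
/-- For a bounded sequence `a`, the bounded operator `u ↦ ∑ₖ aₖ ⟨eₖ, u⟩ eₖ` (and `0` if `a` is
unbounded). -/
def diagCLM (e : HilbertBasis ℕ ℝ H) (a : ℕ → ℝ) : H →L[ℝ] H :=
  if h : ∃ C, ∀ k, |a k| ≤ C then
    LinearMap.mkContinuousOfExistsBound
      ((specOp e a).toFun ∘ₗ LinearMap.codRestrict (specOp e a).domain LinearMap.id fun u =>
        (mem_specOp_domain e a u).2 (specOp_bound e a h.choose_spec u).1)
      (by
        obtain ⟨C, hC⟩ := h
        have hC0 : 0 ≤ C := (abs_nonneg _).trans (hC 0)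
        refine ⟨C, fun u => ?_⟩
        refine abs_le_of_sq_le_sq' ?_ (by positivity) |>.2
        refine (specOp_norm_sq e a ⟨u, _⟩).le.trans (specOp_bound e a hC u).2)
  else 0

theorem diagCLM_hasSum (e : HilbertBasis ℕ ℝ H) (a : ℕ → ℝ) (h : ∃ C, ∀ k, |a k| ≤ C) (u : H) :
    HasSum (fun k => (a k * ⟪e k, u⟫_ℝ) • e k) (diagCLM e a u) := by
  rw [diagCLM, dif_pos h]
  exact specOp_hasSum e a ⟨u, (mem_specOp_domain e a u).2 (specOp_bound e a h.choose_spec u).1⟩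

/-- The semigroup `S(t)`, `t ≥ 0`, generated by `-A`. -/
def heatSemigroup (e : HilbertBasis ℕ ℝ H) (lam : ℕ → ℝ) (t : ℝ) : H →L[ℝ] H :=
  diagCLM e fun k => Real.exp (-(t * lam k))

end Spectral

/-! ### The operators `A`, `A_h` and the fully discrete scheme -/

section Scheme

variable {H : Type*} [NormedAddCommGroup H] [InnerProductSpace ℝ H]

/-- `A` is a strictly positive self-adjoint operator (in particular densely defined) whose domain,
with the graph norm, is compactly embedded in `H`. -/
structure IsPositiveCompactType [CompleteSpace H] (A : H →ₗ.[ℝ] H) : Prop where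
  isSelfAdjoint : IsSelfAdjoint A
  pos : ∀ u : A.domain, u ≠ 0 → 0 < ⟪A u, (u : H)⟫_ℝ
  compact_embedding :
    IsCompact (closure {v : H | ∃ u : A.domain, ‖(u : H)‖ + ‖A u‖ ≤ 1 ∧ (u : H) = v})

/-- `(e k)` is an orthonormal basis of eigenvectors of `A`, with eigenvalues `lam k` in increasing
order. -/
structure IsEigenbasis (A : H →ₗ.[ℝ] H) (lam : ℕ → ℝ) (e : HilbertBasis ℕ ℝ H) : Prop where
  monotone : Monotone lam
  eigen : ∀ k, ∃ h : e k ∈ A.domain, A ⟨e k, h⟩ = lam k • e k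

/-- The restriction of `A^{1/2}` to a finite dimensional `V ⊆ D(A^{1/2})`. -/
def sqrtOn (e : HilbertBasis ℕ ℝ H) (lam : ℕ → ℝ)
    (V : Submodule ℝ H) [FiniteDimensional ℝ V]
    (hV : V ≤ (fracPow e lam (1 / 2)).domain) : V →L[ℝ] H :=
  LinearMap.toContinuousLinearMap ((fracPow e lam (1 / 2)).toFun ∘ₗ Submodule.inclusion hV)

/-- The operator `A_h : V → V` with `⟨A_h u, v⟩ = ⟨A^{1/2} u, A^{1/2} v⟩`. -/
def discreteOp [CompleteSpace H] (e : HilbertBasis ℕ ℝ H) (lam : ℕ → ℝ)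
    (V : Submodule ℝ H) [FiniteDimensional ℝ V]
    (hV : V ≤ (fracPow e lam (1 / 2)).domain) : V →L[ℝ] V :=
  (ContinuousLinearMap.adjoint (sqrtOn e lam V hV)) ∘L sqrtOn e lam V hV

theorem inner_discreteOp [CompleteSpace H] (e : HilbertBasis ℕ ℝ H) (lam : ℕ → ℝ) (V : Submodule ℝ H) [FiniteDimensional ℝ V]
    (hV : V ≤ (fracPow e lam (1 / 2)).domain) (u v : V) :
    ⟪((discreteOp e lam V hV u : V) : H), (v : H)⟫_ℝ =
      ⟪fracPow e lam (1 / 2) ⟨u, hV u.2⟩, fracPow e lam (1 / 2) ⟨v, hV v.2⟩⟫_ℝ := by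
  change ⟪discreteOp e lam V hV u, v⟫_ℝ = _
  rw [discreteOp, ContinuousLinearMap.comp_apply, ContinuousLinearMap.adjoint_inner_left]
  rfl

/-- The semigroup `exp(-tB)` generated by a bounded operator `-B`. -/
def expSemigroup {W : Type*} [NormedAddCommGroup W] [NormedSpace ℝ W] (B : W →L[ℝ] W) (t : ℝ) :
    W →L[ℝ] W :=
  NormedSpace.exp ((-t) • B)

/-- `S_h(t) P_h - S(t) ∈ L(H)`. -/
def semigroupError [CompleteSpace H] (e : HilbertBasis ℕ ℝ H) (lam : ℕ → ℝ)
    (V : Submodule ℝ H) [FiniteDimensional ℝ V]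
    (hV : V ≤ (fracPow e lam (1 / 2)).domain) (t : ℝ) : H →L[ℝ] H :=
  V.subtypeL ∘L expSemigroup (discreteOp e lam V hV) t ∘L V.orthogonalProjectionOnto
    - heatSemigroup e lam t

/-- `T_{h,Δt} = (I + θ Δt A_h)⁻¹`. -/
def stepT [CompleteSpace H] (e : HilbertBasis ℕ ℝ H) (lam : ℕ → ℝ)
    (V : Submodule ℝ H) [FiniteDimensional ℝ V]
    (hV : V ≤ (fracPow e lam (1 / 2)).domain) (θ Δt : ℝ) : V →L[ℝ] V :=
  Ring.inverse (1 + (θ * Δt) • discreteOp e lam V hV)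

/-- `S_{h,Δt} = (I + θ Δt A_h)⁻¹ (I - (1 - θ) Δt A_h)`. -/
def stepS [CompleteSpace H] (e : HilbertBasis ℕ ℝ H) (lam : ℕ → ℝ)
    (V : Submodule ℝ H) [FiniteDimensional ℝ V]
    (hV : V ≤ (fracPow e lam (1 / 2)).domain) (θ Δt : ℝ) : V →L[ℝ] V :=
  stepT e lam V hV θ Δt * (1 - ((1 - θ) * Δt) • discreteOp e lam V hV)

/-- The `θ`-scheme in `V` with initial value `x₀` and noise increments `η k`:
`S^n P x₀ + ∑_{k<n} S^{n-k-1} T P η_k`. -/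
def thetaScheme [CompleteSpace H] (e : HilbertBasis ℕ ℝ H) (lam : ℕ → ℝ)
    (V : Submodule ℝ H) [FiniteDimensional ℝ V]
    (hV : V ≤ (fracPow e lam (1 / 2)).domain) (θ Δt : ℝ) (x₀ : H) (η : ℕ → H) (n : ℕ) : H :=
  ((stepS e lam V hV θ Δt ^ n) (V.orthogonalProjectionOnto x₀) +
    ∑ k ∈ Finset.range n, (stepS e lam V hV θ Δt ^ (n - k - 1))
      (stepT e lam V hV θ Δt (V.orthogonalProjectionOnto (η k))) : V)

/-- The Hilbert-Schmidt norm, with values in `[0,∞]`. -/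
def hsNorm (e : HilbertBasis ℕ ℝ H) (B : H →L[ℝ] H) : ℝ≥0∞ :=
  (∑' k, ‖B (e k)‖ₑ ^ 2) ^ (1 / 2 : ℝ)

/-- `φ ∈ C²_b(H)`, the second derivative `D²φ(x)` (the derivative of the gradient) is
Hilbert-Schmidt for every `x`, and `x ↦ D²φ(x)` is uniformly continuous on bounded sets with
respect to the Hilbert-Schmidt norm. -/
structure IsC2bHS [CompleteSpace H] (e : HilbertBasis ℕ ℝ H) (φ : H → ℝ) : Prop where
  contDiff : ContDiff ℝ 2 φ
  bounded : ∃ K, ∀ x, |φ x| ≤ K ∧ ‖gradient φ x‖ ≤ K ∧ ‖fderiv ℝ (gradient φ) x‖ ≤ K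
  hilbertSchmidt : ∀ x, hsNorm e (fderiv ℝ (gradient φ) x) ≠ ∞
  unifCont : ∀ R : ℝ, ∀ ε : ℝ, 0 < ε → ∃ δ : ℝ, 0 < δ ∧ ∀ x y : H, ‖x‖ ≤ R → ‖y‖ ≤ R →
    ‖x - y‖ < δ → hsNorm e (fderiv ℝ (gradient φ) x - fderiv ℝ (gradient φ) y) ≤ ENNReal.ofReal ε

end Scheme

/-! ### Poisson random measures and stochastic integrals -/

section Noise

variable {Ω : Type*} [MeasurableSpace Ω]

/-- `π` is a Poisson random measure on `X` with reference (intensity) measure `μ`. -/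
structure IsPoissonRandomMeasure {X : Type*} [MeasurableSpace X] (P : Measure Ω)
    (π : Ω → Measure X) (μ : Measure X) : Prop where
  measurable : ∀ B, MeasurableSet B → Measurable fun ω => π ω B
  law : ∀ B, MeasurableSet B → μ B ≠ ∞ →
    P.map (fun ω => π ω B) = (poissonMeasure (μ B).toNNReal).map fun n : ℕ => (n : ℝ≥0∞)
  indep : ∀ (n : ℕ) (B : Fin n → Set X), (∀ i, MeasurableSet (B i)) →
    (Pairwise fun i j => Disjoint (B i) (B j)) → iIndepFun (fun i ω => π ω (B i)) P

/-- The reference measure `dt dξ ν(dσ)` on `[0,∞) × O × ℝ`, as a measure on `ℝ × ℝ^d × ℝ`. -/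
def refMeasure {d : ℕ} (O : Opens (Pt d)) (ν : Measure ℝ) : Measure (ℝ × Pt d × ℝ) :=
  (volume.restrict (Set.Ici 0)).prod ((volume.restrict (O : Set (Pt d))).prod ν)

/-- `I` is (a version of) the `L²`-stochastic integral `∫ f d(π - μ)`: the `L²(P)`-limit of the
elementary integrals `∑_a a (π(g = a) - μ(g = a))` of simple functions `g` (taking nonzero values
only on sets of finite `μ`-measure) which converge to `f` in `L²(μ)`. -/
def IsCompensatedIntegral {X F : Type*} [MeasurableSpace X] [NormedAddCommGroup F]
    [NormedSpace ℝ F] (P : Measure Ω) (π : Ω → Measure X) (μ : Measure X)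
    (f : X → F) (I : Ω → F) : Prop :=
  MemLp f 2 μ ∧ MemLp I 2 P ∧ ∃ g : ℕ → SimpleFunc X F, (∀ n, Integrable (g n) μ) ∧
    Tendsto (fun n => eLpNorm (fun x => f x - g n x) 2 μ) atTop (𝓝 0) ∧
    Tendsto (fun n => eLpNorm (fun ω => I ω - ((g n).integral (π ω) - (g n).integral μ)) 2 P)
      atTop (𝓝 0)

/-- The set `[0,t] × ℝ^d × J` of (time, place, size) of jumps. -/
def jumpSet (d : ℕ) (t : ℝ) (J : Set ℝ) : Set (ℝ × Pt d × ℝ) :=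
  Set.Icc 0 t ×ˢ (Set.univ ×ˢ J)

/-- `M` is the `H^{-s}(O)`-valued impulsive cylindrical process built from the jumps of `π` with
sizes in `J`: for `t ∈ [0,T]`, `M_t = ∑ₖ M^{(k)}_t bₖ` as a limit in `L²(P; H^{-s}(O))`, where
`M^{(k)}_t = ∫_{[0,t] × O × J} bₖ(ξ) σ (π - μ)(ds, dξ, dσ)`. -/
def IsImpulsiveCylindrical {d : ℕ} (O : Opens (Pt d)) {s : ℝ} (hs : (d : ℝ) / 2 < s)
    (ν : Measure ℝ) (P : Measure Ω) (π : Ω → Measure (ℝ × Pt d × ℝ))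
    (b : HilbertBasis ℕ ℝ (L2 O)) (J : Set ℝ) (T : ℝ) (M : ℝ → Ω → NegSobolev O s) : Prop :=
  ∀ t ∈ Set.Icc 0 T, MemLp (M t) 2 P ∧ ∃ Z : ℕ → Ω → ℝ,
    (∀ k, IsCompensatedIntegral P π (refMeasure O ν)
      ((jumpSet d t J).indicator fun x => b k x.2.1 * x.2.2) (Z k)) ∧
    Tendsto (fun n => eLpNorm
      (fun ω => M t ω - ∑ k ∈ Finset.range n, Z k ω • toNegSobolev O hs (b k)) 2 P) atTop (𝓝 0)

/-- `I` is (a version of) `∫_0^t Φ(s) dM_s` for the impulsive cylindrical process `M` built from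
the jumps of `π` with sizes in `J`, i.e. the limit in `L²(P; H)` of
`∑_{k<n} ∫_0^t Φ(s) bₖ dM^{(k)}_s`, where
`∫_0^t Φ(s) bₖ dM^{(k)}_s = ∫_{[0,t] × O × J} bₖ(ξ) σ Φ(s) bₖ (π - μ)(ds, dξ, dσ)`. -/
def IsCylindricalIntegral {d : ℕ} (O : Opens (Pt d))
    (ν : Measure ℝ) (P : Measure Ω) (π : Ω → Measure (ℝ × Pt d × ℝ))
    (b : HilbertBasis ℕ ℝ (L2 O)) (J : Set ℝ) (t : ℝ) (Φ : ℝ → L2 O →L[ℝ] L2 O)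
    (I : Ω → L2 O) : Prop :=
  MemLp I 2 P ∧ ∃ Z : ℕ → Ω → L2 O,
    (∀ k, IsCompensatedIntegral P π (refMeasure O ν)
      ((jumpSet d t J).indicator fun x => (b k x.2.1 * x.2.2) • Φ x.1 (b k)) (Z k)) ∧
    Tendsto (fun n => eLpNorm (fun ω => I ω - ∑ k ∈ Finset.range n, Z k ω) 2 P) atTop (𝓝 0)

/-- The `H^{-s}(O)`-valued compound Poisson process `t ↦ ∑_{T_j ≤ t, Σ_j ∈ J} Σ_j δ_{Ξ_j}`, where
`(T_j, Ξ_j, Σ_j)` are the atoms of `π`, written as an integral with respect to `π`. -/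
def jumpProcess {d : ℕ} (O : Opens (Pt d)) {s : ℝ} (hs : (d : ℝ) / 2 < s)
    (π : Ω → Measure (ℝ × Pt d × ℝ)) (J : Set ℝ) (t : ℝ) (ω : Ω) : NegSobolev O s :=
  ∫ x in jumpSet d t J, x.2.2 • diracDelta O hs x.2.1 ∂(π ω)

/-- `X` is the mild solution of `dX + A X dt = Q^{1/2} (dM + dP)`, `X_0 = x₀`, on `[0,T]`, where `M`
collects the compensated jumps of size at most one and `P` the jumps of size larger than one:
`X_t = S(t) x₀ + ∫_0^t S(t-s) Q^{1/2} dM_s + ∑_{T_j ≤ t, |Σ_j| > 1} S(t-T_j) Q^{1/2} (Σ_j δ_{Ξ_j})`.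
Here `R` is `Q^{1/2} : H → H` and `Rext` its extension to `H^{-s}(O)`. -/
def IsMildSolution {d : ℕ} (O : Opens (Pt d)) {s : ℝ} (hs : (d : ℝ) / 2 < s)
    (e : HilbertBasis ℕ ℝ (L2 O)) (lam : ℕ → ℝ) (R : L2 O →L[ℝ] L2 O)
    (Rext : NegSobolev O s →L[ℝ] L2 O) (ν : Measure ℝ) (P : Measure Ω)
    (π : Ω → Measure (ℝ × Pt d × ℝ)) (b : HilbertBasis ℕ ℝ (L2 O)) (x₀ : L2 O) (T : ℝ)
    (X : ℝ → Ω → L2 O) : Prop :=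
  ∀ t ∈ Set.Icc 0 T, ∃ I : Ω → L2 O,
    IsCylindricalIntegral O ν P π b (Set.Icc (-1) 1) t
      (fun r => heatSemigroup e lam (t - r) ∘L R) I ∧
    X t =ᵐ[P] fun ω => heatSemigroup e lam t x₀ + I ω +
      ∫ x in jumpSet d t {σ | 1 < |σ|},
        heatSemigroup e lam (t - x.1) (Rext (x.2.2 • diracDelta O hs x.2.1)) ∂(π ω)

/-- The first time in `[0,T]` at which a jump of absolute size larger than `m` has occurred
(`inf ∅ = ∞`). -/
def bigJumpTime (d : ℕ) (π : Ω → Measure (ℝ × Pt d × ℝ)) (T m : ℝ) (ω : Ω) : EReal :=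
  sInf {a : EReal | ∃ t ∈ Set.Icc 0 T, a = (t : EReal) ∧ 0 < π ω (jumpSet d t {σ | m < |σ|})}

/-- `P` stopped at the first jump of absolute size larger than `m`. -/
def stoppedJumpProcess {d : ℕ} (O : Opens (Pt d)) {s : ℝ} (hs : (d : ℝ) / 2 < s)
    (π : Ω → Measure (ℝ × Pt d × ℝ)) (T m : ℝ) (t : ℝ) (ω : Ω) : NegSobolev O s :=
  jumpProcess O hs π {σ | 1 < |σ|} (min (t : EReal) (bigJumpTime d π T m ω)).toReal ω

/-- `P` with all jumps of absolute size larger than `m` removed. -/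
def truncatedJumpProcess {d : ℕ} (O : Opens (Pt d)) {s : ℝ} (hs : (d : ℝ) / 2 < s)
    (π : Ω → Measure (ℝ × Pt d × ℝ)) (m : ℝ) (t : ℝ) (ω : Ω) : NegSobolev O s :=
  jumpProcess O hs π {σ | 1 < |σ| ∧ |σ| ≤ m} t ω

/-- The mean `u_m = ∫_{O × ([-m,m] ∖ [-1,1])} σ δ_ξ dξ ν(dσ)` per unit time of the jumps with
`1 < |σ| ≤ m`. -/
def meanJump {d : ℕ} (O : Opens (Pt d)) {s : ℝ} (hs : (d : ℝ) / 2 < s) (ν : Measure ℝ) (m : ℝ) :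
    NegSobolev O s :=
  ∫ x in Set.univ ×ˢ {σ : ℝ | 1 < |σ| ∧ |σ| ≤ m}, x.2 • diracDelta O hs x.1
    ∂((volume.restrict (O : Set (Pt d))).prod ν)

end Noise

end

/-!
The noise has jumps of finite variation, `∫ min(|σ|, 1) dν < ∞`. For such a noise the error in
`L¹(ℙ; H)` already has the weak rate `h^{2γ} + Δt^γ`, so that only the boundedness and the Lipschitz
continuity of `φ` are needed.

Unless a jump larger than `m` occurs, which has probability at most
`min(T λ(O) ν(ℝ \ [-m, m]), 1)` (`measure_ne_zero_le`) and costs at most `2 ‖φ‖_∞`, the solution and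
the scheme see the same jumps, and the drift `u_m` cancels. A compensated integral of an integrable
function is the difference of two Bochner integrals (`ae_eq_of_isCompensatedIntegral`, by the `L²`
isometry). By Campbell's formula (`lintegral_lintegral`) the remaining error of the stochastic
convolutions is therefore at most twice
`∫_{[-m,m]} |σ| ν(dσ) ∫_0^T ∫_O ‖E(r) Q^{1/2} δ_ξ‖ dξ dr`,
where `E(r)` is the difference between the operators by which a jump at time `r` enters the scheme
and the solution at time `T` (`stepError`). The small jumps are defined through an orthonormal basis;
for them the estimate is applied to partial sums of the expansion of `δ_ξ`
(`lintegral_enorm_smallJumps_le`, `lintegral_enorm_largeJumps_le`).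

By the Cauchy-Schwarz inequality it remains to bound `∫_O ‖E Q^{1/2} δ_ξ‖² dξ`, which is the squared
Hilbert-Schmidt norm of `E Q^{1/2}` (`lintegral_norm_sq_ext_diracDelta`). Since `A^β Q` is bounded,
`‖Q^{1/2} x‖ ≤ c ‖A^{-β/2} x‖` (`norm_sq_le_of_rpow_comp_bounded`), and the Hilbert-Schmidt norm of
`E A^{-β/2}`, called `weightedHS`, takes its place. The decisive estimate
`exists_weightedHS_step_sub_le` says that its square is at most
`C (h^{2γ} + Δt^γ)² t^{-(2γ + α - β)}`, `t = T - r`. The square root is integrable on `[0, T]`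
because `γ + (α - β)/2 < 1`.

The estimate is proved separately for space and time.
* Space (`exists_weightedHS_semigroupError_le`): with `E_t = S_h(t) P_h - S(t)` one has
  `E_t = E_{t/2} S(t/2) + S_h(t/2) P_h E_{t/2}`, where `‖E_{t/2}‖` is small by assumption and the
  semigroups are Hilbert-Schmidt because `A^{-α}` has finite trace. The trace of `A_h^{-α}` is at most
  that of `A^{-α}`, by Jensen's inequality for the spectral measures of the eigenvectors of `A_h`.
* Time: the error is diagonal in a basis of eigenvectors of `A_h`, and one is left with the scalar
  function `thetaError`. It is of the order of the step size on low modes, and as `θ > 1/2` the scheme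
  is damped on high modes.
-/


/-! ### The rational stability function of the `θ`-scheme -/

/-- The factor `r(z) = (1 - (1 - θ) z) / (1 + θ z)` by which one step of the `θ`-scheme multiplies
an eigenvector whose eigenvalue times the step size is `z`. -/
noncomputable def thetaRat (θ z : ℝ) : ℝ := (1 - (1 - θ) * z) / (1 + θ * z)

theorem exists_one_add_pow_mul_exp_neg_le (k : ℕ) {c : ℝ} (hc : 0 < c) :
    ∃ K : ℝ, 0 < K ∧ ∀ w : ℝ, 0 ≤ w → (1 + w) ^ k * Real.exp (-(c * w)) ≤ K := by
  refine ⟨k.factorial / c ^ k * Real.exp c, by positivity, fun w hw => ?_⟩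
  have h := Real.pow_div_factorial_le_exp (c * (1 + w)) (by positivity) k
  rw [mul_pow, div_le_iff₀ (by positivity)] at h
  have h2 : Real.exp (c * (1 + w)) * Real.exp (-(c * w)) = Real.exp c := by
    rw [← Real.exp_add]; congr 1; ring
  rw [div_mul_eq_mul_div, le_div_iff₀ (by positivity)]
  calc (1 + w) ^ k * Real.exp (-(c * w)) * c ^ k
      = (c ^ k * (1 + w) ^ k) * Real.exp (-(c * w)) := by ring
    _ ≤ (Real.exp (c * (1 + w)) * k.factorial) * Real.exp (-(c * w)) := by gcongr
    _ = k.factorial * Real.exp c := by rw [mul_right_comm, h2]; ring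

theorem exists_nat_pow_mul_pow_le (k : ℕ) {r : ℝ} (h0 : 0 ≤ r) (h1 : r < 1) :
    ∃ K : ℝ, 0 < K ∧ ∀ n : ℕ, (n : ℝ) ^ k * r ^ n ≤ K := by
  obtain ⟨K, hK⟩ := (tendsto_pow_const_mul_const_pow_of_abs_lt_one k
    (by rwa [abs_of_nonneg h0])).bddAbove_range
  exact ⟨max K 1, by positivity, fun n => (hK ⟨n, rfl⟩).trans (le_max_left _ _)⟩

theorem thetaRat_eq {θ z : ℝ} (hθ : 0 ≤ θ) (hz : 0 ≤ z) :
    thetaRat θ z = 1 - z / (1 + θ * z) := by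
  have : (1 + θ * z) ≠ 0 := by positivity
  rw [thetaRat]; field_simp; ring

theorem abs_thetaRat_le_exp {θ z : ℝ} (hθ : θ ∈ Set.Ioc (1 / 2 : ℝ) 1) (hz : 0 ≤ z)
    (hz1 : z ≤ 1) : |thetaRat θ z| ≤ Real.exp (-(z / 2)) := by
  obtain ⟨h1, h2⟩ := hθ
  have h3 : 0 < 1 + θ * z := by nlinarith
  have h4 : 0 ≤ thetaRat θ z := div_nonneg (by nlinarith) h3.le
  rw [abs_of_nonneg h4, thetaRat_eq (by linarith) hz]
  have h5 : z / 2 ≤ z / (1 + θ * z) := by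
    gcongr; nlinarith
  have := Real.add_one_le_exp (-(z / 2))
  linarith

theorem abs_thetaRat_sub_exp_le {θ z : ℝ} (hθ : θ ∈ Set.Ioc (1 / 2 : ℝ) 1) (hz : 0 ≤ z)
    (hz1 : z ≤ 1) : |thetaRat θ z - Real.exp (-z)| ≤ 2 * z ^ 2 := by
  obtain ⟨h1, h2⟩ := hθ
  have h3 : 0 < 1 + θ * z := by nlinarith
  have h4 := Real.abs_exp_sub_one_sub_id_le (x := -z) (by rw [abs_neg, abs_of_nonneg hz]; exact hz1)
  have h5 : |z - z / (1 + θ * z)| ≤ z ^ 2 := by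
    have : z - z / (1 + θ * z) = θ * z ^ 2 / (1 + θ * z) := by field_simp; ring
    rw [this, abs_of_nonneg (by positivity), div_le_iff₀ h3]
    have h6 : 0 ≤ θ * z := by positivity
    nlinarith [sq_nonneg z]
  have h6 : thetaRat θ z - Real.exp (-z) =
      (z - z / (1 + θ * z)) - (Real.exp (-z) - 1 - -z) := by
    rw [thetaRat_eq (by linarith) hz]; ring
  rw [h6]
  refine (abs_sub _ _).trans ?_
  rw [neg_sq] at h4
  linarith

/-- For `z ≤ 1` the consistency error is transported by the stability of the scheme. -/
theorem abs_thetaRat_pow_sub_exp_le {θ z : ℝ} (hθ : θ ∈ Set.Ioc (1 / 2 : ℝ) 1) (hz : 0 ≤ z)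
    (hz1 : z ≤ 1) (n : ℕ) :
    |thetaRat θ z ^ n - Real.exp (-(n * z))| ≤ 4 * n * z ^ 2 * Real.exp (-(n * z / 2)) := by
  rcases Nat.eq_zero_or_pos n with rfl | hn
  · simp
  have h1 := abs_pow_sub_pow_le (thetaRat θ z) (Real.exp (-z)) n
  have h2 : max |thetaRat θ z| |Real.exp (-z)| ≤ Real.exp (-(z / 2)) := by
    refine max_le (abs_thetaRat_le_exp hθ hz hz1) ?_
    rw [abs_of_pos (Real.exp_pos _)]
    exact Real.exp_le_exp.2 (by linarith)
  have h3 : Real.exp (-(z / 2)) ^ (n - 1) ≤ 2 * Real.exp (-(n * z / 2)) := by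
    have h4 : Real.exp (-(z / 2)) ^ (n - 1) = Real.exp (z / 2) * Real.exp (-(n * z / 2)) := by
      rw [← Real.exp_nat_mul, ← Real.exp_add, Nat.cast_sub hn]; congr 1; push_cast; ring
    rw [h4]
    gcongr
    have h5 : Real.exp (1 / 2) ^ 2 ≤ 2 ^ 2 := by
      rw [← Real.exp_nat_mul]
      have := Real.exp_one_lt_d9
      norm_num at this ⊢; linarith
    exact (Real.exp_le_exp.2 (by linarith)).trans ((sq_le_sq₀ (by positivity) (by norm_num)).1 h5)
  rw [← Real.exp_nat_mul, mul_neg] at h1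
  refine h1.trans ?_
  calc |thetaRat θ z - Real.exp (-z)| * n * max |thetaRat θ z| |Real.exp (-z)| ^ (n - 1)
      ≤ (2 * z ^ 2) * n * (2 * Real.exp (-(n * z / 2))) := by
        gcongr
        · exact abs_thetaRat_sub_exp_le hθ hz hz1
        · exact (pow_le_pow_left₀ (by positivity) h2 _).trans h3
    _ = _ := by ring

/-- The bound of the stability function away from `0`; it is less than one because `θ > 1/2`. -/
noncomputable def thetaDamping (θ : ℝ) : ℝ := max ((1 - θ) / θ) (1 / 2)

theorem thetaDamping_nonneg (θ : ℝ) : 0 ≤ thetaDamping θ :=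
  le_trans (by norm_num) (le_max_right _ _)

theorem thetaDamping_lt_one {θ : ℝ} (hθ : θ ∈ Set.Ioc (1 / 2 : ℝ) 1) : thetaDamping θ < 1 := by
  obtain ⟨h1, h2⟩ := hθ
  refine max_lt ?_ (by norm_num)
  rw [div_lt_one (by linarith)]; linarith

theorem abs_thetaRat_le_thetaDamping {θ z : ℝ} (hθ : θ ∈ Set.Ioc (1 / 2 : ℝ) 1) (hz : 1 ≤ z) :
    |thetaRat θ z| ≤ thetaDamping θ := by
  obtain ⟨h1, h2⟩ := hθ
  have h0 : 0 < θ := by linarith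
  have h3 : 0 < 1 + θ * z := by positivity
  rw [abs_le, thetaRat]
  constructor
  · have h4 : (1 - θ) / θ ≤ thetaDamping θ := le_max_left _ _
    have h5 : -((1 - θ) / θ) ≤ (1 - (1 - θ) * z) / (1 + θ * z) := by
      rw [← neg_div, div_le_div_iff₀ h0 h3]; nlinarith
    linarith
  · refine le_trans ?_ (le_max_right _ _)
    rw [div_le_div_iff₀ h3 (by norm_num)]; nlinarith

/-- The nonsmooth data estimate for the scheme without spatial discretization. -/
theorem exists_abs_thetaRat_pow_sub_exp_le {θ : ℝ} (hθ : θ ∈ Set.Ioc (1 / 2 : ℝ) 1) :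
    ∃ C : ℝ, 0 < C ∧ ∀ (z : ℝ) (n : ℕ), 0 ≤ z → 1 ≤ n →
      |thetaRat θ z ^ n - Real.exp (-(n * z))| ≤ C / n := by
  obtain ⟨K1, hK1, h1⟩ := exists_one_add_pow_mul_exp_neg_le 2 (c := 1 / 2) (by norm_num)
  obtain ⟨K2, hK2, h2⟩ := exists_nat_pow_mul_pow_le 1 (thetaDamping_nonneg θ)
    (thetaDamping_lt_one hθ)
  refine ⟨4 * K1 + K2 + 1, by positivity, fun z n hz hn => ?_⟩
  have hn0 : (0 : ℝ) < n := by exact_mod_cast hn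
  rw [le_div_iff₀ hn0]
  rcases le_total z 1 with hz1 | hz1
  · have h3 := abs_thetaRat_pow_sub_exp_le hθ hz hz1 n
    have h4 := h1 (n * z) (by positivity)
    have h5 : (n * z) ^ 2 * Real.exp (-(1 / 2 * (n * z))) ≤ K1 := by
      refine le_trans ?_ h4
      gcongr; linarith
    have h6 : Real.exp (-(1 / 2 * (n * z))) = Real.exp (-(n * z / 2)) := by congr 1; ring
    rw [h6] at h5
    nlinarith
  · have h3 : |thetaRat θ z ^ n| ≤ thetaDamping θ ^ n := by
      rw [abs_pow]
      exact pow_le_pow_left₀ (abs_nonneg _) (abs_thetaRat_le_thetaDamping hθ hz1) _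
    have h4 := h2 n
    have h5 : Real.exp (-(n * z)) * n ≤ 1 := by
      have h6 : (n : ℝ) ≤ Real.exp (n * z) := by
        have := Real.add_one_le_exp ((n : ℝ) * z); nlinarith
      rw [Real.exp_neg, inv_mul_le_iff₀ (Real.exp_pos _)]; linarith
    have h7 := abs_sub (thetaRat θ z ^ n) (Real.exp (-(n * z)))
    rw [abs_of_pos (Real.exp_pos _)] at h7
    rw [pow_one] at h4
    nlinarith

theorem inv_one_add_mul_bounds {θ z : ℝ} (hθ : θ ∈ Set.Ioc (1 / 2 : ℝ) 1) (hz : 0 < z) :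
    0 < (1 + θ * z)⁻¹ ∧ (1 + θ * z)⁻¹ ≤ 1 ∧ z * (1 + θ * z)⁻¹ ≤ 2 ∧ 1 - z ≤ (1 + θ * z)⁻¹ := by
  obtain ⟨h1, h2⟩ := hθ
  have h3 : 0 < θ * z := by nlinarith
  refine ⟨by positivity, inv_le_one_of_one_le₀ (by linarith), ?_, ?_⟩
  · rw [← div_eq_mul_inv, div_le_iff₀ (by positivity)]; nlinarith
  · rw [← one_div, le_div_iff₀ (by positivity)]; nlinarith

/-- The error on one eigenvector, `z` being its eigenvalue times the step size: the difference between
the factor `r(z)^n (1 + θ z)⁻¹` with which the scheme propagates the noise, and `e^{-s z}`. The time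
`s` is measured in units of the step size; the two factors correspond to each other for
`n ≤ s ≤ n + 1`. -/
noncomputable def thetaError (θ z s : ℝ) (n : ℕ) : ℝ :=
  thetaRat θ z ^ n * (1 + θ * z)⁻¹ - Real.exp (-(s * z))

theorem thetaError_sq_le (θ z s : ℝ) (n : ℕ) :
    thetaError θ z s n ^ 2 ≤
      2 * (thetaRat θ z ^ n * (1 + θ * z)⁻¹) ^ 2 + 2 * Real.exp (-(2 * (s * z))) := by
  have : Real.exp (-(2 * (s * z))) = Real.exp (-(s * z)) ^ 2 := by
    rw [← Real.exp_nat_mul]; congr 1; push_cast; ring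
  rw [this, thetaError]
  nlinarith [sq_nonneg (thetaRat θ z ^ n * (1 + θ * z)⁻¹ + Real.exp (-(s * z)))]

/-- During the first step there is no convergence, but the factor `(1 + θ z)⁻¹` provides the same
smoothing as the semigroup. -/
theorem exists_thetaError_sq_le_of_lt_one {θ : ℝ} (hθ : θ ∈ Set.Ioc (1 / 2 : ℝ) 1) :
    ∃ C : ℝ, 0 < C ∧ ∀ z s : ℝ, 0 < z → 0 < s → s < 1 →
      (1 + s * z) * thetaError θ z s 0 ^ 2 ≤ C := by
  obtain ⟨K, hK, h1⟩ := exists_one_add_pow_mul_exp_neg_le 1 (c := 2) (by norm_num)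
  refine ⟨6 + 2 * K, by positivity, fun z s hz hs hs1 => ?_⟩
  obtain ⟨t1, t2, t3, -⟩ := inv_one_add_mul_bounds hθ hz
  have h2 := thetaError_sq_le θ z s 0
  rw [pow_zero, one_mul] at h2
  have h3 := h1 (s * z) (by positivity)
  rw [pow_one] at h3
  set τ := (1 + θ * z)⁻¹
  have h4 : (1 + s * z) * τ ^ 2 ≤ 3 := by
    have e1 : (1 + s * z) ≤ 1 + z := by nlinarith
    calc (1 + s * z) * τ ^ 2 ≤ (1 + z) * τ ^ 2 := by gcongr
      _ = τ * τ + (z * τ) * τ := by ring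
      _ ≤ 1 * 1 + 2 * 1 := by gcongr
      _ = 3 := by norm_num
  calc (1 + s * z) * thetaError θ z s 0 ^ 2
      ≤ (1 + s * z) * (2 * τ ^ 2 + 2 * Real.exp (-(2 * (s * z)))) := by gcongr
    _ = 2 * ((1 + s * z) * τ ^ 2) + 2 * ((1 + s * z) * Real.exp (-(2 * (s * z)))) := by ring
    _ ≤ _ := by linarith

/-- On low modes the error is of the order of the step size. -/
theorem abs_thetaError_le {θ z s : ℝ} {n : ℕ} (hθ : θ ∈ Set.Ioc (1 / 2 : ℝ) 1) (hz : 0 < z)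
    (hz1 : z ≤ 1) (hn : 1 ≤ n) (hns : n ≤ s) (hsn : s ≤ n + 1) :
    |thetaError θ z s n| ≤ z * (1 + 4 * (s * z)) * Real.exp (-(s * z / 4)) := by
  obtain ⟨t1, t2, t3, t4⟩ := inv_one_add_mul_bounds hθ hz
  have hn1 : (1 : ℝ) ≤ n := by exact_mod_cast hn
  have hnz : n * z ≤ s * z := by gcongr
  have hsz : s * z ≤ 2 * (n * z) := by nlinarith
  have h6 := abs_thetaRat_pow_sub_exp_le hθ hz.le hz1 n
  have h7 : Real.exp (-(n * z / 2)) ≤ Real.exp (-(s * z / 4)) :=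
    Real.exp_le_exp.2 (by linarith)
  have h8 : Real.exp (-(n * z)) ≤ Real.exp (-(s * z / 4)) :=
    Real.exp_le_exp.2 (by nlinarith)
  have h9 : |(1 + θ * z)⁻¹ - Real.exp (-((s - n) * z))| ≤ z := by
    have h11 : 1 - z ≤ Real.exp (-((s - n) * z)) := by
      have := Real.add_one_le_exp (-((s - n) * z)); nlinarith
    have h12 : Real.exp (-((s - n) * z)) ≤ 1 :=
      Real.exp_le_one_iff.2 (by nlinarith)
    rw [abs_le]; constructor <;> linarith
  have h13 : thetaError θ z s n = (thetaRat θ z ^ n - Real.exp (-(n * z))) * (1 + θ * z)⁻¹ +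
      Real.exp (-(n * z)) * ((1 + θ * z)⁻¹ - Real.exp (-((s - n) * z))) := by
    have : Real.exp (-(s * z)) = Real.exp (-(n * z)) * Real.exp (-((s - n) * z)) := by
      rw [← Real.exp_add]; congr 1; ring
    rw [thetaError, this]; ring
  set τ := (1 + θ * z)⁻¹
  calc |thetaError θ z s n| ≤ |thetaRat θ z ^ n - Real.exp (-(n * z))| * |τ| +
        |Real.exp (-(n * z))| * |τ - Real.exp (-((s - n) * z))| := by
        rw [h13, ← abs_mul, ← abs_mul]; exact abs_add_le _ _
    _ ≤ (4 * n * z ^ 2 * Real.exp (-(s * z / 4))) * 1 + Real.exp (-(s * z / 4)) * z := by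
        rw [abs_of_pos t1, abs_of_pos (Real.exp_pos _)]
        gcongr
        exact h6.trans (by gcongr)
    _ = z * (1 + 4 * (n * z)) * Real.exp (-(s * z / 4)) := by ring
    _ ≤ _ := by gcongr

theorem exists_thetaError_sq_le_of_le_one {θ : ℝ} (hθ : θ ∈ Set.Ioc (1 / 2 : ℝ) 1) :
    ∃ C : ℝ, 0 < C ∧ ∀ (z s : ℝ) (n : ℕ), 0 < z → z ≤ 1 → 1 ≤ n → n ≤ s → s ≤ n + 1 →
      s ^ 2 * ((1 + s * z) * thetaError θ z s n ^ 2) ≤ C := by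
  obtain ⟨K, hK, h1⟩ := exists_one_add_pow_mul_exp_neg_le 5 (c := 1 / 2) (by norm_num)
  refine ⟨16 * K, by positivity, fun z s n hz hz1 hn hns hsn => ?_⟩
  have hs : 0 ≤ s := le_trans (by positivity) hns
  have h5 := abs_thetaError_le hθ hz hz1 hn hns hsn
  have hw : 0 ≤ s * z := by positivity
  have h0 := h1 (s * z) hw
  have h6 : thetaError θ z s n ^ 2 ≤
      (z * (1 + 4 * (s * z))) ^ 2 * Real.exp (-(1 / 2 * (s * z))) := by
    have : Real.exp (-(1 / 2 * (s * z))) = Real.exp (-(s * z / 4)) ^ 2 := by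
      rw [← Real.exp_nat_mul]; congr 1; push_cast; ring
    rw [this, ← mul_pow, ← sq_abs]
    exact pow_le_pow_left₀ (abs_nonneg _) h5 2
  calc s ^ 2 * ((1 + s * z) * thetaError θ z s n ^ 2)
      ≤ s ^ 2 * ((1 + s * z) *
          ((z * (1 + 4 * (s * z))) ^ 2 * Real.exp (-(1 / 2 * (s * z))))) := by gcongr
    _ = ((s * z) ^ 2 * (1 + s * z) * (1 + 4 * (s * z)) ^ 2) *
          Real.exp (-(1 / 2 * (s * z))) := by ring
    _ ≤ ((1 + s * z) ^ 2 * (1 + s * z) * (4 * (1 + s * z)) ^ 2) *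
          Real.exp (-(1 / 2 * (s * z))) := by
        gcongr
        · linarith
        · linarith
    _ = 16 * ((1 + s * z) ^ 5 * Real.exp (-(1 / 2 * (s * z)))) := by ring
    _ ≤ _ := by gcongr

/-- On high modes both terms are small separately: the scheme is damped geometrically in `n`. -/
theorem exists_thetaError_sq_le_of_one_le {θ : ℝ} (hθ : θ ∈ Set.Ioc (1 / 2 : ℝ) 1) :
    ∃ C : ℝ, 0 < C ∧ ∀ (z s : ℝ) (n : ℕ), 1 ≤ z → 1 ≤ n → n ≤ s → s ≤ n + 1 →
      s ^ 2 * ((1 + s * z) * thetaError θ z s n ^ 2) ≤ C := by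
  obtain ⟨K1, hK1, h1⟩ := exists_one_add_pow_mul_exp_neg_le 3 (c := 2) (by norm_num)
  obtain ⟨K2, hK2, h2⟩ := exists_nat_pow_mul_pow_le 3
    (mul_nonneg (thetaDamping_nonneg θ) (thetaDamping_nonneg θ))
    (mul_lt_one_of_nonneg_of_lt_one_left (thetaDamping_nonneg θ) (thetaDamping_lt_one hθ)
      (thetaDamping_lt_one hθ).le)
  refine ⟨40 * K2 + 2 * K1, by positivity, fun z s n hz1 hn hns hsn => ?_⟩
  have hz : 0 < z := by linarith
  have hn1 : (1 : ℝ) ≤ n := by exact_mod_cast hn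
  have hs : 0 ≤ s := by linarith
  have hs2 : s ≤ 2 * n := by linarith
  have hw : 0 ≤ s * z := by positivity
  obtain ⟨t1, t2, t3, -⟩ := inv_one_add_mul_bounds hθ hz
  have hD := thetaError_sq_le θ z s n
  have h5 : (thetaRat θ z ^ n) ^ 2 ≤ (thetaDamping θ * thetaDamping θ) ^ n := by
    rw [← sq_abs, abs_pow, ← pow_mul, mul_comm n 2, pow_mul, sq]
    have h0 := thetaDamping_nonneg θ
    have := abs_thetaRat_le_thetaDamping hθ hz1
    gcongr
  have h6 := h2 n
  have h3 := h1 (s * z) hw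
  set ρ := (thetaDamping θ * thetaDamping θ) ^ n
  set τ := (1 + θ * z)⁻¹
  have hρ : 0 ≤ ρ := (sq_nonneg _).trans h5
  have e0 : (1 + s * z) * τ ^ 2 ≤ 5 * n := by
    calc (1 + s * z) * τ ^ 2 ≤ (1 + 2 * n * z) * τ ^ 2 := by gcongr
      _ = τ * τ + 2 * n * ((z * τ) * τ) := by ring
      _ ≤ 1 * 1 + 2 * n * (2 * 1) := by gcongr
      _ ≤ _ := by linarith
  have h8 : s ^ 2 * (1 + s * z) * Real.exp (-(2 * (s * z))) ≤ K1 := by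
    refine le_trans ?_ h3
    have e1 : s ≤ 1 + s * z := by nlinarith
    calc s ^ 2 * (1 + s * z) * Real.exp (-(2 * (s * z)))
        ≤ (1 + s * z) ^ 2 * (1 + s * z) * Real.exp (-(2 * (s * z))) := by gcongr
      _ = _ := by ring
  have h9 : s ^ 2 * (1 + s * z) * (thetaRat θ z ^ n * τ) ^ 2 ≤ 20 * K2 := by
    calc s ^ 2 * (1 + s * z) * (thetaRat θ z ^ n * τ) ^ 2
        = s ^ 2 * ((1 + s * z) * τ ^ 2) * (thetaRat θ z ^ n) ^ 2 := by ring
      _ ≤ (2 * n) ^ 2 * (5 * n) * ρ := by gcongr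
      _ = 20 * (n ^ 3 * ρ) := by ring
      _ ≤ _ := by gcongr
  calc s ^ 2 * ((1 + s * z) * thetaError θ z s n ^ 2)
      ≤ s ^ 2 * ((1 + s * z) *
          (2 * (thetaRat θ z ^ n * τ) ^ 2 + 2 * Real.exp (-(2 * (s * z))))) := by gcongr
    _ = 2 * (s ^ 2 * (1 + s * z) * (thetaRat θ z ^ n * τ) ^ 2) +
          2 * (s ^ 2 * (1 + s * z) * Real.exp (-(2 * (s * z)))) := by ring
    _ ≤ _ := by linarith

/-- The scheme converges on each eigenvector with the rate `γ`, at the price of the singularity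
`s ^ (-γ)`; the factor `z ^ a` is absorbed by the smoothing property. -/
theorem exists_rpow_mul_thetaError_sq_le {θ : ℝ} (hθ : θ ∈ Set.Ioc (1 / 2 : ℝ) 1) :
    ∃ C : ℝ, 0 < C ∧ ∀ (a γ z s : ℝ) (n : ℕ), a ∈ Set.Icc (0 : ℝ) 1 → γ ∈ Set.Icc (0 : ℝ) 1 →
      0 < z → 0 < s → n ≤ s → s < n + 1 →
      z ^ a * thetaError θ z s n ^ 2 ≤ C * s ^ (-(2 * γ + a)) := by
  obtain ⟨C1, hC1, h1⟩ := exists_thetaError_sq_le_of_lt_one hθ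
  obtain ⟨C2, hC2, h2⟩ := exists_thetaError_sq_le_of_le_one hθ
  obtain ⟨C3, hC3, h3⟩ := exists_thetaError_sq_le_of_one_le hθ
  refine ⟨C1 + C2 + C3, by positivity, fun a γ z s n ha hγ hz hs hns hsn => ?_⟩
  set D := thetaError θ z s n
  have hw0 : 0 < s * z := by positivity
  -- since `(s * z) ^ a ≤ 1 + s * z`, a bound for `(1 + s * z) * D ^ 2` suffices
  have key : ((1 + s * z) * D ^ 2) ≤ (C1 + C2 + C3) * s ^ (-(2 * γ)) := by
    rcases lt_or_ge s 1 with hs1 | hs1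
    · have hn : n = 0 := by
        have : (n : ℝ) < 1 := lt_of_le_of_lt hns hs1
        exact_mod_cast Nat.lt_one_iff.1 (by exact_mod_cast this)
      subst hn
      have h4 : 1 ≤ s ^ (-(2 * γ)) := Real.one_le_rpow_of_pos_of_le_one_of_nonpos hs hs1.le
        (by linarith [hγ.1])
      have h5 := h1 z s hz hs hs1
      calc (1 + s * z) * D ^ 2 ≤ C1 := h5
        _ ≤ (C1 + C2 + C3) * 1 := by linarith
        _ ≤ _ := by gcongr
    · have hn : 1 ≤ n := by
        have : (0 : ℝ) < n := by linarith
        exact_mod_cast this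
      have h4 : (s ^ 2)⁻¹ ≤ s ^ (-(2 * γ)) := by
        rw [← Real.rpow_natCast, ← Real.rpow_neg hs.le]
        exact Real.rpow_le_rpow_of_exponent_le hs1 (by push_cast; linarith [hγ.2])
      have h5 : s ^ 2 * ((1 + s * z) * D ^ 2) ≤ C1 + C2 + C3 := by
        rcases le_total z 1 with hz1 | hz1
        · have := h2 z s n hz hz1 hn hns hsn.le; linarith
        · have := h3 z s n hz1 hn hns hsn.le; linarith
      calc (1 + s * z) * D ^ 2 = s ^ 2 * ((1 + s * z) * D ^ 2) * (s ^ 2)⁻¹ := by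
            field_simp
        _ ≤ _ := by gcongr
  have hwa : (s * z) ^ a ≤ 1 + s * z := by
    rcases le_total (s * z) 1 with hw1 | hw1
    · exact (Real.rpow_le_one hw0.le hw1 ha.1).trans (by linarith)
    · calc (s * z) ^ a ≤ (s * z) ^ (1 : ℝ) := Real.rpow_le_rpow_of_exponent_le hw1 ha.2
        _ ≤ 1 + s * z := by rw [Real.rpow_one]; linarith
  have hza : z ^ a = (s * z) ^ a * s ^ (-a) := by
    rw [Real.mul_rpow hs.le hz.le, mul_right_comm, ← Real.rpow_add hs]; simp
  calc z ^ a * D ^ 2 = ((s * z) ^ a * D ^ 2) * s ^ (-a) := by rw [hza]; ring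
    _ ≤ ((1 + s * z) * D ^ 2) * s ^ (-a) := by gcongr
    _ ≤ ((C1 + C2 + C3) * s ^ (-(2 * γ))) * s ^ (-a) := by gcongr
    _ = _ := by rw [mul_assoc, ← Real.rpow_add hs]; congr 2; ring

/-! ### Diagonal operators and the semigroup -/

section Diagonal

variable {H : Type*} [NormedAddCommGroup H] [InnerProductSpace ℝ H]

theorem HilbertBasis.ext_inner {ι : Type*} (e : HilbertBasis ι ℝ H) {u v : H}
    (h : ∀ k, ⟪e k, u⟫_ℝ = ⟪e k, v⟫_ℝ) : u = v := by
  apply e.repr.injective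
  ext k
  rw [e.repr_apply_apply, e.repr_apply_apply, h]

theorem HilbertBasis.inner_eq_ite {ι : Type*} [DecidableEq ι] (e : HilbertBasis ι ℝ H) (i j : ι) :
    ⟪e i, e j⟫_ℝ = if i = j then 1 else 0 :=
  (orthonormal_iff_ite.1 e.orthonormal) i j

theorem HilbertBasis.hasSum_inner_sq {ι : Type*} (e : HilbertBasis ι ℝ H) (u : H) :
    HasSum (fun k => ⟪e k, u⟫_ℝ ^ 2) (‖u‖ ^ 2) := by
  have h := e.hasSum_inner_mul_inner u u
  rw [real_inner_self_eq_norm_sq] at h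
  have h0 : (fun k => ⟪e k, u⟫_ℝ ^ 2) = fun k => ⟪u, e k⟫_ℝ * ⟪e k, u⟫_ℝ := by
    ext k; rw [real_inner_comm, sq]
  rwa [h0]

theorem HilbertBasis.tsum_ofReal_inner_sq {ι : Type*} (e : HilbertBasis ι ℝ H) (u : H) :
    ∑' k, ENNReal.ofReal (⟪e k, u⟫_ℝ ^ 2) = ENNReal.ofReal (‖u‖ ^ 2) := by
  rw [← (e.hasSum_inner_sq u).tsum_eq,
    ENNReal.ofReal_tsum_of_nonneg (fun _ => sq_nonneg _) (e.hasSum_inner_sq u).summable]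

theorem inner_diagCLM (e : HilbertBasis ℕ ℝ H) {a : ℕ → ℝ} (h : ∃ C, ∀ k, |a k| ≤ C) (k : ℕ)
    (u : H) : ⟪e k, diagCLM e a u⟫_ℝ = a k * ⟪e k, u⟫_ℝ := by
  have h1 := (diagCLM_hasSum e a h u).mapL (innerSL ℝ (e k))
  simp only [innerSL_apply_apply, inner_smul_right] at h1
  refine h1.unique ?_
  refine (hasSum_ite_eq k (a k * ⟪e k, u⟫_ℝ)).congr_fun fun i => ?_
  rw [e.inner_eq_ite]
  by_cases hi : k = i
  · subst hi; simp
  · simp [hi, Ne.symm hi]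

theorem norm_diagCLM_apply_le (e : HilbertBasis ℕ ℝ H) {a : ℕ → ℝ} {C : ℝ}
    (h : ∀ k, |a k| ≤ C) (u : H) : ‖diagCLM e a u‖ ≤ C * ‖u‖ := by
  have hC : 0 ≤ C := (abs_nonneg _).trans (h 0)
  refine abs_le_of_sq_le_sq' ?_ (by positivity) |>.2
  refine hasSum_le (fun k => ?_) (e.hasSum_inner_sq (diagCLM e a u))
    ((mul_pow C ‖u‖ 2).symm ▸ (e.hasSum_inner_sq u).mul_left (C ^ 2))
  rw [inner_diagCLM e ⟨C, h⟩, mul_pow]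
  exact mul_le_mul_of_nonneg_right
    (sq_le_sq' (by linarith [abs_le.1 (h k)]) (abs_le.1 (h k)).2) (sq_nonneg _)

theorem diagCLM_basis (e : HilbertBasis ℕ ℝ H) {a : ℕ → ℝ} (h : ∃ C, ∀ k, |a k| ≤ C) (k : ℕ) :
    diagCLM e a (e k) = a k • e k := by
  refine e.ext_inner fun i => ?_
  rw [inner_diagCLM e h, inner_smul_right, e.inner_eq_ite]
  split_ifs with hi
  · rw [hi]
  · simp

theorem bounded_exp_neg {lam : ℕ → ℝ} (hlam : ∀ k, 0 < lam k) {t : ℝ} (ht : 0 ≤ t) (k : ℕ) :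
    |Real.exp (-(t * lam k))| ≤ 1 := by
  rw [abs_of_pos (Real.exp_pos _)]
  exact Real.exp_le_one_iff.2 (by have := hlam k; nlinarith)

theorem inner_heatSemigroup (e : HilbertBasis ℕ ℝ H) {lam : ℕ → ℝ} (hlam : ∀ k, 0 < lam k)
    {t : ℝ} (ht : 0 ≤ t) (k : ℕ) (u : H) :
    ⟪e k, heatSemigroup e lam t u⟫_ℝ = Real.exp (-(t * lam k)) * ⟪e k, u⟫_ℝ :=
  inner_diagCLM e ⟨1, bounded_exp_neg hlam ht⟩ k u

theorem heatSemigroup_basis (e : HilbertBasis ℕ ℝ H) {lam : ℕ → ℝ} (hlam : ∀ k, 0 < lam k)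
    {t : ℝ} (ht : 0 ≤ t) (k : ℕ) :
    heatSemigroup e lam t (e k) = Real.exp (-(t * lam k)) • e k :=
  diagCLM_basis e ⟨1, bounded_exp_neg hlam ht⟩ k

theorem norm_heatSemigroup_apply_le (e : HilbertBasis ℕ ℝ H) {lam : ℕ → ℝ}
    (hlam : ∀ k, 0 < lam k) {t : ℝ} (ht : 0 ≤ t) (u : H) : ‖heatSemigroup e lam t u‖ ≤ ‖u‖ := by
  exact (norm_diagCLM_apply_le e (bounded_exp_neg hlam ht) u).trans (one_mul _).le

theorem heatSemigroup_add (e : HilbertBasis ℕ ℝ H) {lam : ℕ → ℝ} (hlam : ∀ k, 0 < lam k)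
    {s t : ℝ} (hs : 0 ≤ s) (ht : 0 ≤ t) (u : H) :
    heatSemigroup e lam (s + t) u = heatSemigroup e lam s (heatSemigroup e lam t u) := by
  refine e.ext_inner fun k => ?_
  rw [inner_heatSemigroup e hlam (add_nonneg hs ht), inner_heatSemigroup e hlam hs,
    inner_heatSemigroup e hlam ht, ← mul_assoc, ← Real.exp_add]
  congr 2; ring

theorem stronglyMeasurable_heatSemigroup (e : HilbertBasis ℕ ℝ H) {lam : ℕ → ℝ}
    (hlam : ∀ k, 0 < lam k) (u : H) :
    StronglyMeasurable fun t : ℝ => heatSemigroup e lam (max t 0) u := by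
  refine stronglyMeasurable_of_tendsto atTop
    (f := fun n t => ∑ k ∈ Finset.range n,
      (Real.exp (-(max t 0 * lam k)) * ⟪e k, u⟫_ℝ) • e k) (fun n => ?_) ?_
  · refine (Continuous.stronglyMeasurable ?_)
    fun_prop
  · rw [tendsto_pi_nhds]
    intro t
    exact (diagCLM_hasSum e _ ⟨1, bounded_exp_neg hlam (le_max_right t 0)⟩ u).tendsto_sum_nat

theorem inner_fracPow {H : Type*} [NormedAddCommGroup H] [InnerProductSpace ℝ H]
    (e : HilbertBasis ℕ ℝ H) (lam : ℕ → ℝ) (r : ℝ) (u : (fracPow e lam r).domain) (k : ℕ) :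
    ⟪e k, fracPow e lam r u⟫_ℝ = lam k ^ r * ⟪e k, (u : H)⟫_ℝ := by
  rw [← e.repr_apply_apply]
  change e.repr (e.repr.symm ⟨fun k => lam k ^ r * ⟪e k, (u : H)⟫_ℝ, u.2⟩) k = _
  rw [LinearIsometryEquiv.apply_symm_apply]

theorem IsEigenbasis.pos {H : Type*} [NormedAddCommGroup H] [InnerProductSpace ℝ H]
    [CompleteSpace H] {A : H →ₗ.[ℝ] H} (hA : IsPositiveCompactType A) {lam : ℕ → ℝ}
    {e : HilbertBasis ℕ ℝ H} (he : IsEigenbasis A lam e) (k : ℕ) : 0 < lam k := by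
  obtain ⟨hk, hAk⟩ := he.eigen k
  have h := hA.pos ⟨e k, hk⟩ fun h0 => by
    have h1 := e.orthonormal.ne_zero k
    exact h1 (congrArg Subtype.val h0)
  rw [hAk, real_inner_smul_left, e.inner_eq_ite, if_pos rfl, mul_one] at h
  exact h

end Diagonal

/-! ### Weighted Hilbert-Schmidt norms -/

section HilbertSchmidt

variable {H : Type*} [NormedAddCommGroup H] [InnerProductSpace ℝ H]

/-- The squared Hilbert-Schmidt norm `∑ₖ wₖ ‖E eₖ‖²` of `E` with weights `w`; for `wₖ = λₖ^{-β}`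
this is the squared Hilbert-Schmidt norm of `E A^{-β/2}`. -/
noncomputable def weightedHS (e : HilbertBasis ℕ ℝ H) (w : ℕ → ℝ) (E : H →L[ℝ] H) : ℝ≥0∞ :=
  ∑' k, ENNReal.ofReal (w k * ‖E (e k)‖ ^ 2)

theorem weightedHS_add_le (e : HilbertBasis ℕ ℝ H) {w : ℕ → ℝ} (hw : ∀ k, 0 ≤ w k)
    (E F : H →L[ℝ] H) :
    weightedHS e w (E + F) ≤ 2 * weightedHS e w E + 2 * weightedHS e w F := by
  rw [weightedHS, weightedHS, weightedHS, ← ENNReal.tsum_mul_left, ← ENNReal.tsum_mul_left,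
    ← ENNReal.tsum_add]
  refine ENNReal.tsum_le_tsum fun k => ?_
  have h2 : (2 : ℝ≥0∞) = ENNReal.ofReal 2 := by simp
  rw [h2, ← ENNReal.ofReal_mul zero_le_two, ← ENNReal.ofReal_mul zero_le_two,
    ← ENNReal.ofReal_add (by have := hw k; positivity) (by have := hw k; positivity)]
  refine ENNReal.ofReal_le_ofReal ?_
  have h3 : ‖(E + F) (e k)‖ ^ 2 ≤ 2 * ‖E (e k)‖ ^ 2 + 2 * ‖F (e k)‖ ^ 2 := by
    have h4 : ‖(E + F) (e k)‖ ≤ ‖E (e k)‖ + ‖F (e k)‖ := norm_add_le _ _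
    have h5 : ‖(E + F) (e k)‖ ^ 2 ≤ (‖E (e k)‖ + ‖F (e k)‖) ^ 2 := by gcongr
    nlinarith [sq_nonneg (‖E (e k)‖ - ‖F (e k)‖)]
  have := mul_le_mul_of_nonneg_left h3 (hw k)
  linarith

variable [CompleteSpace H]

/-- The Hilbert-Schmidt norms of an operator and of its adjoint agree. -/
theorem tsum_norm_sq_eq_adjoint {ι κ : Type*} (b : HilbertBasis ι ℝ H) (f : HilbertBasis κ ℝ H)
    (E : H →L[ℝ] H) :
    ∑' k, ENNReal.ofReal (‖E (b k)‖ ^ 2) =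
      ∑' j, ENNReal.ofReal (‖ContinuousLinearMap.adjoint E (f j)‖ ^ 2) := by
  simp_rw [← f.tsum_ofReal_inner_sq (E _), ← b.tsum_ofReal_inner_sq]
  rw [ENNReal.tsum_comm]
  simp_rw [ContinuousLinearMap.adjoint_inner_right, real_inner_comm]

/-- If `‖R x‖² ≤ c ∑ₖ wₖ ⟨eₖ, x⟩²` then the Hilbert-Schmidt norm of `E R`, in any orthonormal basis,
is controlled by the weighted Hilbert-Schmidt norm of `E`. -/
theorem tsum_norm_comp_sq_le {ι : Type*} (b : HilbertBasis ι ℝ H) (e : HilbertBasis ℕ ℝ H)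
    {w : ℕ → ℝ} (hw : ∀ k, 0 ≤ w k) {R : H →L[ℝ] H} (hR : IsSelfAdjoint R) {c : ℝ≥0∞}
    (hc : ∀ x, ENNReal.ofReal (‖R x‖ ^ 2) ≤ c * ∑' k, ENNReal.ofReal (w k * ⟪e k, x⟫_ℝ ^ 2))
    (E : H →L[ℝ] H) :
    ∑' k, ENNReal.ofReal (‖E (R (b k))‖ ^ 2) ≤ c * weightedHS e w E := by
  have h1 := tsum_norm_sq_eq_adjoint b e (E ∘L R)
  simp only [ContinuousLinearMap.comp_apply] at h1
  have hRa : ContinuousLinearMap.adjoint R = R := hR.adjoint_eq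
  rw [h1, ContinuousLinearMap.adjoint_comp, hRa]
  calc ∑' j, ENNReal.ofReal (‖R (ContinuousLinearMap.adjoint E (e j))‖ ^ 2)
      ≤ ∑' j, c * ∑' k,
          ENNReal.ofReal (w k * ⟪e k, ContinuousLinearMap.adjoint E (e j)⟫_ℝ ^ 2) :=
        ENNReal.tsum_le_tsum fun j => hc _
    _ = c * weightedHS e w E := by
        rw [ENNReal.tsum_mul_left, ENNReal.tsum_comm, weightedHS]
        congr 1
        refine tsum_congr fun k => ?_
        rw [ENNReal.ofReal_mul (hw k), ← e.tsum_ofReal_inner_sq (E (e k)),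
          ← ENNReal.tsum_mul_left]
        refine tsum_congr fun j => ?_
        rw [ENNReal.ofReal_mul (hw k), ContinuousLinearMap.adjoint_inner_right, real_inner_comm]

/-- A real number whose powers `x ^ 2 ^ j` grow at most like `b ^ 2 ^ j` is at most `b`. -/
theorem le_of_pow_two_pow_le {x b c : ℝ} (hb : 0 < b)
    (h : ∀ j : ℕ, x ^ 2 ^ j ≤ c * b ^ 2 ^ j) : x ≤ b := by
  by_contra! hx
  have h1 : 1 < x / b := by rwa [one_lt_div hb]
  obtain ⟨j, hj⟩ := pow_unbounded_of_one_lt c h1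
  have h2 : (x / b) ^ j ≤ (x / b) ^ 2 ^ j := pow_le_pow_right₀ h1.le (Nat.lt_two_pow_self).le
  have h3 : (x / b) ^ 2 ^ j ≤ c := by
    rw [div_pow, div_le_iff₀ (by positivity)]; exact h j
  linarith

/-- If `A^β Q` is bounded for the diagonal operator `A` and `Q = R²` then `‖R A^{β/2}‖` is finite.
The operator `T = A^{β/2} Q A^{β/2}`, cut off to finitely many modes, is symmetric, so that its norm
is determined by the growth of `T ^ m = A^{β/2} Q (A^β Q) ^ (m - 1) A^{β/2}`. -/
theorem norm_sq_le_of_rpow_comp_bounded (e : HilbertBasis ℕ ℝ H) {lam : ℕ → ℝ}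
    (hlam : ∀ k, 0 < lam k) {Q R B : H →L[ℝ] H} (hR : IsSelfAdjoint R) (hRQ : R ∘L R = Q)
    {β : ℝ} (hB : ∀ k x, lam k ^ β * ⟪e k, Q x⟫_ℝ = ⟪e k, B x⟫_ℝ) (x : H) :
    ENNReal.ofReal (‖R x‖ ^ 2) ≤
      ENNReal.ofReal (‖B‖ + 1) * ∑' k, ENNReal.ofReal (lam k ^ (-β) * ⟪e k, x⟫_ℝ ^ 2) := by
  set b : ℝ := ‖B‖ + 1 with hb
  have hb0 : 0 < b := by positivity
  have hcut : ∀ (n : ℕ) (d : ℕ → ℝ), ∃ C, ∀ k, |if k < n then d k else 0| ≤ C := fun n d => by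
    refine ⟨∑ k ∈ Finset.range n, |d k|, fun k => ?_⟩
    split_ifs with hk
    · exact Finset.single_le_sum (f := fun k => |d k|) (fun _ _ => abs_nonneg _)
        (Finset.mem_range.2 hk)
    · simpa using Finset.sum_nonneg fun k _ => abs_nonneg (d k)
  let D : ℕ → ℝ → H →L[ℝ] H := fun n r => diagCLM e fun k => if k < n then lam k ^ r else 0
  have hD : ∀ n r k u, ⟪e k, D n r u⟫_ℝ = (if k < n then lam k ^ r else 0) * ⟪e k, u⟫_ℝ :=
    fun n r k u => inner_diagCLM e (hcut n _) k u
  have hDsymm : ∀ n r, IsSelfAdjoint (D n r) := fun n r => by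
    rw [ContinuousLinearMap.isSelfAdjoint_iff_isSymmetric]
    intro u v
    have h1 := e.hasSum_inner_mul_inner (D n r u) v
    have h2 := e.hasSum_inner_mul_inner u (D n r v)
    refine h1.unique (h2.congr_fun fun k => ?_)
    rw [hD, real_inner_comm, hD, real_inner_comm (e k) u]; ring
  have hRsymm : ∀ u v, ⟪R u, v⟫_ℝ = ⟪u, R v⟫_ℝ :=
    (ContinuousLinearMap.isSelfAdjoint_iff_isSymmetric.1 hR)
  have hQ : ∀ u, Q u = R (R u) := fun u => by rw [← hRQ]; rfl
  -- the cut-off of `A^{β/2} Q A^{β/2}` has norm at most `b`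
  have hT : ∀ n, ‖D n (β / 2) * Q * D n (β / 2)‖ ≤ b := fun n => by
    set Dn := D n (β / 2) with hDn
    have hQs : IsSelfAdjoint Q := by
      have := hR.pow 2
      rw [sq] at this
      rw [← hRQ]
      exact this
    have hTs : IsSelfAdjoint (Dn * Q * Dn) := by
      have := hQs.conjugate_self (hDsymm n (β / 2))
      exact this
    have hDQ : ‖Dn * Dn * Q‖ ≤ b := by
      refine ContinuousLinearMap.opNorm_le_bound _ hb0.le fun u => ?_
      refine le_trans ?_ ((B.le_opNorm u).trans (by gcongr; linarith))
      refine abs_le_of_sq_le_sq' ?_ (norm_nonneg _) |>.2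
      refine hasSum_le (fun k => ?_) (e.hasSum_inner_sq _) (e.hasSum_inner_sq _)
      have h1 : (Dn * Dn * Q) u = Dn (Dn (Q u)) := rfl
      rw [h1, hD, hD]
      split_ifs with hk
      · rw [← mul_assoc, ← Real.rpow_add (hlam k), add_halves, hB]
      · simpa using sq_nonneg _
    have hpow : ∀ m, (Dn * Q * Dn) ^ (m + 1) = Dn * Q * (Dn * Dn * Q) ^ m * Dn := fun m => by
      induction m with
      | zero => simp
      | succ m ih => rw [pow_succ, ih, pow_succ]; simp only [mul_assoc]
    refine le_of_pow_two_pow_le (c := ‖Dn * Q‖ * ‖Dn‖ / b) hb0 fun j => ?_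
    have h1 : ‖Dn * Q * Dn‖ ^ 2 ^ j = ‖(Dn * Q * Dn) ^ 2 ^ j‖ := by
      have := IsSelfAdjoint.nnnorm_pow_two_pow (E := H →L[ℝ] H) hTs j
      exact (congrArg NNReal.toReal this).symm
    obtain ⟨m, hm⟩ : ∃ m, 2 ^ j = m + 1 := ⟨2 ^ j - 1, by have := Nat.two_pow_pos j; omega⟩
    rw [h1, hm, hpow]
    calc ‖Dn * Q * (Dn * Dn * Q) ^ m * Dn‖ ≤ ‖Dn * Q‖ * ‖(Dn * Dn * Q) ^ m‖ * ‖Dn‖ := by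
          refine (norm_mul_le _ _).trans ?_
          gcongr
          exact norm_mul_le _ _
      _ ≤ ‖Dn * Q‖ * b ^ m * ‖Dn‖ := by
          gcongr
          rcases Nat.eq_zero_or_pos m with rfl | hm0
          · rw [pow_zero, pow_zero]
            exact ContinuousLinearMap.norm_id_le
          · exact (norm_pow_le' _ hm0).trans (by gcongr)
      _ = _ := by rw [pow_succ]; field_simp
  have hn : ∀ n, ENNReal.ofReal (‖R (D n 0 x)‖ ^ 2) ≤
      ENNReal.ofReal b * ∑' k, ENNReal.ofReal (lam k ^ (-β) * ⟪e k, x⟫_ℝ ^ 2) := fun n => by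
    set y := D n (-β / 2) x with hy
    have h1 : D n 0 x = D n (β / 2) y := e.ext_inner fun k => by
      rw [hD, hD, hy, hD]
      split_ifs with hk
      · rw [← mul_assoc, ← Real.rpow_add (hlam k)]; congr 2; ring
      · simp
    have h2 : ‖R (D n 0 x)‖ ^ 2 ≤ b * ‖y‖ ^ 2 := by
      have h3 : ‖R (D n 0 x)‖ ^ 2 = ⟪(D n (β / 2) * Q * D n (β / 2)) y, y⟫_ℝ := by
        have h4 : (D n (β / 2) * Q * D n (β / 2)) y = D n (β / 2) (R (R (D n (β / 2) y))) := by
          rw [← hQ]; rfl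
        have h5 : ⟪D n (β / 2) (R (R (D n (β / 2) y))), y⟫_ℝ =
            ⟪R (R (D n (β / 2) y)), D n (β / 2) y⟫_ℝ :=
          ContinuousLinearMap.isSelfAdjoint_iff_isSymmetric.1 (hDsymm n (β / 2)) _ _
        rw [h4, h5, hRsymm, ← h1, real_inner_self_eq_norm_sq]
      rw [h3]
      calc _ ≤ ‖(D n (β / 2) * Q * D n (β / 2)) y‖ * ‖y‖ := real_inner_le_norm _ _
        _ ≤ (b * ‖y‖) * ‖y‖ := by
          gcongr
          exact (ContinuousLinearMap.le_opNorm _ _).trans (by gcongr; exact hT n)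
        _ = _ := by ring
    refine (ENNReal.ofReal_le_ofReal h2).trans ?_
    rw [ENNReal.ofReal_mul hb0.le]
    gcongr
    rw [← e.tsum_ofReal_inner_sq]
    refine ENNReal.tsum_le_tsum fun k => ENNReal.ofReal_le_ofReal ?_
    rw [hy, hD]
    split_ifs with hk
    · rw [mul_pow, ← Real.rpow_natCast, ← Real.rpow_mul (hlam k).le]
      apply le_of_eq; congr 2; push_cast; ring
    · have := Real.rpow_nonneg (hlam k).le (-β)
      rw [zero_mul, zero_pow two_ne_zero]
      positivity
  refine le_of_tendsto' (f := fun n : ℕ => ENNReal.ofReal (‖R (D n 0 x)‖ ^ 2)) (x := atTop) ?_ hn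
  have h5 : ∀ n, D n 0 x = ∑ k ∈ Finset.range n, ⟪e k, x⟫_ℝ • e k := fun n =>
    e.ext_inner fun k => by
      rw [hD, inner_sum]
      simp only [inner_smul_right, e.inner_eq_ite, Real.rpow_zero]
      simp
  have h6 : Tendsto (fun n => D n 0 x) atTop (𝓝 x) := by
    simp_rw [h5, ← e.repr_apply_apply]
    exact (e.hasSum_repr x).tendsto_sum_nat
  exact ENNReal.tendsto_ofReal (((R.continuous.tendsto _).comp h6).norm.pow 2)

end HilbertSchmidt

/-! ### Spectral decomposition of the discrete operators -/

section Discrete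

variable {H : Type*} [NormedAddCommGroup H] [InnerProductSpace ℝ H]

/-- The operator `G P` on `H`, where `G` acts on `V` and `P` is the orthogonal projection onto
`V`. -/
noncomputable def liftOp (V : Submodule ℝ H) [FiniteDimensional ℝ V] (G : V →L[ℝ] V) : H →L[ℝ] H :=
  V.subtypeL ∘L G ∘L V.orthogonalProjectionOnto

theorem liftOp_apply (V : Submodule ℝ H) [FiniteDimensional ℝ V] (G : V →L[ℝ] V) (x : H) :
    liftOp V G x = (G (V.orthogonalProjectionOnto x) : H) := rfl

theorem liftOp_mul (V : Submodule ℝ H) [FiniteDimensional ℝ V] (F G : V →L[ℝ] V) (x : H) :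
    liftOp V (F * G) x = liftOp V F (liftOp V G x) := by
  rw [liftOp_apply, liftOp_apply, liftOp_apply,
    Submodule.orthogonalProjectionOnto_mem_subspace_eq_self]
  rfl

theorem liftOp_sub (V : Submodule ℝ H) [FiniteDimensional ℝ V] (F G : V →L[ℝ] V) :
    liftOp V (F - G) = liftOp V F - liftOp V G := by
  ext x; simp [liftOp_apply]

/-- Parseval's identity for an operator which is diagonal in an orthonormal basis of `V`. -/
theorem norm_liftOp_apply_sq {V : Submodule ℝ H} [FiniteDimensional ℝ V] {n : ℕ}
    (f : OrthonormalBasis (Fin n) ℝ V) {G : V →L[ℝ] V} {g : Fin n → ℝ}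
    (hG : ∀ j, G (f j) = g j • f j) (x : H) :
    ‖liftOp V G x‖ ^ 2 = ∑ j, g j ^ 2 * ⟪(f j : H), x⟫_ℝ ^ 2 := by
  set y := V.orthogonalProjectionOnto x with hy
  have h1 : G y = ∑ j, (g j * ⟪f j, y⟫_ℝ) • f j := by
    conv_lhs => rw [← f.sum_repr' y]
    rw [map_sum]
    refine Finset.sum_congr rfl fun j _ => ?_
    rw [map_smul, hG, smul_smul, mul_comm]
  have h2 : ‖liftOp V G x‖ = ‖G y‖ := rfl
  rw [h2, ← f.sum_sq_norm_inner_right (G y)]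
  refine Finset.sum_congr rfl fun j _ => ?_
  have h3 : ⟪f j, G y⟫_ℝ = g j * ⟪f j, y⟫_ℝ := by
    rw [h1, inner_sum]
    simp only [inner_smul_right, f.inner_eq_ite]
    simp
  have h4 : ⟪f j, y⟫_ℝ = ⟪(f j : H), x⟫_ℝ := by
    rw [hy]
    exact Submodule.inner_orthogonalProjectionOnto_eq_of_mem_left _ _
  rw [h3, h4, Real.norm_eq_abs, sq_abs, mul_pow]

theorem sum_inner_sq_le {V : Submodule ℝ H} [FiniteDimensional ℝ V] {n : ℕ}
    (f : OrthonormalBasis (Fin n) ℝ V) (x : H) :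
    ∑ j, ⟪(f j : H), x⟫_ℝ ^ 2 ≤ ‖x‖ ^ 2 := by
  have h := norm_liftOp_apply_sq f (G := 1) (g := fun _ => 1) (fun j => by simp) x
  simp only [one_pow, one_mul] at h
  rw [← h]
  have : ‖liftOp V 1 x‖ ≤ ‖x‖ := V.norm_orthogonalProjectionOnto_apply_le x
  gcongr

theorem norm_liftOp_apply_le {V : Submodule ℝ H} [FiniteDimensional ℝ V] {n : ℕ}
    (f : OrthonormalBasis (Fin n) ℝ V) {G : V →L[ℝ] V} {g : Fin n → ℝ}
    (hG : ∀ j, G (f j) = g j • f j) {C : ℝ} (hC : 0 ≤ C) (hg : ∀ j, |g j| ≤ C) (x : H) :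
    ‖liftOp V G x‖ ≤ C * ‖x‖ := by
  refine abs_le_of_sq_le_sq' ?_ (by positivity) |>.2
  rw [norm_liftOp_apply_sq f hG]
  calc ∑ j, g j ^ 2 * ⟪(f j : H), x⟫_ℝ ^ 2 ≤ ∑ j, C ^ 2 * ⟪(f j : H), x⟫_ℝ ^ 2 := by
        refine Finset.sum_le_sum fun j _ => ?_
        exact mul_le_mul_of_nonneg_right
          (sq_le_sq' (by linarith [abs_le.1 (hg j)]) (abs_le.1 (hg j)).2) (sq_nonneg _)
    _ = C ^ 2 * ∑ j, ⟪(f j : H), x⟫_ℝ ^ 2 := by rw [Finset.mul_sum]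
    _ ≤ C ^ 2 * ‖x‖ ^ 2 := by gcongr; exact sum_inner_sq_le f x
    _ = _ := by ring

variable [CompleteSpace H]

/-- `(f j)` is an orthonormal basis of eigenvectors of `A_h` with eigenvalues `μ j`; in particular
`μ j = ∑ₖ λₖ ⟨eₖ, f j⟩²` is an average of the eigenvalues of `A`. -/
structure IsDiscreteEigenbasis (e : HilbertBasis ℕ ℝ H) (lam : ℕ → ℝ) (V : Submodule ℝ H)
    [FiniteDimensional ℝ V] (hV : V ≤ (fracPow e lam (1 / 2)).domain) {n : ℕ}
    (f : OrthonormalBasis (Fin n) ℝ V) (μ : Fin n → ℝ) : Prop where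
  eigen : ∀ j, discreteOp e lam V hV (f j) = μ j • f j
  hasSum : ∀ j, HasSum (fun k => lam k * ⟪e k, (f j : H)⟫_ℝ ^ 2) (μ j)

theorem norm_fracPow_half_sq (e : HilbertBasis ℕ ℝ H) {lam : ℕ → ℝ} (hlam : ∀ k, 0 < lam k)
    (u : (fracPow e lam (1 / 2)).domain) :
    HasSum (fun k => lam k * ⟪e k, (u : H)⟫_ℝ ^ 2) (‖fracPow e lam (1 / 2) u‖ ^ 2) := by
  have h1 := (mem_specOp_domain e _ (u : H)).1 u.2
  have h2 := h1.hasSum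
  have h3 := specOp_norm_sq e (fun k => lam k ^ (1 / 2 : ℝ)) u
  rw [← h3] at h2
  refine h2.congr_fun fun k => ?_
  have h4 : (lam k ^ (1 / 2 : ℝ)) ^ 2 = lam k := by
    rw [← Real.rpow_natCast, ← Real.rpow_mul (hlam k).le]; norm_num
  rw [mul_pow, h4]

theorem exists_isDiscreteEigenbasis (e : HilbertBasis ℕ ℝ H) {lam : ℕ → ℝ}
    (hlam : ∀ k, 0 < lam k) (V : Submodule ℝ H) [FiniteDimensional ℝ V]
    (hV : V ≤ (fracPow e lam (1 / 2)).domain) :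
    ∃ (n : ℕ) (f : OrthonormalBasis (Fin n) ℝ V) (μ : Fin n → ℝ),
      IsDiscreteEigenbasis e lam V hV f μ := by
  have hs : (discreteOp e lam V hV : V →ₗ[ℝ] V).IsSymmetric := fun u v => by
    change ⟪discreteOp e lam V hV u, v⟫_ℝ = ⟪u, discreteOp e lam V hV v⟫_ℝ
    have h1 := inner_discreteOp e lam V hV u v
    have h2 := inner_discreteOp e lam V hV v u
    rw [← Submodule.coe_inner] at h1 h2
    rw [h1, real_inner_comm, ← h2, real_inner_comm]
  have h0 : ∀ j, discreteOp e lam V hV (hs.eigenvectorBasis rfl j) =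
      hs.eigenvalues rfl j • hs.eigenvectorBasis rfl j := fun j =>
    hs.apply_eigenvectorBasis rfl j
  refine ⟨_, hs.eigenvectorBasis rfl, hs.eigenvalues rfl, h0, ?_⟩
  · intro j
    have h1 := h0 j
    set v := hs.eigenvectorBasis rfl j with hv
    have h2 := inner_discreteOp e lam V hV v v
    rw [h1, real_inner_self_eq_norm_sq, Submodule.coe_smul, inner_smul_left,
      real_inner_self_eq_norm_sq] at h2
    have h3 : ‖(v : H)‖ = 1 := (hs.eigenvectorBasis rfl).orthonormal.1 j
    rw [h3] at h2
    have h4 := norm_fracPow_half_sq e hlam ⟨v, hV v.2⟩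
    rw [← h2] at h4
    simpa using h4

variable {e : HilbertBasis ℕ ℝ H} {lam : ℕ → ℝ} {V : Submodule ℝ H} [FiniteDimensional ℝ V]
  {hV : V ≤ (fracPow e lam (1 / 2)).domain} {n : ℕ} {f : OrthonormalBasis (Fin n) ℝ V}
  {μ : Fin n → ℝ}

theorem IsDiscreteEigenbasis.hasSum_one (_hf : IsDiscreteEigenbasis e lam V hV f μ) (j : Fin n) :
    HasSum (fun k => ⟪e k, (f j : H)⟫_ℝ ^ 2) 1 := by
  have h := e.hasSum_inner_sq (f j : H)
  have h3 : ‖(f j : H)‖ = 1 := f.orthonormal.1 j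
  rwa [h3, one_pow] at h

theorem IsDiscreteEigenbasis.pos (hf : IsDiscreteEigenbasis e lam V hV f μ)
    (hlam : ∀ k, 0 < lam k) (j : Fin n) : 0 < μ j := by
  have h1 := hf.hasSum j
  have h2 : ∀ k, 0 ≤ lam k * ⟪e k, (f j : H)⟫_ℝ ^ 2 := fun k => by have := hlam k; positivity
  refine lt_of_le_of_ne (h1.nonneg h2) fun h0 => ?_
  rw [← h0, hasSum_zero_iff_of_nonneg h2] at h1
  have h3 := hf.hasSum_one j
  have h4 : (fun k => ⟪e k, (f j : H)⟫_ℝ ^ 2) = 0 := by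
    ext k
    have := congrFun h1 k
    simpa [(hlam k).ne'] using this
  rw [h4] at h3
  exact one_ne_zero (h3.unique hasSum_zero)

/-- Tangent line of the convex function `x ↦ x^{-α}` at `c`. -/
theorem rpow_neg_tangent_le {α c x : ℝ} (hα : 0 ≤ α) (hc : 0 < c) (hx : 0 < x) :
    c ^ (-α) * (1 + α) - c ^ (-α) * α / c * x ≤ x ^ (-α) := by
  have h1 : Real.log (x / c) ≤ x / c - 1 := Real.log_le_sub_one_of_pos (by positivity)
  have h2 := Real.add_one_le_exp (-α * Real.log (x / c))
  have h3 : Real.exp (-α * Real.log (x / c)) = (x / c) ^ (-α) := by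
    rw [Real.rpow_def_of_pos (by positivity), mul_comm]
  have h4 : x ^ (-α) = c ^ (-α) * (x / c) ^ (-α) := by
    rw [← Real.mul_rpow hc.le (by positivity)]; congr 1; field_simp
  have h5 : 1 + α - α / c * x ≤ (x / c) ^ (-α) := by
    have h6 : α / c * x = α * (x / c) := by ring
    rw [h6]; nlinarith
  rw [h4]
  calc c ^ (-α) * (1 + α) - c ^ (-α) * α / c * x = c ^ (-α) * (1 + α - α / c * x) := by ring
    _ ≤ _ := by gcongr

/-- Jensen's inequality for the spectral measure of an eigenvector of `A_h`. -/
theorem IsDiscreteEigenbasis.rpow_neg_le (hf : IsDiscreteEigenbasis e lam V hV f μ)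
    (hlam : ∀ k, 0 < lam k) {α : ℝ} (hα : 0 ≤ α) (hTr : Summable fun k => lam k ^ (-α))
    (j : Fin n) :
    ENNReal.ofReal (μ j ^ (-α)) ≤
      ∑' k, ENNReal.ofReal (lam k ^ (-α) * ⟪e k, (f j : H)⟫_ℝ ^ 2) := by
  have hμ := hf.pos hlam j
  have hp := hf.hasSum_one j
  have hnn : ∀ k, 0 ≤ lam k ^ (-α) * ⟪e k, (f j : H)⟫_ℝ ^ 2 := fun k => by
    have := Real.rpow_nonneg (hlam k).le (-α); positivity
  have hs : Summable fun k => lam k ^ (-α) * ⟪e k, (f j : H)⟫_ℝ ^ 2 := by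
    refine Summable.of_nonneg_of_le hnn (fun k => ?_) hTr
    have h1 : ⟪e k, (f j : H)⟫_ℝ ^ 2 ≤ 1 := le_hasSum hp k fun _ _ => sq_nonneg _
    have := Real.rpow_nonneg (hlam k).le (-α)
    nlinarith
  rw [← ENNReal.ofReal_tsum_of_nonneg hnn hs]
  refine ENNReal.ofReal_le_ofReal ?_
  have h2 := (hp.mul_left (μ j ^ (-α) * (1 + α))).sub
    ((hf.hasSum j).mul_left (μ j ^ (-α) * α / μ j))
  have h3 : μ j ^ (-α) * (1 + α) * 1 - μ j ^ (-α) * α / μ j * μ j = μ j ^ (-α) := by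
    field_simp; ring
  rw [h3] at h2
  refine hasSum_le (fun k => ?_) h2 hs.hasSum
  have h4 := rpow_neg_tangent_le hα hμ (hlam k)
  have h5 := mul_le_mul_of_nonneg_right h4 (sq_nonneg ⟪e k, (f j : H)⟫_ℝ)
  linarith

theorem sum_tsum_rpow_neg_le (e : HilbertBasis ℕ ℝ H) {lam : ℕ → ℝ} (hlam : ∀ k, 0 < lam k)
    {n : ℕ} (f : OrthonormalBasis (Fin n) ℝ V) (α : ℝ) :
    ∑ j, ∑' k, ENNReal.ofReal (lam k ^ (-α) * ⟪e k, (f j : H)⟫_ℝ ^ 2) ≤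
      ∑' k, ENNReal.ofReal (lam k ^ (-α)) := by
  rw [← Summable.tsum_finsetSum fun _ _ => ENNReal.summable]
  refine ENNReal.tsum_le_tsum fun k => ?_
  have h0 := Real.rpow_nonneg (hlam k).le (-α)
  rw [← ENNReal.ofReal_sum_of_nonneg fun j _ => by positivity, ← Finset.mul_sum]
  refine ENNReal.ofReal_le_ofReal ?_
  have h1 := sum_inner_sq_le f (e k)
  rw [e.orthonormal.1 k, one_pow] at h1
  simp_rw [real_inner_comm] at h1 ⊢
  nlinarith

theorem IsDiscreteEigenbasis.sum_rpow_neg_le (hf : IsDiscreteEigenbasis e lam V hV f μ)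
    (hlam : ∀ k, 0 < lam k) {α : ℝ} (hα : 0 ≤ α) (hTr : Summable fun k => lam k ^ (-α)) :
    ∑ j, ENNReal.ofReal (μ j ^ (-α)) ≤ ∑' k, ENNReal.ofReal (lam k ^ (-α)) :=
  (Finset.sum_le_sum fun j _ => hf.rpow_neg_le hlam hα hTr j).trans
    (sum_tsum_rpow_neg_le e hlam f α)

theorem rpow_neg_mul_rpow_neg_le {x y a b : ℝ} (hx : 0 < x) (hy : 0 < y) (ha : 0 ≤ a)
    (hb : 0 ≤ b) : x ^ (-a) * y ^ (-b) ≤ x ^ (-(a + b)) + y ^ (-(a + b)) := by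
  have hx' := Real.rpow_pos_of_pos hx (-(a + b))
  have hy' := Real.rpow_pos_of_pos hy (-(a + b))
  rcases le_total x y with h | h
  · have h1 : y ^ (-b) ≤ x ^ (-b) := Real.rpow_le_rpow_of_nonpos hx h (by linarith)
    calc x ^ (-a) * y ^ (-b) ≤ x ^ (-a) * x ^ (-b) := by gcongr
      _ = x ^ (-(a + b)) := by rw [← Real.rpow_add hx]; congr 1; ring
      _ ≤ _ := by linarith
  · have h1 : x ^ (-a) ≤ y ^ (-a) := Real.rpow_le_rpow_of_nonpos hy h (by linarith)
    calc x ^ (-a) * y ^ (-b) ≤ y ^ (-a) * y ^ (-b) := by gcongr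
      _ = y ^ (-(a + b)) := by rw [← Real.rpow_add hy]; congr 1; ring
      _ ≤ _ := by linarith

/-- A weighted Hilbert-Schmidt bound for functions of `A_h`, from a bound on the spectrum. -/
theorem IsDiscreteEigenbasis.weightedHS_liftOp_le (hf : IsDiscreteEigenbasis e lam V hV f μ)
    (hlam : ∀ k, 0 < lam k) {a β : ℝ} (ha : 0 ≤ a) (hβ : 0 ≤ β)
    (hTr : Summable fun k => lam k ^ (-(a + β))) {G : V →L[ℝ] V} {g : Fin n → ℝ}
    (hG : ∀ j, G (f j) = g j • f j) {K : ℝ} (hK : 0 ≤ K)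
    (hg : ∀ j, g j ^ 2 ≤ K * μ j ^ (-a)) :
    weightedHS e (fun k => lam k ^ (-β)) (liftOp V G) ≤
      ENNReal.ofReal K * (2 * ∑' k, ENNReal.ofReal (lam k ^ (-(a + β)))) := by
  set α := a + β with hα
  have hl : ∀ (r : ℝ) k, 0 ≤ lam k ^ r := fun r k => Real.rpow_nonneg (hlam k).le r
  have hm : ∀ (r : ℝ) j, 0 ≤ μ j ^ r := fun r j => Real.rpow_nonneg (hf.pos hlam j).le r
  calc weightedHS e (fun k => lam k ^ (-β)) (liftOp V G)
      ≤ ∑' k, ∑ j, ENNReal.ofReal K * (ENNReal.ofReal (μ j ^ (-α) * ⟪e k, (f j : H)⟫_ℝ ^ 2) +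
          ENNReal.ofReal (lam k ^ (-α) * ⟪e k, (f j : H)⟫_ℝ ^ 2)) := by
        refine ENNReal.tsum_le_tsum fun k => ?_
        rw [norm_liftOp_apply_sq f hG, Finset.mul_sum,
          ENNReal.ofReal_sum_of_nonneg fun j _ => by have := hl (-β) k; positivity]
        refine Finset.sum_le_sum fun j _ => ?_
        rw [← ENNReal.ofReal_add (mul_nonneg (hm _ _) (sq_nonneg _))
          (mul_nonneg (hl _ _) (sq_nonneg _)), ← ENNReal.ofReal_mul hK]
        refine ENNReal.ofReal_le_ofReal ?_
        have h1 := rpow_neg_mul_rpow_neg_le (hf.pos hlam j) (hlam k) ha hβ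
        rw [real_inner_comm]
        have h2 := hl (-β) k
        calc lam k ^ (-β) * (g j ^ 2 * ⟪e k, (f j : H)⟫_ℝ ^ 2)
            ≤ lam k ^ (-β) * (K * μ j ^ (-a) * ⟪e k, (f j : H)⟫_ℝ ^ 2) := by
              gcongr; exact hg j
          _ = K * ((μ j ^ (-a) * lam k ^ (-β)) * ⟪e k, (f j : H)⟫_ℝ ^ 2) := by ring
          _ ≤ K * ((μ j ^ (-α) + lam k ^ (-α)) * ⟪e k, (f j : H)⟫_ℝ ^ 2) := by gcongr
          _ = _ := by ring
    _ = ENNReal.ofReal K * (∑ j, ENNReal.ofReal (μ j ^ (-α)) +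
          ∑ j, ∑' k, ENNReal.ofReal (lam k ^ (-α) * ⟪e k, (f j : H)⟫_ℝ ^ 2)) := by
        simp_rw [← Finset.mul_sum]
        rw [ENNReal.tsum_mul_left, Summable.tsum_finsetSum fun _ _ => ENNReal.summable]
        congr 1
        rw [← Finset.sum_add_distrib]
        refine Finset.sum_congr rfl fun j _ => ?_
        rw [ENNReal.tsum_add]
        congr 1
        simp_rw [ENNReal.ofReal_mul (hm (-α) j)]
        rw [ENNReal.tsum_mul_left, ← ENNReal.ofReal_tsum_of_nonneg (fun _ => sq_nonneg _)
          (hf.hasSum_one j).summable, (hf.hasSum_one j).tsum_eq]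
        simp
    _ ≤ _ := by
        rw [two_mul]
        gcongr
        · exact hf.sum_rpow_neg_le hlam (by positivity) hTr
        · exact sum_tsum_rpow_neg_le e hlam f α

/-! ### The discrete semigroup and the steps of the scheme -/

theorem expSemigroup_eigen {W : Type*} [NormedAddCommGroup W] [NormedSpace ℝ W] [CompleteSpace W]
    {B : W →L[ℝ] W} {v : W} {c : ℝ} (h : B v = c • v) (t : ℝ) :
    expSemigroup B t v = Real.exp (-(t * c)) • v := by
  have hpow : ∀ m : ℕ, (((-t) • B) ^ m) v = ((-(t * c)) ^ m) • v := fun m => by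
    induction m with
    | zero => simp
    | succ m ih =>
      rw [pow_succ', mul_apply_eq_comp, ih, map_smul]
      rw [smul_apply, h, smul_smul, smul_smul, pow_succ]
      congr 1; ring
  have h1 := (NormedSpace.exp_series_hasSum_exp' (𝕂 := ℝ) ((-t) • B)).mapL
    (ContinuousLinearMap.apply ℝ W v)
  have h2 := (NormedSpace.exp_series_hasSum_exp' (𝕂 := ℝ) (-(t * c))).smul_const v
  rw [← Real.exp_eq_exp_ℝ] at h2
  refine (h1.unique (h2.congr_fun fun m => ?_))
  rw [map_smul, ContinuousLinearMap.apply_apply, hpow, smul_smul, smul_eq_mul]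

theorem expSemigroup_add {W : Type*} [NormedAddCommGroup W] [NormedSpace ℝ W] [CompleteSpace W]
    (B : W →L[ℝ] W) (s t : ℝ) :
    expSemigroup B (s + t) = expSemigroup B s * expSemigroup B t := by
  let := NormedAlgebra.restrictScalars ℚ ℝ (W →L[ℝ] W)
  rw [expSemigroup, expSemigroup, expSemigroup, neg_add, add_smul]
  refine NormedSpace.exp_add_of_commute ?_
  exact ((Commute.refl B).smul_left _).smul_right _

theorem isUnit_one_add_smul_discreteOp (e : HilbertBasis ℕ ℝ H) (lam : ℕ → ℝ) (V : Submodule ℝ H)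
    [FiniteDimensional ℝ V] (hV : V ≤ (fracPow e lam (1 / 2)).domain) {c : ℝ} (hc : 0 ≤ c) :
    IsUnit (1 + c • discreteOp e lam V hV) := by
  have hinj : Function.Injective (1 + c • discreteOp e lam V hV : V →L[ℝ] V) := by
    rw [injective_iff_map_eq_zero]
    intro v hv
    have h1 : ⟪((1 + c • discreteOp e lam V hV) v : V), v⟫_ℝ =
        ‖v‖ ^ 2 + c * ‖fracPow e lam (1 / 2) ⟨v, hV v.2⟩‖ ^ 2 := by
      have h2 := inner_discreteOp e lam V hV v v
      rw [real_inner_self_eq_norm_sq, ← Submodule.coe_inner] at h2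
      rw [add_apply, inner_add_left, smul_apply,
        real_inner_smul_left, h2]
      simp
    rw [hv, inner_zero_left] at h1
    have h3 : ‖v‖ ^ 2 = 0 := by
      have : 0 ≤ c * ‖fracPow e lam (1 / 2) ⟨v, hV v.2⟩‖ ^ 2 := by positivity
      nlinarith [sq_nonneg ‖v‖]
    simpa using h3
  rw [ContinuousLinearMap.isUnit_iff_bijective]
  exact ⟨hinj, (LinearMap.injective_iff_surjective
    (f := (1 + c • discreteOp e lam V hV : V →L[ℝ] V).toLinearMap)).1 hinj⟩

theorem IsDiscreteEigenbasis.stepT_apply (hf : IsDiscreteEigenbasis e lam V hV f μ)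
    (hlam : ∀ k, 0 < lam k) {θ Δt : ℝ} (hθ : 0 ≤ θ) (hΔ : 0 ≤ Δt) (j : Fin n) :
    stepT e lam V hV θ Δt (f j) = (1 + θ * (Δt * μ j))⁻¹ • f j := by
  have hμ := hf.pos hlam j
  have h1 : (1 + (θ * Δt) • discreteOp e lam V hV) (f j) = (1 + θ * (Δt * μ j)) • f j := by
    rw [add_apply, smul_apply, hf.eigen, add_smul,
      one_smul, smul_smul, mul_assoc]
    rfl
  have h2 : 0 < 1 + θ * (Δt * μ j) := by positivity
  have h3 := congrArg (fun G : V →L[ℝ] V => G (f j)) (Ring.inverse_mul_cancel _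
    (isUnit_one_add_smul_discreteOp e lam V hV (mul_nonneg hθ hΔ)))
  simp only [mul_apply_eq_comp, h1, map_smul] at h3
  rw [stepT, eq_inv_smul_iff₀ h2.ne']
  exact h3

theorem IsDiscreteEigenbasis.stepS_apply (hf : IsDiscreteEigenbasis e lam V hV f μ)
    (hlam : ∀ k, 0 < lam k) {θ Δt : ℝ} (hθ : 0 ≤ θ) (hΔ : 0 ≤ Δt) (j : Fin n) :
    stepS e lam V hV θ Δt (f j) = thetaRat θ (Δt * μ j) • f j := by
  have h1 : (1 - ((1 - θ) * Δt) • discreteOp e lam V hV) (f j) =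
      (1 - (1 - θ) * (Δt * μ j)) • f j := by
    rw [sub_apply, smul_apply, hf.eigen, sub_smul,
      one_smul, smul_smul, mul_assoc]
    rfl
  rw [stepS, mul_apply_eq_comp, h1, map_smul, hf.stepT_apply hlam hθ hΔ, smul_smul]
  rfl

theorem IsDiscreteEigenbasis.stepS_pow_apply (hf : IsDiscreteEigenbasis e lam V hV f μ)
    (hlam : ∀ k, 0 < lam k) {θ Δt : ℝ} (hθ : 0 ≤ θ) (hΔ : 0 ≤ Δt) (m : ℕ) (j : Fin n) :
    (stepS e lam V hV θ Δt ^ m) (f j) = thetaRat θ (Δt * μ j) ^ m • f j := by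
  induction m with
  | zero => simp
  | succ m ih =>
    rw [pow_succ, mul_apply_eq_comp, hf.stepS_apply hlam hθ hΔ, map_smul, ih,
      smul_smul, pow_succ']

end Discrete

/-! ### Error of the spatial discretization of the semigroup -/

section SemigroupError

variable {H : Type*} [NormedAddCommGroup H] [InnerProductSpace ℝ H] [CompleteSpace H]
  {e : HilbertBasis ℕ ℝ H} {lam : ℕ → ℝ} {V : Submodule ℝ H} [FiniteDimensional ℝ V]
  {hV : V ≤ (fracPow e lam (1 / 2)).domain} {n : ℕ} {f : OrthonormalBasis (Fin n) ℝ V}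
  {μ : Fin n → ℝ}

theorem semigroupError_apply (t : ℝ) (x : H) :
    semigroupError e lam V hV t x =
      liftOp V (expSemigroup (discreteOp e lam V hV) t) x - heatSemigroup e lam t x := rfl

/-- Composition rule for the error operators `E_t = S_h(t) P_h - S(t)`. -/
theorem semigroupError_add (hlam : ∀ k, 0 < lam k) {s t : ℝ} (hs : 0 ≤ s) (ht : 0 ≤ t) (x : H) :
    semigroupError e lam V hV (s + t) x =
      semigroupError e lam V hV s (heatSemigroup e lam t x) +
        liftOp V (expSemigroup (discreteOp e lam V hV) s) (semigroupError e lam V hV t x) := by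
  simp only [semigroupError_apply]
  rw [expSemigroup_add, liftOp_mul, heatSemigroup_add e hlam hs ht, map_sub]
  abel

theorem IsDiscreteEigenbasis.norm_liftOp_expSemigroup_apply_le
    (hf : IsDiscreteEigenbasis e lam V hV f μ) (hlam : ∀ k, 0 < lam k) {t : ℝ} (ht : 0 ≤ t)
    (x : H) : ‖liftOp V (expSemigroup (discreteOp e lam V hV) t) x‖ ≤ ‖x‖ := by
  refine (norm_liftOp_apply_le f (fun j => expSemigroup_eigen (hf.eigen j) t) zero_le_one
    (fun j => ?_) x).trans (one_mul _).le
  rw [abs_of_pos (Real.exp_pos _)]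
  exact Real.exp_le_one_iff.2 (by have := hf.pos hlam j; nlinarith)

theorem exists_exp_neg_le_rpow {α : ℝ} (hα : 0 ≤ α) :
    ∃ c : ℝ, 0 < c ∧ ∀ x : ℝ, 0 < x → Real.exp (-x) ≤ c * x ^ (-α) := by
  obtain ⟨m, hm⟩ := exists_nat_ge α
  obtain ⟨K, hK, h⟩ := exists_one_add_pow_mul_exp_neg_le m one_pos
  refine ⟨K, hK, fun x hx => ?_⟩
  rw [Real.rpow_neg hx.le, ← div_eq_mul_inv, le_div_iff₀ (Real.rpow_pos_of_pos hx α)]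
  have h1 : x ^ α ≤ (1 + x) ^ m := by
    calc x ^ α ≤ (1 + x) ^ α := Real.rpow_le_rpow hx.le (by linarith) hα
      _ ≤ (1 + x) ^ (m : ℝ) := Real.rpow_le_rpow_of_exponent_le (by linarith) hm
      _ = _ := Real.rpow_natCast _ _
  have h2 := h x hx.le
  rw [one_mul] at h2
  calc Real.exp (-x) * x ^ α ≤ Real.exp (-x) * (1 + x) ^ m := by gcongr
    _ = (1 + x) ^ m * Real.exp (-x) := by ring
    _ ≤ K := h2

/-- An operator of the form `(G P) E` is Hilbert-Schmidt because `G` has finite rank, and passing to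
the adjoint shows that the Hilbert-Schmidt norm of `G` controls it. -/
theorem tsum_norm_liftOp_comp_sq_le (f : OrthonormalBasis (Fin n) ℝ V) {G : V →L[ℝ] V}
    {g : Fin n → ℝ} (hG : ∀ j, G (f j) = g j • f j) (e : HilbertBasis ℕ ℝ H) (E : H →L[ℝ] H) :
    ∑' k, ENNReal.ofReal (‖liftOp V G (E (e k))‖ ^ 2) ≤
      ENNReal.ofReal (‖E‖ ^ 2) * ∑ j, ENNReal.ofReal (g j ^ 2) := by
  calc ∑' k, ENNReal.ofReal (‖liftOp V G (E (e k))‖ ^ 2)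
      = ∑' k, ∑ j, ENNReal.ofReal (g j ^ 2) *
          ENNReal.ofReal (⟪e k, ContinuousLinearMap.adjoint E (f j : H)⟫_ℝ ^ 2) := by
        refine tsum_congr fun k => ?_
        rw [norm_liftOp_apply_sq f hG, ENNReal.ofReal_sum_of_nonneg fun j _ => by positivity]
        refine Finset.sum_congr rfl fun j _ => ?_
        rw [ENNReal.ofReal_mul (sq_nonneg _), ContinuousLinearMap.adjoint_inner_right,
          real_inner_comm]
    _ = ∑ j, ENNReal.ofReal (g j ^ 2) *
          ENNReal.ofReal (‖ContinuousLinearMap.adjoint E (f j : H)‖ ^ 2) := by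
        rw [Summable.tsum_finsetSum fun _ _ => ENNReal.summable]
        refine Finset.sum_congr rfl fun j _ => ?_
        rw [ENNReal.tsum_mul_left, e.tsum_ofReal_inner_sq]
    _ ≤ ∑ j, ENNReal.ofReal (g j ^ 2) * ENNReal.ofReal (‖E‖ ^ 2) := by
        gcongr with j
        have h1 := (ContinuousLinearMap.adjoint E).le_opNorm (f j : H)
        have h3 : ‖(f j : H)‖ = 1 := f.orthonormal.1 j
        rwa [h3, mul_one, LinearIsometryEquiv.norm_map] at h1
    _ = _ := by rw [← Finset.sum_mul, mul_comm]

theorem IsDiscreteEigenbasis.tsum_norm_liftOp_expSemigroup_comp_sq_le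
    (hf : IsDiscreteEigenbasis e lam V hV f μ) (hlam : ∀ k, 0 < lam k) {α c : ℝ} (hα : 0 ≤ α)
    (hc : 0 ≤ c) (hexp : ∀ x : ℝ, 0 < x → Real.exp (-x) ≤ c * x ^ (-α))
    (hTr : Summable fun k => lam k ^ (-α)) {t : ℝ} (ht : 0 < t) (E : H →L[ℝ] H) :
    ∑' k, ENNReal.ofReal (‖liftOp V (expSemigroup (discreteOp e lam V hV) (t / 2)) (E (e k))‖ ^ 2)
      ≤ ENNReal.ofReal (‖E‖ ^ 2) *
        (ENNReal.ofReal (c * t ^ (-α)) * ∑' k, ENNReal.ofReal (lam k ^ (-α))) := by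
  refine (tsum_norm_liftOp_comp_sq_le f
    (fun j => expSemigroup_eigen (hf.eigen j) (t / 2)) e E).trans ?_
  gcongr
  refine le_trans ?_ (mul_le_mul_right (hf.sum_rpow_neg_le hlam hα hTr) _)
  rw [Finset.mul_sum]
  refine Finset.sum_le_sum fun j _ => ?_
  have hμ := hf.pos hlam j
  have h0 : 0 ≤ c * t ^ (-α) := mul_nonneg hc (Real.rpow_nonneg ht.le _)
  rw [← ENNReal.ofReal_mul h0]
  refine ENNReal.ofReal_le_ofReal ?_
  calc Real.exp (-(t / 2 * μ j)) ^ 2 = Real.exp (-(t * μ j)) := by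
        rw [← Real.exp_nat_mul]; congr 1; push_cast; ring
    _ ≤ c * (t * μ j) ^ (-α) := hexp _ (by positivity)
    _ = _ := by rw [Real.mul_rpow ht.le hμ.le, mul_assoc]

theorem tsum_norm_comp_heatSemigroup_sq_le (e : HilbertBasis ℕ ℝ H) {lam : ℕ → ℝ}
    (hlam : ∀ k, 0 < lam k) {α c : ℝ} (hc : 0 ≤ c)
    (hexp : ∀ x : ℝ, 0 < x → Real.exp (-x) ≤ c * x ^ (-α)) {t : ℝ} (ht : 0 < t) (E : H →L[ℝ] H) :
    ∑' k, ENNReal.ofReal (‖E (heatSemigroup e lam (t / 2) (e k))‖ ^ 2)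
      ≤ ENNReal.ofReal (‖E‖ ^ 2) *
        (ENNReal.ofReal (c * t ^ (-α)) * ∑' k, ENNReal.ofReal (lam k ^ (-α))) := by
  have h0 : 0 ≤ c * t ^ (-α) := mul_nonneg hc (Real.rpow_nonneg ht.le _)
  rw [← ENNReal.tsum_mul_left, ← ENNReal.tsum_mul_left]
  refine ENNReal.tsum_le_tsum fun k => ?_
  rw [← ENNReal.ofReal_mul h0, ← ENNReal.ofReal_mul (sq_nonneg _)]
  refine ENNReal.ofReal_le_ofReal ?_
  rw [heatSemigroup_basis e hlam (by positivity), map_smul, norm_smul, mul_pow, mul_comm]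
  have h1 := E.le_opNorm (e k)
  rw [e.orthonormal.1 k, mul_one] at h1
  gcongr
  calc ‖Real.exp (-(t / 2 * lam k))‖ ^ 2 = Real.exp (-(t * lam k)) := by
        rw [Real.norm_of_nonneg (Real.exp_pos _).le, ← Real.exp_nat_mul]
        congr 1; push_cast; ring
    _ ≤ c * (t * lam k) ^ (-α) := hexp _ (mul_pos ht (hlam k))
    _ = _ := by rw [Real.mul_rpow ht.le (hlam k).le, mul_assoc]

/-- On a low mode the nonsmooth data estimate at the time `1 / λₖ` yields a bound of the error which
does not blow up as `t → 0`. -/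
theorem IsDiscreteEigenbasis.norm_semigroupError_basis_le
    (hf : IsDiscreteEigenbasis e lam V hV f μ) (hlam : ∀ k, 0 < lam k) {κ γ : ℝ} (hκ : 0 ≤ κ)
    (hγ : 0 ≤ γ) (hE : ∀ t : ℝ, 0 < t → ‖semigroupError e lam V hV t‖ ≤ κ * t ^ (-γ))
    {t : ℝ} (ht : 0 < t) (k : ℕ) :
    ‖semigroupError e lam V hV t (e k)‖ ≤ 6 * κ * lam k ^ γ := by
  have hl := hlam k
  have hr : 0 < (lam k)⁻¹ := inv_pos.2 hl
  have he : ‖e k‖ = 1 := e.orthonormal.1 k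
  have hb : ∀ s : ℝ, (lam k)⁻¹ ≤ s → ‖semigroupError e lam V hV s (e k)‖ ≤ κ * lam k ^ γ := by
    intro s hs
    have h1 := (semigroupError e lam V hV s).le_opNorm (e k)
    rw [he, mul_one] at h1
    refine h1.trans ((hE s (hr.trans_le hs)).trans ?_)
    gcongr
    calc s ^ (-γ) ≤ ((lam k)⁻¹) ^ (-γ) := Real.rpow_le_rpow_of_nonpos hr hs (by linarith)
      _ = lam k ^ γ := by rw [Real.inv_rpow hl.le, Real.rpow_neg hl.le, inv_inv]
  have h1 := semigroupError_add (e := e) (lam := lam) (hV := hV) hlam ht.le hr.le (e k)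
  rw [heatSemigroup_basis e hlam hr.le, inv_mul_cancel₀ hl.ne', map_smul] at h1
  have h2 : Real.exp (-1) • semigroupError e lam V hV t (e k) =
      semigroupError e lam V hV (t + (lam k)⁻¹) (e k) -
        liftOp V (expSemigroup (discreteOp e lam V hV) t)
          (semigroupError e lam V hV (lam k)⁻¹ (e k)) := by
    rw [h1]; abel
  have h3 : Real.exp (-1) * ‖semigroupError e lam V hV t (e k)‖ ≤ 2 * (κ * lam k ^ γ) := by
    have h4 := congrArg norm h2
    rw [norm_smul, Real.norm_of_nonneg (Real.exp_pos _).le] at h4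
    rw [h4, two_mul]
    refine (norm_sub_le _ _).trans (add_le_add (hb _ (by linarith)) ?_)
    exact (hf.norm_liftOp_expSemigroup_apply_le hlam ht.le _).trans (hb _ le_rfl)
  have h5 : 1 / 3 ≤ Real.exp (-1) := by
    rw [Real.exp_neg, ← one_div]
    have := Real.exp_one_lt_d9
    gcongr
    linarith
  nlinarith [norm_nonneg (semigroupError e lam V hV t (e k))]

/-- The spatial error in the weighted Hilbert-Schmidt norm. The modes with `λₖ t ≤ 1` are treated one
by one; for the others the weight is at most `t ^ β` and one of the semigroups in
`E_t = E_{t/2} S(t/2) + S_h(t/2) P_h E_{t/2}` is Hilbert-Schmidt. -/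
theorem exists_weightedHS_semigroupError_le {α β γ : ℝ} (hβ : 0 ≤ β) (hβα : β ≤ α)
    (hγ : 0 ≤ γ) (e : HilbertBasis ℕ ℝ H) {lam : ℕ → ℝ} (hlam : ∀ k, 0 < lam k)
    (hTr : Summable fun k => lam k ^ (-α)) :
    ∃ C : ℝ, 0 < C ∧
      ∀ (V : Submodule ℝ H) [FiniteDimensional ℝ V] (hV : V ≤ (fracPow e lam (1 / 2)).domain)
        (κ : ℝ), 0 ≤ κ → (∀ t : ℝ, 0 < t → ‖semigroupError e lam V hV t‖ ≤ κ * t ^ (-γ)) →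
      ∀ t : ℝ, 0 < t → weightedHS e (fun k => lam k ^ (-β)) (semigroupError e lam V hV t) ≤
        ENNReal.ofReal (C * κ ^ 2 * t ^ (-(2 * γ + (α - β)))) *
          ∑' k, ENNReal.ofReal (lam k ^ (-α)) := by
  have hα : 0 ≤ α := hβ.trans hβα
  obtain ⟨c, hc, hexp⟩ := exists_exp_neg_le_rpow hα
  refine ⟨36 + 4 * c * 2 ^ (2 * γ), by positivity, ?_⟩
  intro V _ hV κ hκ hE t ht
  obtain ⟨n, f, μ, hf⟩ := exists_isDiscreteEigenbasis e hlam V hV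
  set Tr : ℝ≥0∞ := ∑' k, ENNReal.ofReal (lam k ^ (-α)) with hTrdef
  set E := semigroupError e lam V hV (t / 2) with hEdef
  set F := liftOp V (expSemigroup (discreteOp e lam V hV) (t / 2)) with hF
  set p : ℝ := 2 * γ + (α - β) with hp
  have hp0 : 0 ≤ p := by rw [hp]; linarith
  have htp : 0 ≤ t ^ (-p) := Real.rpow_nonneg ht.le _
  have htβ : 0 ≤ t ^ β := Real.rpow_nonneg ht.le _
  have hsplit : ∀ k, semigroupError e lam V hV t (e k) =
      E (heatSemigroup e lam (t / 2) (e k)) + F (E (e k)) := fun k => by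
    rw [← semigroupError_add hlam (by positivity) (by positivity), add_halves]
  have hpt : ∀ k, ENNReal.ofReal (lam k ^ (-β) * ‖semigroupError e lam V hV t (e k)‖ ^ 2) ≤
      ENNReal.ofReal (36 * κ ^ 2 * t ^ (-p)) * ENNReal.ofReal (lam k ^ (-α)) +
        ENNReal.ofReal (2 * t ^ β) *
          (ENNReal.ofReal (‖E (heatSemigroup e lam (t / 2) (e k))‖ ^ 2) +
            ENNReal.ofReal (‖F (E (e k))‖ ^ 2)) := fun k => by
    have hl := hlam k
    have hlβ := Real.rpow_nonneg hl.le (-β)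
    rw [← ENNReal.ofReal_add (by positivity) (by positivity), ← ENNReal.ofReal_mul (by positivity),
      ← ENNReal.ofReal_mul (by positivity)]
    -- the low modes use the first term on the right, the high modes the second
    rcases le_total (lam k * t) 1 with h1 | h1
    · refine le_trans (ENNReal.ofReal_le_ofReal ?_) le_self_add
      have h2 := hf.norm_semigroupError_basis_le hlam hκ hγ hE ht k
      have h3 : lam k ^ p ≤ t ^ (-p) := by
        rw [Real.rpow_neg ht.le, ← Real.inv_rpow ht.le]
        refine Real.rpow_le_rpow hl.le ?_ hp0
        rwa [← one_div, le_div_iff₀ ht]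
      have h4 : lam k ^ (-β) * (lam k ^ γ) ^ 2 = lam k ^ p * lam k ^ (-α) := by
        rw [← Real.rpow_natCast, ← Real.rpow_mul hl.le, ← Real.rpow_add hl, ← Real.rpow_add hl]
        congr 1; rw [hp]; push_cast; ring
      calc lam k ^ (-β) * ‖semigroupError e lam V hV t (e k)‖ ^ 2
          ≤ lam k ^ (-β) * (6 * κ * lam k ^ γ) ^ 2 := by gcongr
        _ = 36 * κ ^ 2 * (lam k ^ (-β) * (lam k ^ γ) ^ 2) := by ring
        _ = 36 * κ ^ 2 * (lam k ^ p * lam k ^ (-α)) := by rw [h4]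
        _ ≤ 36 * κ ^ 2 * (t ^ (-p) * lam k ^ (-α)) := by
          have := Real.rpow_nonneg hl.le (-α)
          gcongr
        _ = _ := by ring
    · refine le_trans (ENNReal.ofReal_le_ofReal ?_) le_add_self
      have h2 : lam k ^ (-β) ≤ t ^ β := by
        rw [Real.rpow_neg hl.le, ← Real.inv_rpow hl.le]
        refine Real.rpow_le_rpow (by positivity) ?_ hβ
        rw [← one_div, div_le_iff₀ hl]; linarith
      have h3 : ‖semigroupError e lam V hV t (e k)‖ ^ 2 ≤
          2 * (‖E (heatSemigroup e lam (t / 2) (e k))‖ ^ 2 + ‖F (E (e k))‖ ^ 2) := by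
        rw [hsplit k]
        have h4 := norm_add_le (E (heatSemigroup e lam (t / 2) (e k))) (F (E (e k)))
        exact (pow_le_pow_left₀ (norm_nonneg _) h4 2).trans (add_sq_le)
      calc lam k ^ (-β) * ‖semigroupError e lam V hV t (e k)‖ ^ 2
          ≤ t ^ β * (2 * (‖E (heatSemigroup e lam (t / 2) (e k))‖ ^ 2 + ‖F (E (e k))‖ ^ 2)) := by
            gcongr
        _ = _ := by ring
  have hEn : ‖E‖ ^ 2 ≤ κ ^ 2 * 2 ^ (2 * γ) * t ^ (-(2 * γ)) := by
    have h1 := hE (t / 2) (by positivity)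
    calc ‖E‖ ^ 2 ≤ (κ * (t / 2) ^ (-γ)) ^ 2 := by gcongr
      _ = _ := by
        have h2 : (t / 2) ^ (-γ) = t ^ (-γ) * 2 ^ γ := by
          rw [Real.div_rpow ht.le zero_le_two, Real.rpow_neg zero_le_two, div_inv_eq_mul]
        have h3 : (t ^ (-γ)) ^ 2 = t ^ (-(2 * γ)) := by
          rw [← Real.rpow_natCast, ← Real.rpow_mul ht.le]; congr 1; push_cast; ring
        have h4 : ((2 : ℝ) ^ γ) ^ 2 = 2 ^ (2 * γ) := by
          rw [← Real.rpow_natCast, ← Real.rpow_mul zero_le_two]; congr 1; push_cast; ring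
        rw [h2, mul_pow, mul_pow, h3, h4]; ring
  have hhs : ENNReal.ofReal (2 * t ^ β) * (ENNReal.ofReal (‖E‖ ^ 2) *
        (ENNReal.ofReal (c * t ^ (-α)) * Tr)) ≤
      ENNReal.ofReal (2 * c * 2 ^ (2 * γ) * κ ^ 2 * t ^ (-p)) * Tr := by
    rw [← mul_assoc, ← mul_assoc, ← ENNReal.ofReal_mul (by positivity),
      ← ENNReal.ofReal_mul (by positivity)]
    refine mul_le_mul' (ENNReal.ofReal_le_ofReal ?_) le_rfl
    have h5 : t ^ β * t ^ (-(2 * γ)) * t ^ (-α) = t ^ (-p) := by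
      rw [← Real.rpow_add ht, ← Real.rpow_add ht]; congr 1; rw [hp]; ring
    have h6 := Real.rpow_nonneg ht.le (-α)
    calc 2 * t ^ β * ‖E‖ ^ 2 * (c * t ^ (-α))
        ≤ 2 * t ^ β * (κ ^ 2 * 2 ^ (2 * γ) * t ^ (-(2 * γ))) * (c * t ^ (-α)) := by gcongr
      _ = 2 * c * 2 ^ (2 * γ) * κ ^ 2 * (t ^ β * t ^ (-(2 * γ)) * t ^ (-α)) := by ring
      _ = _ := by rw [h5]
  calc weightedHS e (fun k => lam k ^ (-β)) (semigroupError e lam V hV t)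
      ≤ ∑' k, (ENNReal.ofReal (36 * κ ^ 2 * t ^ (-p)) * ENNReal.ofReal (lam k ^ (-α)) +
        ENNReal.ofReal (2 * t ^ β) *
          (ENNReal.ofReal (‖E (heatSemigroup e lam (t / 2) (e k))‖ ^ 2) +
            ENNReal.ofReal (‖F (E (e k))‖ ^ 2))) := ENNReal.tsum_le_tsum hpt
    _ = ENNReal.ofReal (36 * κ ^ 2 * t ^ (-p)) * Tr + ENNReal.ofReal (2 * t ^ β) *
          (∑' k, ENNReal.ofReal (‖E (heatSemigroup e lam (t / 2) (e k))‖ ^ 2) +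
            ∑' k, ENNReal.ofReal (‖F (E (e k))‖ ^ 2)) := by
        rw [ENNReal.tsum_add, ENNReal.tsum_mul_left, ENNReal.tsum_mul_left, ENNReal.tsum_add]
    _ ≤ ENNReal.ofReal (36 * κ ^ 2 * t ^ (-p)) * Tr + ENNReal.ofReal (2 * t ^ β) *
          (ENNReal.ofReal (‖E‖ ^ 2) * (ENNReal.ofReal (c * t ^ (-α)) * Tr) +
            ENNReal.ofReal (‖E‖ ^ 2) * (ENNReal.ofReal (c * t ^ (-α)) * Tr)) := by
        gcongr
        · exact tsum_norm_comp_heatSemigroup_sq_le e hlam hc.le hexp ht E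
        · exact hf.tsum_norm_liftOp_expSemigroup_comp_sq_le hlam hα hc.le hexp hTr ht E
    _ ≤ ENNReal.ofReal (36 * κ ^ 2 * t ^ (-p)) * Tr +
          (ENNReal.ofReal (2 * c * 2 ^ (2 * γ) * κ ^ 2 * t ^ (-p)) * Tr +
            ENNReal.ofReal (2 * c * 2 ^ (2 * γ) * κ ^ 2 * t ^ (-p)) * Tr) := by
        rw [mul_add]; gcongr
    _ = _ := by
        rw [← add_mul, ← add_mul, ← ENNReal.ofReal_add (by positivity) (by positivity),
          ← ENNReal.ofReal_add (by positivity) (by positivity)]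
        congr 2; ring

end SemigroupError

/-! ### Error of the fully discrete propagator -/

section FullyDiscrete

variable {H : Type*} [NormedAddCommGroup H] [InnerProductSpace ℝ H] [CompleteSpace H]

/-- The error of the propagator of the noise, at a time `t` of the step following the `n`-th. -/
theorem exists_weightedHS_step_sub_le {α β γ θ : ℝ} (hβ : 0 ≤ β) (hβα : β ≤ α)
    (hαβ : α - β ≤ 1) (hγ : γ ∈ Set.Icc (0 : ℝ) 1) (hθ : θ ∈ Set.Ioc (1 / 2 : ℝ) 1)
    (e : HilbertBasis ℕ ℝ H) {lam : ℕ → ℝ} (hlam : ∀ k, 0 < lam k)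
    (hTr : Summable fun k => lam k ^ (-α)) :
    ∃ C : ℝ, 0 < C ∧
      ∀ (V : Submodule ℝ H) [FiniteDimensional ℝ V] (hV : V ≤ (fracPow e lam (1 / 2)).domain)
        (κ : ℝ), 0 ≤ κ → (∀ t : ℝ, 0 < t → ‖semigroupError e lam V hV t‖ ≤ κ * t ^ (-γ)) →
      ∀ (Δt t : ℝ) (n : ℕ), 0 < Δt → 0 < t → n * Δt ≤ t → t < (n + 1) * Δt →
        weightedHS e (fun k => lam k ^ (-β))
          (liftOp V (stepS e lam V hV θ Δt ^ n * stepT e lam V hV θ Δt) - heatSemigroup e lam t) ≤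
        ENNReal.ofReal (C * (κ + Δt ^ γ) ^ 2 * t ^ (-(2 * γ + (α - β)))) := by
  obtain ⟨C1, hC1, h1⟩ := exists_weightedHS_semigroupError_le hβ hβα hγ.1 e hlam hTr
  obtain ⟨C2, hC2, h2⟩ := exists_rpow_mul_thetaError_sq_le hθ
  set Tr : ℝ := ∑' k, lam k ^ (-α) with hTrdef
  have hTr0 : 0 ≤ Tr := tsum_nonneg fun k => Real.rpow_nonneg (hlam k).le _
  have hTrE : ∑' k, ENNReal.ofReal (lam k ^ (-α)) = ENNReal.ofReal Tr :=
    (ENNReal.ofReal_tsum_of_nonneg (fun k => Real.rpow_nonneg (hlam k).le _) hTr).symm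
  refine ⟨(2 * C1 + 4 * C2) * Tr + 1, by positivity, ?_⟩
  intro V _ hV κ hκ hE Δt t n hΔ ht hnt htn
  obtain ⟨m, f, μ, hf⟩ := exists_isDiscreteEigenbasis e hlam V hV
  set a := α - β with ha
  have ha0 : 0 ≤ a := by rw [ha]; linarith
  have hα' : α = a + β := by rw [ha]; ring
  set p : ℝ := 2 * γ + a with hp
  have hw : ∀ k, 0 ≤ lam k ^ (-β) := fun k => Real.rpow_nonneg (hlam k).le _
  have hθ0 : 0 ≤ θ := by linarith [hθ.1]
  have htp : 0 ≤ t ^ (-p) := Real.rpow_nonneg ht.le _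
  set G := stepS e lam V hV θ Δt ^ n * stepT e lam V hV θ Δt -
    expSemigroup (discreteOp e lam V hV) t with hG
  have hdec : liftOp V (stepS e lam V hV θ Δt ^ n * stepT e lam V hV θ Δt) -
      heatSemigroup e lam t = liftOp V G + semigroupError e lam V hV t := by
    ext x
    rw [hG, liftOp_sub]
    simp only [sub_apply, add_apply, semigroupError_apply]
    abel
  have hGf : ∀ j, G (f j) = thetaError θ (Δt * μ j) (t / Δt) n • f j := fun j => by
    rw [hG, sub_apply, mul_apply_eq_comp, hf.stepT_apply hlam hθ0 hΔ.le, map_smul,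
      hf.stepS_pow_apply hlam hθ0 hΔ.le, expSemigroup_eigen (hf.eigen j), smul_smul, ← sub_smul,
      thetaError]
    congr 2
    · ring
    · congr 2; field_simp
  have hg : ∀ j, thetaError θ (Δt * μ j) (t / Δt) n ^ 2 ≤
      (C2 * (Δt ^ γ) ^ 2 * t ^ (-p)) * μ j ^ (-a) := fun j => by
    have hμ := hf.pos hlam j
    have h3 := h2 a γ (Δt * μ j) (t / Δt) n ⟨ha0, hαβ⟩ hγ (by positivity) (by positivity)
      (by rwa [le_div_iff₀ hΔ]) (by rwa [div_lt_iff₀ hΔ])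
    have h4 : 0 < (Δt * μ j) ^ a := by positivity
    have h5 : (t / Δt) ^ (-(2 * γ + a)) * ((Δt * μ j) ^ a)⁻¹ =
        (Δt ^ γ) ^ 2 * t ^ (-p) * μ j ^ (-a) := by
      rw [Real.div_rpow ht.le hΔ.le, ← Real.rpow_neg (by positivity : 0 ≤ Δt * μ j),
        Real.mul_rpow hΔ.le hμ.le, Real.rpow_neg hΔ.le (2 * γ + a), div_inv_eq_mul,
        Real.rpow_add hΔ, Real.rpow_neg hΔ.le a, ← hp]
      have h6 : Δt ^ (2 * γ) = (Δt ^ γ) ^ 2 := by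
        rw [← Real.rpow_natCast, ← Real.rpow_mul hΔ.le]; congr 1; push_cast; ring
      have h7 : Δt ^ a ≠ 0 := by positivity
      rw [h6]; field_simp
    rw [← le_div_iff₀' h4, mul_div_assoc, div_eq_mul_inv ((t / Δt) ^ _), h5] at h3
    linarith
  have hA := hf.weightedHS_liftOp_le hlam ha0 hβ (by rwa [← hα']) hGf (K := C2 * (Δt ^ γ) ^ 2 *
    t ^ (-p)) (by positivity) hg
  have hB := h1 V hV κ hκ hE t ht
  rw [← hα', hTrE] at hA
  rw [hTrE, ← ENNReal.ofReal_mul (by positivity)] at hB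
  have e2 : (2 : ℝ≥0∞) = ENNReal.ofReal 2 := by simp
  rw [e2, ← ENNReal.ofReal_mul zero_le_two, ← ENNReal.ofReal_mul (by positivity)] at hA
  rw [hdec]
  refine (weightedHS_add_le e hw _ _).trans ?_
  rw [e2]
  refine (add_le_add (mul_le_mul_right hA _) (mul_le_mul_right hB _)).trans ?_
  rw [← ENNReal.ofReal_mul zero_le_two, ← ENNReal.ofReal_mul zero_le_two,
    ← ENNReal.ofReal_add (by positivity) (by positivity)]
  refine ENNReal.ofReal_le_ofReal ?_
  have hΔγ : 0 ≤ Δt ^ γ := by positivity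
  have e3 : (Δt ^ γ) ^ 2 ≤ (κ + Δt ^ γ) ^ 2 := by gcongr; linarith
  have e4 : κ ^ 2 ≤ (κ + Δt ^ γ) ^ 2 := by gcongr; linarith
  calc 2 * (C2 * (Δt ^ γ) ^ 2 * t ^ (-p) * (2 * Tr)) + 2 * (C1 * κ ^ 2 * t ^ (-p) * Tr)
      ≤ 2 * (C2 * (κ + Δt ^ γ) ^ 2 * t ^ (-p) * (2 * Tr)) +
          2 * (C1 * (κ + Δt ^ γ) ^ 2 * t ^ (-p) * Tr) := by gcongr
    _ = ((2 * C1 + 4 * C2) * Tr) * (κ + Δt ^ γ) ^ 2 * t ^ (-p) := by ring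
    _ ≤ _ := by gcongr; linarith

/-- The error of the propagator of the initial value. -/
theorem exists_norm_stepS_pow_sub_le {γ θ : ℝ} (hγ : γ ∈ Set.Icc (0 : ℝ) 1)
    (hθ : θ ∈ Set.Ioc (1 / 2 : ℝ) 1) (e : HilbertBasis ℕ ℝ H) {lam : ℕ → ℝ}
    (hlam : ∀ k, 0 < lam k) {T : ℝ} (hT : 1 ≤ T) :
    ∃ C : ℝ, 0 < C ∧
      ∀ (V : Submodule ℝ H) [FiniteDimensional ℝ V] (hV : V ≤ (fracPow e lam (1 / 2)).domain)
        (κ : ℝ), 0 ≤ κ → (∀ t : ℝ, 0 < t → ‖semigroupError e lam V hV t‖ ≤ κ * t ^ (-γ)) →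
      ∀ (N : ℕ), 1 ≤ N → T / N ≤ 1 → ∀ x : H,
        ‖liftOp V (stepS e lam V hV θ (T / N) ^ N) x - heatSemigroup e lam T x‖ ≤
          C * (κ + (T / N) ^ γ) * ‖x‖ := by
  obtain ⟨C, hC, h1⟩ := exists_abs_thetaRat_pow_sub_exp_le hθ
  refine ⟨C + 1, by positivity, ?_⟩
  intro V _ hV κ hκ hE N hN hΔ1 x
  obtain ⟨m, f, μ, hf⟩ := exists_isDiscreteEigenbasis e hlam V hV
  have hT0 : 0 < T := by linarith
  have hN0 : (0 : ℝ) < N := by exact_mod_cast hN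
  have hΔ : 0 < T / N := by positivity
  have hθ0 : 0 ≤ θ := by linarith [hθ.1]
  set G := stepS e lam V hV θ (T / N) ^ N - expSemigroup (discreteOp e lam V hV) T with hG
  have hdec : liftOp V (stepS e lam V hV θ (T / N) ^ N) x - heatSemigroup e lam T x =
      liftOp V G x + semigroupError e lam V hV T x := by
    rw [hG, liftOp_sub, semigroupError_apply, sub_apply]
    abel
  have hGf : ∀ j, G (f j) = (thetaRat θ (T / N * μ j) ^ N -
      Real.exp (-(N * (T / N * μ j)))) • f j := fun j => by
    rw [hG, sub_apply, hf.stepS_pow_apply hlam hθ0 hΔ.le, expSemigroup_eigen (hf.eigen j),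
      ← sub_smul]
    congr 4; field_simp
  have hg : ∀ j, |thetaRat θ (T / N * μ j) ^ N - Real.exp (-(N * (T / N * μ j)))| ≤
      C * (T / N) ^ γ := fun j => by
    refine (h1 _ N (by have := hf.pos hlam j; positivity) hN).trans ?_
    rw [div_eq_mul_inv]
    gcongr
    calc ((N : ℝ))⁻¹ ≤ T / N := by rw [← one_div]; gcongr
      _ = (T / N) ^ (1 : ℝ) := (Real.rpow_one _).symm
      _ ≤ (T / N) ^ γ := Real.rpow_le_rpow_of_exponent_ge hΔ hΔ1 hγ.2
  rw [hdec]
  refine (norm_add_le _ _).trans ?_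
  have h2 := norm_liftOp_apply_le f hGf (by positivity) hg x
  have h3 : ‖semigroupError e lam V hV T x‖ ≤ κ * ‖x‖ := by
    refine ((semigroupError e lam V hV T).le_opNorm x).trans ?_
    gcongr
    refine (hE T hT0).trans (mul_le_of_le_one_right hκ ?_)
    exact Real.rpow_le_one_of_one_le_of_nonpos hT (by linarith [hγ.1])
  have h4 : 0 ≤ (T / N) ^ γ := by positivity
  calc _ ≤ C * (T / N) ^ γ * ‖x‖ + κ * ‖x‖ := add_le_add h2 h3
    _ = (C * (T / N) ^ γ + κ) * ‖x‖ := by ring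
    _ ≤ ((C + 1) * (κ + (T / N) ^ γ)) * ‖x‖ := by gcongr; nlinarith

end FullyDiscrete

/-! ### Moments of the Poisson distribution -/

section PoissonMoments

theorem hasSum_poisson_mul_id (r : ℝ) :
    HasSum (fun n : ℕ => Real.exp (-r) * r ^ n / n.factorial * n) r := by
  have h := (NormedSpace.exp_series_hasSum_exp' (𝕂 := ℝ) r).mul_left (Real.exp (-r) * r)
  rw [← Real.exp_eq_exp_ℝ, mul_right_comm, ← Real.exp_add, neg_add_cancel, Real.exp_zero,
    one_mul] at h
  rw [← hasSum_nat_add_iff' 1]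
  simp only [Finset.range_one, Finset.sum_singleton, Nat.cast_zero, mul_zero, sub_zero]
  refine h.congr_fun fun n => ?_
  rw [Nat.factorial_succ]
  push_cast
  rw [smul_eq_mul]
  have : ((n : ℝ) + 1) ≠ 0 := by positivity
  field_simp
  ring

theorem hasSum_poisson_mul_factorial_two (r : ℝ) :
    HasSum (fun n : ℕ => Real.exp (-r) * r ^ n / n.factorial * (n * (n - 1))) (r ^ 2) := by
  have h := (NormedSpace.exp_series_hasSum_exp' (𝕂 := ℝ) r).mul_left (Real.exp (-r) * r ^ 2)
  rw [← Real.exp_eq_exp_ℝ, mul_right_comm, ← Real.exp_add, neg_add_cancel, Real.exp_zero,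
    one_mul] at h
  rw [← hasSum_nat_add_iff' 2]
  simp only [Finset.sum_range_succ, Finset.range_zero, Finset.sum_empty, Nat.cast_zero, zero_mul,
    mul_zero, Nat.cast_one, sub_self, add_zero, sub_zero]
  refine h.congr_fun fun n => ?_
  rw [Nat.factorial_succ, Nat.factorial_succ]
  push_cast
  rw [smul_eq_mul]
  have h1 : ((n : ℝ) + 1) ≠ 0 := by positivity
  have h2 : ((n : ℝ) + 1 + 1) ≠ 0 := by positivity
  have h3 : ((n : ℝ) + 2 - 1) = n + 1 := by ring
  have h4 : ((n : ℝ) + 2) = n + 1 + 1 := by ring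
  rw [h3, h4]
  field_simp
  ring

theorem hasSum_poisson_variance (r : ℝ) :
    HasSum (fun n : ℕ => Real.exp (-r) * r ^ n / n.factorial * ((n : ℝ) - r) ^ 2) r := by
  have h0 : HasSum (fun n : ℕ => Real.exp (-r) * r ^ n / n.factorial) 1 := by
    have h := (NormedSpace.exp_series_hasSum_exp' (𝕂 := ℝ) r).mul_left (Real.exp (-r))
    rw [← Real.exp_eq_exp_ℝ, ← Real.exp_add, neg_add_cancel, Real.exp_zero] at h
    refine h.congr_fun fun n => ?_
    rw [smul_eq_mul]; field_simp
  have h := ((hasSum_poisson_mul_factorial_two r).add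
    ((hasSum_poisson_mul_id r).mul_left (1 - 2 * r))).add (h0.mul_left (r ^ 2))
  have h1 : r ^ 2 + (1 - 2 * r) * r + r ^ 2 * 1 = r := by ring
  rw [h1] at h
  exact h.congr_fun fun n => by ring

theorem integrable_id_poissonMeasure (r : ℝ≥0) :
    Integrable (fun n : ℕ => (n : ℝ)) (poissonMeasure r) := by
  rw [integrable_poissonMeasure_iff]
  simpa using (hasSum_poisson_mul_id r).summable

theorem integral_id_poissonMeasure (r : ℝ≥0) : ∫ n : ℕ, (n : ℝ) ∂poissonMeasure r = r := by
  have h := hasSum_integral_poissonMeasure (integrable_id_poissonMeasure r)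
  exact h.unique (hasSum_poisson_mul_id r)

theorem integrable_sub_sq_poissonMeasure (r : ℝ≥0) :
    Integrable (fun n : ℕ => ((n : ℝ) - r) ^ 2) (poissonMeasure r) := by
  rw [integrable_poissonMeasure_iff]
  simpa using (hasSum_poisson_variance r).summable

theorem integral_sub_sq_poissonMeasure (r : ℝ≥0) :
    ∫ n : ℕ, ((n : ℝ) - r) ^ 2 ∂poissonMeasure r = r := by
  have h := hasSum_integral_poissonMeasure (integrable_sub_sq_poissonMeasure r)
  exact h.unique (hasSum_poisson_variance r)

end PoissonMoments

/-! ### Poisson random measures: Campbell's formula and the compensated integral -/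

section PoissonRandomMeasure

variable {Ω X : Type*} [MeasurableSpace Ω] [MeasurableSpace X] {P : Measure Ω}
  {π : Ω → Measure X} {μ : Measure X}

namespace IsPoissonRandomMeasure

theorem measurable_measure (h : IsPoissonRandomMeasure P π μ) : Measurable π :=
  Measure.measurable_of_measurable_coe _ h.measurable

theorem lintegral_apply (h : IsPoissonRandomMeasure P π μ) {B : Set X} (hB : MeasurableSet B)
    (hμ : μ B ≠ ∞) : ∫⁻ ω, π ω B ∂P = μ B := by
  have h1 : ∫⁻ ω, π ω B ∂P = ∫⁻ x, x ∂(P.map fun ω => π ω B) :=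
    (lintegral_map measurable_id (h.measurable B hB)).symm
  have h0 : ∫⁻ x, x ∂((poissonMeasure (μ B).toNNReal).map fun n : ℕ => (n : ℝ≥0∞)) =
      ∫⁻ n : ℕ, (n : ℝ≥0∞) ∂poissonMeasure (μ B).toNNReal :=
    lintegral_map measurable_id (by fun_prop)
  rw [h1, h.law B hB hμ, h0]
  have h2 : ∀ n : ℕ, (n : ℝ≥0∞) = ENNReal.ofReal (n : ℝ) := fun n => by simp
  simp_rw [h2]
  rw [← ofReal_integral_eq_lintegral_ofReal (integrable_id_poissonMeasure _)
    (Eventually.of_forall fun n => Nat.cast_nonneg n), integral_id_poissonMeasure]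
  simp [hμ]

/-- The intensity measure of `π` is `μ`. -/
theorem bind_eq (h : IsPoissonRandomMeasure P π μ) [SigmaFinite μ] : P.bind π = μ := by
  ext B hB
  rw [Measure.bind_apply hB h.measurable_measure.aemeasurable]
  have h1 : ∀ ω, π ω B = ⨆ n, π ω (B ∩ spanningSets μ n) := fun ω => by
    rw [← Directed.measure_iUnion, ← Set.inter_iUnion, iUnion_spanningSets, Set.inter_univ]
    exact (monotone_const.inter (monotone_spanningSets μ)).directed_le
  have h2 : μ B = ⨆ n, μ (B ∩ spanningSets μ n) := by
    rw [← Directed.measure_iUnion, ← Set.inter_iUnion, iUnion_spanningSets, Set.inter_univ]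
    exact (monotone_const.inter (monotone_spanningSets μ)).directed_le
  have hm : ∀ n, MeasurableSet (B ∩ spanningSets μ n) := fun n =>
    hB.inter (measurableSet_spanningSets μ n)
  simp_rw [h1]
  rw [lintegral_iSup (fun n => h.measurable _ (hm n)), h2]
  · refine iSup_congr fun n => h.lintegral_apply (hm n) ?_
    exact ((measure_mono Set.inter_subset_right).trans_lt (measure_spanningSets_lt_top μ n)).ne
  · intro i j hij ω
    exact measure_mono (Set.inter_subset_inter_right _ (monotone_spanningSets μ hij))

/-- Campbell's formula. -/
theorem lintegral_lintegral (h : IsPoissonRandomMeasure P π μ) [SigmaFinite μ] {f : X → ℝ≥0∞}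
    (hf : AEMeasurable f μ) : ∫⁻ ω, ∫⁻ x, f x ∂π ω ∂P = ∫⁻ x, f x ∂μ := by
  have h1 := Measure.lintegral_bind (m := P) (f := f) h.measurable_measure.aemeasurable
    (by rwa [h.bind_eq])
  rw [← h1, h.bind_eq]

theorem ae_ae (h : IsPoissonRandomMeasure P π μ) [SigmaFinite μ] {p : X → Prop}
    (hp : ∀ᵐ x ∂μ, p x) : ∀ᵐ ω ∂P, ∀ᵐ x ∂π ω, p x := by
  rw [← h.bind_eq] at hp
  exact Measure.ae_ae_of_ae_bind h.measurable_measure.aemeasurable hp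

theorem ae_lintegral_lt_top (h : IsPoissonRandomMeasure P π μ) [SigmaFinite μ] {f : X → ℝ≥0∞}
    (hf : Measurable f) (hfi : ∫⁻ x, f x ∂μ ≠ ∞) : ∀ᵐ ω ∂P, ∫⁻ x, f x ∂π ω < ∞ := by
  refine ae_lt_top ?_ (by rwa [h.lintegral_lintegral hf.aemeasurable])
  exact (Measure.measurable_lintegral hf).comp h.measurable_measure

theorem ae_integrable (h : IsPoissonRandomMeasure P π μ) [SigmaFinite μ] {F : Type*}
    [NormedAddCommGroup F] {f : X → F} (hf : Integrable f μ) :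
    ∀ᵐ ω ∂P, Integrable f (π ω) := by
  set g := hf.1.mk f with hg
  have hgm : StronglyMeasurable g := hf.1.stronglyMeasurable_mk
  have h1 : ∫⁻ x, ‖g x‖ₑ ∂μ ≠ ∞ := ((integrable_congr hf.1.ae_eq_mk).1 hf).2.ne
  filter_upwards [h.ae_ae hf.1.ae_eq_mk, h.ae_lintegral_lt_top hgm.enorm h1] with ω h2 h3
  exact (integrable_congr h2).2 ⟨hgm.aestronglyMeasurable, h3⟩

theorem ae_measure_lt_top (h : IsPoissonRandomMeasure P π μ) {B : Set X} (hB : MeasurableSet B)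
    (hμ : μ B ≠ ∞) : ∀ᵐ ω ∂P, π ω B < ∞ :=
  ae_lt_top (h.measurable B hB) (by rwa [h.lintegral_apply hB hμ])

/-- The `L¹` bound for integrals with respect to the compensated measure. -/
theorem lintegral_enorm_integral_sub_le (h : IsPoissonRandomMeasure P π μ) [SigmaFinite μ]
    [IsProbabilityMeasure P] {F : Type*} [NormedAddCommGroup F] [NormedSpace ℝ F] {f : X → F}
    (hf : AEStronglyMeasurable f μ) :
    ∫⁻ ω, ‖∫ x, f x ∂π ω - ∫ x, f x ∂μ‖ₑ ∂P ≤ 2 * ∫⁻ x, ‖f x‖ₑ ∂μ := by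
  calc ∫⁻ ω, ‖∫ x, f x ∂π ω - ∫ x, f x ∂μ‖ₑ ∂P
      ≤ ∫⁻ ω, (∫⁻ x, ‖f x‖ₑ ∂π ω + ∫⁻ x, ‖f x‖ₑ ∂μ) ∂P := by
        refine lintegral_mono fun ω => enorm_sub_le.trans ?_
        exact add_le_add (enorm_integral_le_lintegral_enorm _)
          (enorm_integral_le_lintegral_enorm _)
    _ = _ := by
        rw [lintegral_add_right _ measurable_const, h.lintegral_lintegral hf.enorm]
        simp [two_mul]

/-- The probability that `π` charges `B` is at most `μ B`, because `π B` is integer valued. -/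
theorem measure_ne_zero_le (h : IsPoissonRandomMeasure P π μ) {B : Set X} (hB : MeasurableSet B)
    (hμ : μ B ≠ ∞) : P {ω | π ω B ≠ 0} ≤ μ B := by
  have hS : MeasurableSet {x : ℝ≥0∞ | x ≠ 0 ∧ x < 1} :=
    (measurableSet_singleton 0).compl.inter measurableSet_Iio
  have h1 : P {ω | π ω B ≠ 0 ∧ π ω B < 1} = 0 := by
    have h2 := congrArg (fun m => m {x : ℝ≥0∞ | x ≠ 0 ∧ x < 1}) (h.law B hB hμ)
    rw [Measure.map_apply (h.measurable B hB) hS, Measure.map_apply (by fun_prop) hS] at h2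
    have h3 : (fun n : ℕ => (n : ℝ≥0∞)) ⁻¹' {x : ℝ≥0∞ | x ≠ 0 ∧ x < 1} = ∅ := by
      ext n
      simp only [Set.mem_preimage, Set.mem_ofPred_eq, Set.mem_empty_iff_false, iff_false, not_and,
        not_lt]
      intro hn
      have : n ≠ 0 := by exact_mod_cast hn
      exact_mod_cast Nat.one_le_iff_ne_zero.2 this
    rw [h3, measure_empty] at h2
    exact h2
  calc P {ω | π ω B ≠ 0} ≤ P ({ω | 1 ≤ π ω B} ∪ {ω | π ω B ≠ 0 ∧ π ω B < 1}) := by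
        refine measure_mono fun ω hω => ?_
        rcases le_or_gt 1 (π ω B) with h4 | h4
        · exact Or.inl h4
        · exact Or.inr ⟨hω, h4⟩
    _ ≤ P {ω | 1 ≤ π ω B} + P {ω | π ω B ≠ 0 ∧ π ω B < 1} := measure_union_le _ _
    _ = P {ω | 1 ≤ π ω B} + 0 := by rw [h1]
    _ ≤ ∫⁻ ω, π ω B ∂P := by
        rw [add_zero]
        have := mul_meas_ge_le_lintegral (μ := P) (h.measurable B hB) 1
        rwa [one_mul] at this
    _ = μ B := h.lintegral_apply hB hμ

section Isometry

theorem map_real (h : IsPoissonRandomMeasure P π μ) {B : Set X} (hB : MeasurableSet B)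
    (hμ : μ B ≠ ∞) :
    P.map (fun ω => (π ω).real B) = (poissonMeasure (μ B).toNNReal).map fun n : ℕ => (n : ℝ) := by
  have h1 : (fun ω => (π ω).real B) = ENNReal.toReal ∘ fun ω => π ω B := rfl
  rw [h1, ← Measure.map_map ENNReal.measurable_toReal (h.measurable B hB), h.law B hB hμ,
    Measure.map_map ENNReal.measurable_toReal (by fun_prop)]
  congr 1

theorem measurable_real (h : IsPoissonRandomMeasure P π μ) {B : Set X} (hB : MeasurableSet B) :
    Measurable fun ω => (π ω).real B :=
  ENNReal.measurable_toReal.comp (h.measurable B hB)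

theorem integral_comp_real (h : IsPoissonRandomMeasure P π μ) {B : Set X} (hB : MeasurableSet B)
    (hμ : μ B ≠ ∞) {g : ℝ → ℝ} (hg : Continuous g)
    (hgi : Integrable (fun n : ℕ => g n) (poissonMeasure (μ B).toNNReal)) :
    Integrable (fun ω => g ((π ω).real B)) P ∧
      ∫ ω, g ((π ω).real B) ∂P = ∫ n : ℕ, g n ∂poissonMeasure (μ B).toNNReal := by
  have hm := (h.measurable_real hB).aemeasurable (μ := P)
  have hc : AEMeasurable (fun n : ℕ => (n : ℝ)) (poissonMeasure (μ B).toNNReal) := by fun_prop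
  constructor
  · have h1 : Integrable g (P.map fun ω => (π ω).real B) := by
      rw [h.map_real hB hμ, integrable_map_measure hg.aestronglyMeasurable hc]
      exact hgi
    exact (integrable_map_measure hg.aestronglyMeasurable hm).1 h1
  · rw [← integral_map hm hg.aestronglyMeasurable, h.map_real hB hμ,
      integral_map hc hg.aestronglyMeasurable]

theorem coe_toNNReal_measure {B : Set X} : ((μ B).toNNReal : ℝ) = μ.real B := rfl

theorem integral_sub_real (h : IsPoissonRandomMeasure P π μ) [IsProbabilityMeasure P] {B : Set X}
    (hB : MeasurableSet B) (hμ : μ B ≠ ∞) :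
    Integrable (fun ω => (π ω).real B - μ.real B) P ∧
      ∫ ω, ((π ω).real B - μ.real B) ∂P = 0 := by
  obtain ⟨h1, h2⟩ := h.integral_comp_real hB hμ continuous_id (integrable_id_poissonMeasure _)
  simp only [id] at h1 h2
  refine ⟨h1.sub (integrable_const _), ?_⟩
  rw [integral_sub h1 (integrable_const _), h2, integral_id_poissonMeasure, coe_toNNReal_measure]
  simp

theorem integral_sub_real_sq (h : IsPoissonRandomMeasure P π μ) {B : Set X}
    (hB : MeasurableSet B) (hμ : μ B ≠ ∞) :
    Integrable (fun ω => ((π ω).real B - μ.real B) ^ 2) P ∧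
      ∫ ω, ((π ω).real B - μ.real B) ^ 2 ∂P = μ.real B := by
  have h1 := h.integral_comp_real hB hμ (g := fun x => (x - μ.real B) ^ 2) (by fun_prop)
    (integrable_sub_sq_poissonMeasure _)
  refine ⟨h1.1, h1.2.trans ?_⟩
  exact integral_sub_sq_poissonMeasure (μ B).toNNReal

theorem integral_sub_real_mul (h : IsPoissonRandomMeasure P π μ) [IsProbabilityMeasure P]
    {B B' : Set X} (hB : MeasurableSet B) (hμ : μ B ≠ ∞) (hB' : MeasurableSet B') (hμ' : μ B' ≠ ∞)
    (hd : Disjoint B B') :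
    Integrable (fun ω => ((π ω).real B - μ.real B) * ((π ω).real B' - μ.real B')) P ∧
      ∫ ω, ((π ω).real B - μ.real B) * ((π ω).real B' - μ.real B') ∂P = 0 := by
  have h1 : IndepFun (fun ω => π ω B) (fun ω => π ω B') P := by
    have h2 := h.indep 2 ![B, B'] (by intro i; fin_cases i <;> simpa) (by
      intro i j hij
      fin_cases i <;> fin_cases j <;> first | exact absurd rfl hij | exact hd | exact hd.symm)
    exact h2.indepFun (show (0 : Fin 2) ≠ 1 by simp)
  have h3 : IndepFun (fun ω => (π ω).real B - μ.real B) (fun ω => (π ω).real B' - μ.real B') P :=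
    h1.comp (φ := fun x : ℝ≥0∞ => x.toReal - μ.real B)
      (ψ := fun x : ℝ≥0∞ => x.toReal - μ.real B') (by fun_prop) (by fun_prop)
  obtain ⟨i1, z1⟩ := h.integral_sub_real hB hμ
  obtain ⟨i2, z2⟩ := h.integral_sub_real hB' hμ'
  refine ⟨h3.integrable_mul i1 i2, ?_⟩
  have h4 := h3.integral_fun_mul_eq_mul_integral i1.1 i2.1
  rw [h4, z1, zero_mul]

variable {F : Type*} [NormedAddCommGroup F]

theorem simpleFunc_integral_sub_eq [NormedSpace ℝ F] (g : SimpleFunc X F) (ω : Ω) :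
    g.integral (π ω) - g.integral μ =
      ∑ x ∈ g.range, ((π ω).real (g ⁻¹' {x}) - μ.real (g ⁻¹' {x})) • x := by
  rw [SimpleFunc.integral_eq, SimpleFunc.integral_eq, ← Finset.sum_sub_distrib]
  simp_rw [sub_smul]

theorem stronglyMeasurable_simpleFunc_integral_sub [NormedSpace ℝ F]
    (h : IsPoissonRandomMeasure P π μ) (g : SimpleFunc X F) :
    StronglyMeasurable fun ω => g.integral (π ω) - g.integral μ := by
  simp_rw [simpleFunc_integral_sub_eq]
  refine Finset.stronglyMeasurable_fun_sum _ fun x _ => ?_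
  exact ((h.measurable_real (g.measurableSet_fiber x)).sub_const _).stronglyMeasurable.smul_const x

/-- The isometry for the elementary compensated integrals. -/
theorem eLpNorm_simpleFunc_integral_sub [InnerProductSpace ℝ F] [IsProbabilityMeasure P]
    (h : IsPoissonRandomMeasure P π μ) {g : SimpleFunc X F} (hg : Integrable g μ) :
    eLpNorm (fun ω => g.integral (π ω) - g.integral μ) 2 P = eLpNorm g 2 μ := by
  classical
  set c : F → Ω → ℝ := fun x ω => (π ω).real (g ⁻¹' {x}) - μ.real (g ⁻¹' {x}) with hc
  have hfin : ∀ x, x ≠ 0 → μ (g ⁻¹' {x}) ≠ ∞ := fun x hx => (SimpleFunc.integrable_iff.1 hg x hx).ne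
  have hms : ∀ x, MeasurableSet (g ⁻¹' {x}) := g.measurableSet_fiber
  have hexp : ∀ ω, ‖g.integral (π ω) - g.integral μ‖ ^ 2 =
      ∑ x ∈ g.range, ∑ y ∈ g.range, (c x ω * c y ω) * ⟪x, y⟫_ℝ := fun ω => by
    rw [simpleFunc_integral_sub_eq, ← real_inner_self_eq_norm_sq, sum_inner]
    refine Finset.sum_congr rfl fun x _ => ?_
    rw [inner_sum]
    refine Finset.sum_congr rfl fun y _ => ?_
    rw [real_inner_smul_left, real_inner_smul_right]; ring
  have hint : ∀ x y, Integrable (fun ω => (c x ω * c y ω) * ⟪x, y⟫_ℝ) P ∧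
      ∫ ω, (c x ω * c y ω) * ⟪x, y⟫_ℝ ∂P =
        if x = y then μ.real (g ⁻¹' {x}) * ‖x‖ ^ 2 else 0 := fun x y => by
    by_cases hx : x = 0
    · subst hx; simp
    by_cases hy : y = 0
    · subst hy; simp [hx]
    rw [integral_mul_const]
    by_cases hxy : x = y
    · subst hxy
      obtain ⟨i1, i2⟩ := h.integral_sub_real_sq (hms x) (hfin x hx)
      simp_rw [sq] at i1 i2
      rw [if_pos rfl, real_inner_self_eq_norm_sq]
      exact ⟨i1.mul_const _, by rw [i2]⟩
    · obtain ⟨i1, i2⟩ := h.integral_sub_real_mul (hms x) (hfin x hx) (hms y) (hfin y hy)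
        (Disjoint.preimage _ (by simpa using hxy))
      rw [if_neg hxy]
      exact ⟨i1.mul_const _, by rw [i2, zero_mul]⟩
  have hI : Integrable (fun ω => ‖g.integral (π ω) - g.integral μ‖ ^ 2) P := by
    simp_rw [hexp]
    exact integrable_finsetSum _ fun x _ => integrable_finsetSum _ fun y _ => (hint x y).1
  have hval : ∫ ω, ‖g.integral (π ω) - g.integral μ‖ ^ 2 ∂P =
      ∑ x ∈ g.range, μ.real (g ⁻¹' {x}) * ‖x‖ ^ 2 := by
    simp_rw [hexp]
    rw [integral_finsetSum _ fun x _ => integrable_finsetSum _ fun y _ => (hint x y).1]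
    refine Finset.sum_congr rfl fun x hx => ?_
    rw [integral_finsetSum _ fun y _ => (hint x y).1]
    simp_rw [(hint x _).2]
    rw [Finset.sum_ite_eq, if_pos hx]
  have hg2 : ∫ x, ‖g x‖ ^ 2 ∂μ = ∑ x ∈ g.range, μ.real (g ⁻¹' {x}) * ‖x‖ ^ 2 := by
    have h1 := SimpleFunc.map_integral g (fun x : F => ‖x‖ ^ 2) hg (by simp)
    rw [SimpleFunc.integral_eq_integral] at h1
    · exact h1
    · exact (memLp_two_iff_integrable_sq_norm hg.1).1
        ((SimpleFunc.memLp_iff_integrable two_ne_zero (by simp)).2 hg)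
  have hD : MemLp (fun ω => g.integral (π ω) - g.integral μ) 2 P :=
    (memLp_two_iff_integrable_sq_norm
      (h.stronglyMeasurable_simpleFunc_integral_sub g).aestronglyMeasurable).2 hI
  have hG : MemLp g 2 μ := (SimpleFunc.memLp_iff_integrable two_ne_zero (by simp)).2 hg
  rw [hD.eLpNorm_eq_integral_rpow_norm two_ne_zero (by simp),
    hG.eLpNorm_eq_integral_rpow_norm two_ne_zero (by simp)]
  simp only [ENNReal.toReal_ofNat, Real.rpow_two]
  rw [hval, hg2]

/-- For an integrable integrand the compensated integral is the difference of two Bochner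
integrals. -/
theorem ae_eq_of_isCompensatedIntegral [InnerProductSpace ℝ F] [CompleteSpace F]
    [IsProbabilityMeasure P] [SigmaFinite μ] (h : IsPoissonRandomMeasure P π μ) {f : X → F}
    {I : Ω → F} (hI : IsCompensatedIntegral P π μ f I) (hf : Integrable f μ) :
    I =ᵐ[P] fun ω => ∫ x, f x ∂π ω - ∫ x, f x ∂μ := by
  borelize F
  obtain ⟨hf2, hI2, g, hg, hgf, hgI⟩ := hI
  set f' := hf.1.mk f with hf'
  have hfm : StronglyMeasurable f' := hf.1.stronglyMeasurable_mk
  have hff : f =ᵐ[μ] f' := hf.1.ae_eq_mk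
  have : SeparableSpace (Set.range f' ∪ {0} : Set F) := hfm.separableSpace_range_union_singleton
  -- simple functions converging to `f` pointwise, in `L¹` and in `L²`
  let G : ℕ → SimpleFunc X F := fun n =>
    SimpleFunc.approxOn f' hfm.measurable (Set.range f' ∪ {0}) 0 (by simp) n
  have hf'1 : Integrable f' μ := (integrable_congr hff).1 hf
  have hf'2 : MemLp f' 2 μ := (memLp_congr_ae hff).1 hf2
  have hG : ∀ n, Integrable (G n) μ := fun n =>
    SimpleFunc.integrable_approxOn_range hfm.measurable hf'1 n
  have hGf : Tendsto (fun n => eLpNorm (⇑(G n) - f') 2 μ) atTop (𝓝 0) :=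
    SimpleFunc.tendsto_approxOn_range_Lp_eLpNorm (by simp) hfm.measurable hf'2.2
  have hGg : Tendsto (fun n => eLpNorm (⇑(G n - g n)) 2 μ) atTop (𝓝 0) := by
    refine tendsto_of_tendsto_of_tendsto_of_le_of_le tendsto_const_nhds
      (by simpa using hGf.add hgf) (fun _ => zero_le) fun n => ?_
    have h1 : ⇑(G n - g n) =ᵐ[μ] (⇑(G n) - f') + fun x => f x - g n x := by
      filter_upwards [hff] with x hx
      simp [hx]
    rw [eLpNorm_congr_ae h1]
    exact eLpNorm_add_le ((G n).stronglyMeasurable.sub hfm).aestronglyMeasurable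
      (hf.1.sub (g n).aestronglyMeasurable) one_le_two
  set E : SimpleFunc X F → Ω → F := fun g ω => g.integral (π ω) - g.integral μ with hE
  have hEm : ∀ g, AEStronglyMeasurable (E g) P := fun g =>
    (h.stronglyMeasurable_simpleFunc_integral_sub g).aestronglyMeasurable
  have hsub : ∀ n, E (G n) =ᵐ[P] E (G n - g n) + E (g n) := fun n => by
    filter_upwards [h.ae_integrable (hG n), h.ae_integrable (hg n)] with ω h1 h2
    simp only [hE, Pi.add_apply]
    rw [SimpleFunc.integral_sub h1 h2, SimpleFunc.integral_sub (hG n) (hg n)]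
    abel
  have hEI : Tendsto (fun n => eLpNorm (E (G n) - I) 2 P) atTop (𝓝 0) := by
    refine tendsto_of_tendsto_of_tendsto_of_le_of_le tendsto_const_nhds
      (by simpa using hGg.add hgI) (fun _ => zero_le) fun n => ?_
    have h1 : E (G n) - I =ᵐ[P] E (G n - g n) - (fun ω => I ω - E (g n) ω) := by
      filter_upwards [hsub n] with ω hω
      simp only [Pi.sub_apply, hω, Pi.add_apply]
      abel
    rw [eLpNorm_congr_ae h1]
    refine (eLpNorm_sub_le (hEm _) (hI2.1.sub (hEm _)) one_le_two).trans ?_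
    exact add_le_add (h.eLpNorm_simpleFunc_integral_sub ((hG n).sub (hg n))).le le_rfl
  have hlim : ∀ m : Measure X, Integrable f' m →
      Tendsto (fun n => (G n).integral m) atTop (𝓝 (∫ x, f' x ∂m)) := fun m hm => by
    have h1 := tendsto_integral_approxOn_of_measurable_of_range_subset hfm.measurable hm
      (Set.range f' ∪ {0}) le_rfl
    refine h1.congr fun n => ?_
    rw [SimpleFunc.integral_eq_integral]
    exact SimpleFunc.integrable_approxOn_range hfm.measurable hm n
  have hEJ : ∀ᵐ ω ∂P, Tendsto (fun n => E (G n) ω) atTop (𝓝 (∫ x, f' x ∂π ω - ∫ x, f' x ∂μ)) := by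
    filter_upwards [h.ae_integrable hf'1] with ω hω
    exact (hlim _ hω).sub (hlim _ hf'1)
  have h1 : TendstoInMeasure P (fun n => E (G n)) atTop I :=
    tendstoInMeasure_of_tendsto_eLpNorm two_ne_zero (fun n => hEm _) hI2.1 hEI
  have h2 : TendstoInMeasure P (fun n => E (G n)) atTop
      fun ω => ∫ x, f' x ∂π ω - ∫ x, f' x ∂μ :=
    tendstoInMeasure_of_tendsto_ae (fun n => hEm _) hEJ
  have h3 := tendstoInMeasure_ae_unique h1 h2
  filter_upwards [h3, h.ae_ae hff] with ω h4 h5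
  rw [h4, integral_congr_ae h5, integral_congr_ae hff]

end Isometry

/-- Integrals with respect to `π` over a set of finite intensity depend measurably on the
randomness, also when the integrand does. -/
theorem aestronglyMeasurable_setIntegral (h : IsPoissonRandomMeasure P π μ) {K : Set X}
    (hK : MeasurableSet K) (hμ : μ K ≠ ∞) {F : Type*} [NormedAddCommGroup F] [NormedSpace ℝ F]
    {f : Ω → X → F} (hf : StronglyMeasurable (Function.uncurry f)) :
    AEStronglyMeasurable (fun ω => ∫ x in K, f ω x ∂π ω) P := by
  -- the restriction of `π` to `K`, cut into pieces of bounded mass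
  have hlevel : ∀ n : ℕ, MeasurableSet {ω | (n : ℝ≥0∞) ≤ π ω K ∧ π ω K < n + 1} := fun n =>
    (measurableSet_le measurable_const (h.measurable K hK)).inter
      (measurableSet_lt (h.measurable K hK) measurable_const)
  have hmr : Measurable fun ω => (π ω).restrict K := by
    refine Measure.measurable_of_measurable_coe _ fun B hB => ?_
    simp_rw [Measure.restrict_apply hB]
    exact h.measurable _ (hB.inter hK)
  classical
  let κ : ℕ → Kernel Ω X := fun n => Kernel.piecewise (hlevel n) ⟨fun ω => (π ω).restrict K, hmr⟩ 0
  have hκ : ∀ n ω, κ n ω =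
      if (n : ℝ≥0∞) ≤ π ω K ∧ π ω K < n + 1 then (π ω).restrict K else 0 := fun n ω => by
    simp only [κ, Kernel.piecewise_apply]
    rfl
  have hfin : ∀ n, IsFiniteKernel (κ n) := fun n => by
    refine ⟨⟨n + 1, by simp, fun ω => ?_⟩⟩
    rw [hκ]
    split_ifs with hω
    · rw [Measure.restrict_apply_univ]; exact hω.2.le
    · simp
  have hm := hf.integral_kernel_prod_right (κ := Kernel.sum κ)
  refine ⟨_, hm, ?_⟩
  filter_upwards [h.ae_measure_lt_top hK hμ] with ω hω
  have h1 : Kernel.sum κ ω = (π ω).restrict K := by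
    rw [Kernel.sum_apply]
    ext B hB
    rw [Measure.sum_apply _ hB]
    simp_rw [hκ]
    have hfl : ∀ n : ℕ, ((n : ℝ≥0∞) ≤ π ω K ∧ π ω K < n + 1) ↔ n = ⌊(π ω K).toReal⌋₊ := fun n => by
      obtain ⟨r, hr⟩ : ∃ r : ℝ≥0, (r : ℝ≥0∞) = π ω K := ⟨_, ENNReal.coe_toNNReal hω.ne⟩
      rw [eq_comm (a := n), Nat.floor_eq_iff ENNReal.toReal_nonneg, ← hr, ENNReal.coe_toReal]
      norm_cast
    simp_rw [hfl]
    rw [tsum_eq_single ⌊(π ω K).toReal⌋₊ fun n hn => by rw [if_neg hn]; rfl, if_pos rfl]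
  rw [h1]

end IsPoissonRandomMeasure

end PoissonRandomMeasure

/-! ### Dirac functionals on Sobolev spaces -/

section Dirac

variable {d : ℕ} {O : Opens (Pt d)} {s : ℝ}

theorem integrable_sobolevWeight (hs : (d : ℝ) / 2 < s) :
    Integrable fun k : Pt d => (1 + ‖k‖ ^ 2) ^ (-s) := by
  have h := integrable_rpow_neg_one_add_norm_sq (μ := (volume : Measure (Pt d))) (r := 2 * s)
    (by rw [finrank_euclideanSpace_fin]; linarith)
  refine h.congr (Eventually.of_forall fun k => ?_)
  simp only
  congr 1
  ring

/-- The Cauchy-Schwarz inequality for a Fourier multiplier applied to a test function. -/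
theorem norm_integral_mul_fourier_le (hs : (d : ℝ) / 2 < s) {c : Pt d → ℂ} (hc : Continuous c)
    (hc2 : ∀ k, ‖c k‖ ≤ 2) (ψ : SobolevTest O s) :
    ‖∫ k, c k * (𝓕 (testToSchwartz (SobolevTest.toTest O s ψ))) k‖ ≤
      (∫ k : Pt d, ‖c k‖ ^ 2 * (1 + ‖k‖ ^ 2) ^ (-s)) ^ (1 / 2 : ℝ) * ‖ψ‖ := by
  set χ := SobolevTest.toTest O s ψ with hχ
  set g : SchwartzMap (Pt d) ℂ := 𝓕 (testToSchwartz χ) with hg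
  have hpos : ∀ k : Pt d, (0 : ℝ) < 1 + ‖k‖ ^ 2 := fun k => by positivity
  have hw : ∀ k, ‖weightedFourier s χ k‖ = (1 + ‖k‖ ^ 2) ^ (s / 2) * ‖g k‖ := fun k => by
    rw [weightedFourier, SchwartzMap.smulLeftCLM_apply_apply (hasTemperateGrowth_weight s),
      norm_smul, Real.norm_of_nonneg (Real.rpow_nonneg (hpos k).le _)]
  have h4 : ∀ k, ‖c k * g k‖ =
      (‖c k‖ * (1 + ‖k‖ ^ 2) ^ (-s / 2)) * ‖weightedFourier s χ k‖ := fun k => by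
    rw [hw, norm_mul, mul_assoc, ← mul_assoc ((1 + ‖k‖ ^ 2) ^ (-s / 2)), ← Real.rpow_add (hpos k)]
    simp [neg_div]
  have h5 : ∀ k : Pt d, (‖c k‖ * (1 + ‖k‖ ^ 2) ^ (-s / 2) : ℝ) ^ (2 : ℝ) =
      ‖c k‖ ^ 2 * (1 + ‖k‖ ^ 2) ^ (-s) := fun k => by
    rw [Real.mul_rpow (norm_nonneg _) (Real.rpow_nonneg (hpos k).le _),
      ← Real.rpow_mul (hpos k).le, Real.rpow_two]
    congr 2
    ring
  have hmeas : AEStronglyMeasurable (fun k : Pt d => (‖c k‖ * (1 + ‖k‖ ^ 2) ^ (-s / 2) : ℝ))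
      volume :=
    (hc.norm.mul (hasTemperateGrowth_weight (-s)).1.continuous).aestronglyMeasurable
  have h6 : MemLp (fun k : Pt d => (‖c k‖ * (1 + ‖k‖ ^ 2) ^ (-s / 2) : ℝ)) (ENNReal.ofReal 2)
      volume := by
    rw [← integrable_norm_rpow_iff hmeas (by simp) (by simp)]
    simp only [ENNReal.toReal_ofReal (zero_le_two : (0 : ℝ) ≤ 2)]
    have hcm : Continuous fun k : Pt d => (‖c k‖ * (1 + ‖k‖ ^ 2) ^ (-s / 2) : ℝ) :=
      hc.norm.mul (hasTemperateGrowth_weight (-s)).1.continuous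
    refine ((integrable_sobolevWeight hs).const_mul 4).mono'
      (hcm.norm.rpow_const fun _ => Or.inr zero_le_two).aestronglyMeasurable
      (Eventually.of_forall fun k => ?_)
    have h0 : 0 ≤ ‖c k‖ * (1 + ‖k‖ ^ 2) ^ (-s / 2) :=
      mul_nonneg (norm_nonneg _) (Real.rpow_nonneg (hpos k).le _)
    rw [Real.norm_of_nonneg (Real.rpow_nonneg (norm_nonneg _) _), Real.norm_of_nonneg h0, h5]
    refine mul_le_mul_of_nonneg_right ?_ (Real.rpow_nonneg (hpos k).le _)
    nlinarith [hc2 k, norm_nonneg (c k)]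
  have h7 : MemLp (fun k : Pt d => ‖weightedFourier s χ k‖) (ENNReal.ofReal 2) volume :=
    ((weightedFourier s χ).memLp _ volume).norm
  have h8 := integral_mul_le_Lp_mul_Lq_of_nonneg Real.HolderConjugate.two_two
    (Eventually.of_forall fun k =>
      mul_nonneg (norm_nonneg (c k)) (Real.rpow_nonneg (hpos k).le (-s / 2)))
    (Eventually.of_forall fun k => norm_nonneg _) h6 h7
  have h9 : ‖ψ‖ = (∫ k : Pt d, ‖weightedFourier s χ k‖ ^ (2 : ℝ)) ^ (1 / 2 : ℝ) := by
    rw [SobolevTest.norm_def, SchwartzMap.norm_toLp' (by simp) (by simp)]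
    simp [hχ]
  rw [h9]
  refine (norm_integral_le_integral_norm _).trans ?_
  simp_rw [h4]
  simp_rw [h5] at h8
  exact h8

/-- Fourier inversion: `δ_ξ` is the Fourier multiplier `k ↦ e^{2πi⟨k, ξ⟩}`. -/
theorem diracDelta_eq_integral_fourier (hs : (d : ℝ) / 2 < s) (ξ : Pt d) (ψ : SobolevTest O s) :
    ((diracDelta O hs ξ ψ : ℝ) : ℂ) =
      ∫ k, (Real.fourierChar ⟪k, ξ⟫_ℝ : ℂ) *
        (𝓕 (testToSchwartz (SobolevTest.toTest O s ψ))) k := by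
  set χ := SobolevTest.toTest O s ψ with hχ
  have h3 : testToSchwartz χ = 𝓕⁻ (𝓕 (testToSchwartz χ)) := by
    rw [FourierTransform.fourierInv_fourier_eq]
  have h2 : ((diracDelta O hs ξ ψ : ℝ) : ℂ) = testToSchwartz χ ξ := by
    rw [diracDelta_apply, testToSchwartz_apply]
  rw [h2]
  conv_lhs => rw [h3]
  rw [SchwartzMap.fourierInv_coe, Real.fourierInv_eq]
  rfl

theorem continuous_fourierChar_inner (ξ : Pt d) :
    Continuous fun k : Pt d => (Real.fourierChar ⟪k, ξ⟫_ℝ : ℂ) := by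
  have h := Real.continuous_fourierChar
  fun_prop

theorem norm_fourierChar_coe (x : ℝ) : ‖(Real.fourierChar x : ℂ)‖ = 1 := Circle.norm_coe _

theorem norm_diracDelta_le (hs : (d : ℝ) / 2 < s) (ξ : Pt d) :
    ‖diracDelta O hs ξ‖ ≤ (∫ k : Pt d, (1 + ‖k‖ ^ 2) ^ (-s)) ^ (1 / 2 : ℝ) := by
  refine ContinuousLinearMap.opNorm_le_bound _
    (Real.rpow_nonneg (integral_nonneg fun k => by positivity) _) fun ψ => ?_
  have h := norm_integral_mul_fourier_le hs (continuous_fourierChar_inner ξ)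
    (fun k => (norm_fourierChar_coe _).trans_le one_le_two) ψ
  rw [← diracDelta_eq_integral_fourier hs, Complex.norm_real] at h
  simp_rw [norm_fourierChar_coe, one_pow, one_mul] at h
  exact h

theorem continuous_diracDelta (hs : (d : ℝ) / 2 < s) : Continuous (diracDelta O hs) := by
  refine continuous_iff_continuousAt.2 fun ξ => tendsto_iff_norm_sub_tendsto_zero.2 ?_
  have hb : ∀ (k η : Pt d),
      ‖(Real.fourierChar ⟪k, η⟫_ℝ : ℂ) - Real.fourierChar ⟪k, ξ⟫_ℝ‖ ≤ 2 := fun k η =>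
    (norm_sub_le _ _).trans (by rw [norm_fourierChar_coe, norm_fourierChar_coe]; norm_num)
  have h1 : ∀ η, ‖diracDelta O hs η - diracDelta O hs ξ‖ ≤
      (∫ k : Pt d, ‖(Real.fourierChar ⟪k, η⟫_ℝ : ℂ) - Real.fourierChar ⟪k, ξ⟫_ℝ‖ ^ 2 *
        (1 + ‖k‖ ^ 2) ^ (-s)) ^ (1 / 2 : ℝ) := fun η => by
    refine ContinuousLinearMap.opNorm_le_bound _
      (Real.rpow_nonneg (integral_nonneg fun k => by positivity) _) fun ψ => ?_
    have h := norm_integral_mul_fourier_le hs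
      ((continuous_fourierChar_inner η).sub (continuous_fourierChar_inner ξ))
      (fun k => hb k η) ψ
    have hi : ∀ ζ : Pt d, Integrable fun k => (Real.fourierChar ⟪k, ζ⟫_ℝ : ℂ) *
        (𝓕 (testToSchwartz (SobolevTest.toTest O s ψ))) k := fun ζ => by
      refine (SchwartzMap.integrable (𝓕 (testToSchwartz (SobolevTest.toTest O s ψ)))).bdd_mul
        (c := 1) (continuous_fourierChar_inner ζ).aestronglyMeasurable
        (Eventually.of_forall fun k => (norm_fourierChar_coe _).le)
    have h2 := integral_sub (hi η) (hi ξ)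
    simp_rw [← sub_mul] at h2
    simp only [Pi.sub_apply] at h
    rw [h2, ← diracDelta_eq_integral_fourier hs, ← diracDelta_eq_integral_fourier hs,
      ← Complex.ofReal_sub, Complex.norm_real] at h
    exact h
  refine tendsto_of_tendsto_of_tendsto_of_le_of_le tendsto_const_nhds ?_ (fun _ => norm_nonneg _) h1
  have h2 : Tendsto (fun η : Pt d => ∫ k : Pt d,
      ‖(Real.fourierChar ⟪k, η⟫_ℝ : ℂ) - Real.fourierChar ⟪k, ξ⟫_ℝ‖ ^ 2 * (1 + ‖k‖ ^ 2) ^ (-s))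
      (𝓝 ξ) (𝓝 (∫ _ : Pt d, (0 : ℝ))) := by
    refine tendsto_integral_filter_of_dominated_convergence
      (fun k => 4 * (1 + ‖k‖ ^ 2) ^ (-s)) (Eventually.of_forall fun η => ?_)
      (Eventually.of_forall fun η => Eventually.of_forall fun k => ?_)
      ((integrable_sobolevWeight hs).const_mul 4) (Eventually.of_forall fun k => ?_)
    · exact (((continuous_fourierChar_inner η).sub
        (continuous_fourierChar_inner ξ)).norm.pow 2).aestronglyMeasurable.mul
        (integrable_sobolevWeight hs).1
    · rw [Real.norm_of_nonneg (by positivity)]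
      refine mul_le_mul_of_nonneg_right ?_ (by positivity)
      nlinarith [hb k η, norm_nonneg ((Real.fourierChar ⟪k, η⟫_ℝ : ℂ) - Real.fourierChar ⟪k, ξ⟫_ℝ)]
    · have hcont : Continuous fun η : Pt d =>
          ‖(Real.fourierChar ⟪k, η⟫_ℝ : ℂ) - Real.fourierChar ⟪k, ξ⟫_ℝ‖ ^ 2 *
            (1 + ‖k‖ ^ 2) ^ (-s) := by
        have h := Real.continuous_fourierChar
        fun_prop
      have h3 := hcont.tendsto ξ
      simpa using h3
  have h3 := h2.rpow_const (p := 1 / 2) (Or.inr (by norm_num))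
  simpa using h3

theorem stronglyMeasurable_diracDelta (hs : (d : ℝ) / 2 < s) :
    StronglyMeasurable (diracDelta O hs) :=
  have : SecondCountableTopologyEither (Pt d) (NegSobolev O s) :=
    secondCountableTopologyEither_of_left _ _
  (continuous_diracDelta hs).stronglyMeasurable

end Dirac

/-! ### The extension of the noise operator to Dirac functionals -/

section NoiseKernel

variable {d : ℕ} {O : Opens (Pt d)} {s : ℝ}

theorem L2.integrable_of_isBounded (hO : Bornology.IsBounded (O : Set (Pt d))) (u : L2 O) :
    Integrable u (volume.restrict (O : Set (Pt d))) := by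
  have : IsFiniteMeasure (volume.restrict (O : Set (Pt d))) :=
    ⟨by rw [Measure.restrict_apply_univ]; exact hO.measure_lt_top⟩
  exact (Lp.memLp u).integrable one_le_two

theorem integral_smul_diracDelta (hO : Bornology.IsBounded (O : Set (Pt d)))
    (hs : (d : ℝ) / 2 < s) (u : L2 O) :
    Integrable (fun ξ => u ξ • diracDelta O hs ξ) (volume.restrict (O : Set (Pt d))) ∧
    ∫ ξ in (O : Set (Pt d)), u ξ • diracDelta O hs ξ = toNegSobolev O hs u := by
  have hi : Integrable (fun ξ => u ξ • diracDelta O hs ξ) (volume.restrict (O : Set (Pt d))) := by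
    refine (L2.integrable_of_isBounded hO u).smul_bdd
      (C := (∫ k : Pt d, (1 + ‖k‖ ^ 2) ^ (-s)) ^ (1 / 2 : ℝ))
      (stronglyMeasurable_diracDelta hs).aestronglyMeasurable
      (Eventually.of_forall fun ξ => norm_diracDelta_le hs ξ)
  refine ⟨hi, ?_⟩
  ext ψ
  rw [ContinuousLinearMap.integral_apply hi, toNegSobolev_apply]
  refine integral_congr_ae (Eventually.of_forall fun ξ => ?_)
  simp [diracDelta_apply, mul_comm]

variable {R : L2 O →L[ℝ] L2 O} {Rext : NegSobolev O s →L[ℝ] L2 O}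

theorem continuous_ext_diracDelta (hs : (d : ℝ) / 2 < s) (Rext : NegSobolev O s →L[ℝ] L2 O) :
    Continuous fun ξ => Rext (diracDelta O hs ξ) :=
  Rext.continuous.comp (continuous_diracDelta hs)

/-- `ξ ↦ ⟨w, Q^{1/2} δ_ξ⟩` is a version of `Q^{1/2} w`. -/
theorem inner_ext_diracDelta_ae (hO : Bornology.IsBounded (O : Set (Pt d)))
    (hs : (d : ℝ) / 2 < s) (hR : IsSelfAdjoint R)
    (hRext : ∀ u : L2 O, Rext (toNegSobolev O hs u) = R u) (w : L2 O) :
    (fun ξ => ⟪w, Rext (diracDelta O hs ξ)⟫_ℝ) =ᵐ[volume.restrict (O : Set (Pt d))] R w := by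
  have : IsFiniteMeasure (volume.restrict (O : Set (Pt d))) :=
    ⟨by rw [Measure.restrict_apply_univ]; exact hO.measure_lt_top⟩
  have hmem : MemLp (fun ξ => ⟪w, Rext (diracDelta O hs ξ)⟫_ℝ) 2
      (volume.restrict (O : Set (Pt d))) := by
    refine MemLp.of_bound
      (continuous_const.inner (continuous_ext_diracDelta hs Rext)).aestronglyMeasurable
      (‖w‖ * (‖Rext‖ * (∫ k : Pt d, (1 + ‖k‖ ^ 2) ^ (-s)) ^ (1 / 2 : ℝ)))
      (Eventually.of_forall fun ξ => ?_)
    refine (norm_inner_le_norm _ _).trans (mul_le_mul_of_nonneg_left ?_ (norm_nonneg _))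
    exact (Rext.le_opNorm _).trans
      (mul_le_mul_of_nonneg_left (norm_diracDelta_le hs ξ) (norm_nonneg _))
  have h1 : hmem.toLp = R w := by
    refine ext_inner_left ℝ fun u => ?_
    have h2 : ⟪u, R w⟫_ℝ = ⟪w, R u⟫_ℝ := by
      rw [← hR.adjoint_eq, ContinuousLinearMap.adjoint_inner_right, real_inner_comm, hR.adjoint_eq]
    obtain ⟨hi, hI⟩ := integral_smul_diracDelta hO hs u
    rw [h2, ← hRext, ← hI, ← ContinuousLinearMap.integral_comp_comm _ hi,
      ← integral_inner (Rext.integrable_comp hi), L2.inner_def]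
    refine integral_congr_ae ?_
    filter_upwards [hmem.coeFn_toLp] with ξ hξ
    rw [hξ, map_smul, inner_smul_right]
    simp [mul_comm]
  rw [← h1]
  exact hmem.coeFn_toLp.symm

/-- `∫_O |E Q^{1/2} δ_ξ|² dξ` is the squared Hilbert-Schmidt norm of `E Q^{1/2}`. -/
theorem lintegral_norm_sq_ext_diracDelta (hO : Bornology.IsBounded (O : Set (Pt d)))
    (hs : (d : ℝ) / 2 < s) (hR : IsSelfAdjoint R)
    (hRext : ∀ u : L2 O, Rext (toNegSobolev O hs u) = R u) (b : HilbertBasis ℕ ℝ (L2 O))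
    (E : L2 O →L[ℝ] L2 O) :
    ∫⁻ ξ in (O : Set (Pt d)), ENNReal.ofReal (‖E (Rext (diracDelta O hs ξ))‖ ^ 2) =
      ∑' k, ENNReal.ofReal (‖E (R (b k))‖ ^ 2) := by
  have h1 : ∀ ξ, ENNReal.ofReal (‖E (Rext (diracDelta O hs ξ))‖ ^ 2) =
      ∑' k, ENNReal.ofReal (⟪b k, E (Rext (diracDelta O hs ξ))⟫_ℝ ^ 2) := fun ξ =>
    (b.tsum_ofReal_inner_sq _).symm
  simp_rw [h1]
  have hm : ∀ k, Continuous fun ξ => ⟪b k, E (Rext (diracDelta O hs ξ))⟫_ℝ ^ 2 := fun k =>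
    (continuous_const.inner (E.continuous.comp (continuous_ext_diracDelta hs Rext))).pow 2
  rw [lintegral_tsum fun k => (hm k).measurable.ennreal_ofReal.aemeasurable]
  have h2 := tsum_norm_sq_eq_adjoint b b (E ∘L R)
  simp only [ContinuousLinearMap.comp_apply] at h2
  rw [h2]
  refine tsum_congr fun k => ?_
  have h3 : (ContinuousLinearMap.adjoint (E ∘L R)) (b k) =
      R (ContinuousLinearMap.adjoint E (b k)) := by
    rw [ContinuousLinearMap.adjoint_comp, hR.adjoint_eq]; rfl
  rw [h3]
  set w := ContinuousLinearMap.adjoint E (b k)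
  have h4 := (Lp.memLp (R w)).integrable_sq
  have h5 : ‖R w‖ ^ 2 = ∫ ξ in (O : Set (Pt d)), (R w) ξ ^ 2 := by
    rw [← real_inner_self_eq_norm_sq, L2.inner_def]
    refine integral_congr_ae (Eventually.of_forall fun ξ => ?_)
    simp [sq]
  rw [h5, ofReal_integral_eq_lintegral_ofReal h4 (Eventually.of_forall fun ξ => sq_nonneg _)]
  refine lintegral_congr_ae ?_
  filter_upwards [inner_ext_diracDelta_ae hO hs hR hRext w] with ξ hξ
  rw [← hξ, ContinuousLinearMap.adjoint_inner_left]

/-- The analogue of `lintegral_norm_sq_ext_diracDelta` for the truncated expansion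
`∑_{k<n} b_k(ξ) b_k` of `δ_ξ`. -/
theorem lintegral_norm_sq_sum_basis_le (R : L2 O →L[ℝ] L2 O) (b : HilbertBasis ℕ ℝ (L2 O)) (n : ℕ)
    (E : L2 O →L[ℝ] L2 O) :
    ∫⁻ ξ in (O : Set (Pt d)),
        ENNReal.ofReal (‖E (∑ k ∈ Finset.range n, b k ξ • R (b k))‖ ^ 2) ≤
      ∑' k, ENNReal.ofReal (‖E (R (b k))‖ ^ 2) := by
  have h1 : ∀ ξ, ‖E (∑ k ∈ Finset.range n, b k ξ • R (b k))‖ ^ 2 =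
      ∑ k ∈ Finset.range n, ∑ l ∈ Finset.range n,
        b k ξ * b l ξ * ⟪E (R (b k)), E (R (b l))⟫_ℝ := fun ξ => by
    rw [← real_inner_self_eq_norm_sq, map_sum, sum_inner]
    refine Finset.sum_congr rfl fun k _ => ?_
    rw [inner_sum]
    refine Finset.sum_congr rfl fun l _ => ?_
    rw [map_smul, map_smul, real_inner_smul_left, real_inner_smul_right, mul_assoc]
  have hi : ∀ k l, Integrable (fun ξ => b k ξ * b l ξ * ⟪E (R (b k)), E (R (b l))⟫_ℝ)
      (volume.restrict (O : Set (Pt d))) := fun k l =>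
    ((Lp.memLp (b k)).integrable_mul (Lp.memLp (b l))).mul_const _
  have hI : Integrable (fun ξ => ‖E (∑ k ∈ Finset.range n, b k ξ • R (b k))‖ ^ 2)
      (volume.restrict (O : Set (Pt d))) := by
    simp_rw [h1]
    exact integrable_finsetSum _ fun k _ => integrable_finsetSum _ fun l _ => hi k l
  rw [← ofReal_integral_eq_lintegral_ofReal hI (Eventually.of_forall fun ξ => sq_nonneg _)]
  have h2 : ∫ ξ in (O : Set (Pt d)), ‖E (∑ k ∈ Finset.range n, b k ξ • R (b k))‖ ^ 2 =
      ∑ k ∈ Finset.range n, ‖E (R (b k))‖ ^ 2 := by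
    simp_rw [h1]
    rw [integral_finsetSum _ fun k _ => integrable_finsetSum _ fun l _ => hi k l]
    refine Finset.sum_congr rfl fun k hk => ?_
    rw [integral_finsetSum _ fun l _ => hi k l]
    have h3 : ∀ l, ∫ ξ in (O : Set (Pt d)), b k ξ * b l ξ * ⟪E (R (b k)), E (R (b l))⟫_ℝ =
        if l = k then ‖E (R (b k))‖ ^ 2 else 0 := fun l => by
      rw [integral_mul_const]
      have h4 : ∫ ξ in (O : Set (Pt d)), b k ξ * b l ξ = ⟪b l, b k⟫_ℝ := by
        rw [L2.inner_def]; rfl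
      rw [h4, b.inner_eq_ite]
      split_ifs with h5
      · rw [h5, real_inner_self_eq_norm_sq, one_mul]
      · rw [zero_mul]
    simp_rw [h3]
    rw [Finset.sum_ite_eq' , if_pos hk]
  rw [h2, ENNReal.ofReal_sum_of_nonneg fun k _ => sq_nonneg _]
  exact ENNReal.sum_le_tsum _

end NoiseKernel

/-! ### The reference measure on sets of jumps -/

section RefMeasure

variable {d : ℕ}

instance {O : Opens (Pt d)} {ν : Measure ℝ} [SigmaFinite ν] : SigmaFinite (refMeasure O ν) := by
  unfold refMeasure
  infer_instance

theorem measurableSet_jumpSet (t : ℝ) {J : Set ℝ} (hJ : MeasurableSet J) :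
    MeasurableSet (jumpSet d t J) :=
  measurableSet_Icc.prod (MeasurableSet.univ.prod hJ)

theorem jumpSet_mono {t t' : ℝ} (h : t ≤ t') {J J' : Set ℝ} (hJ : J ⊆ J') :
    jumpSet d t J ⊆ jumpSet d t' J' :=
  Set.prod_mono (Set.Icc_subset_Icc_right h) (Set.prod_mono subset_rfl hJ)

variable (O : Opens (Pt d)) (ν : Measure ℝ) [SigmaFinite ν]

theorem refMeasure_restrict_jumpSet (t : ℝ) (J : Set ℝ) :
    (refMeasure O ν).restrict (jumpSet d t J) =
      (volume.restrict (Set.Icc 0 t)).prod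
        ((volume.restrict (O : Set (Pt d))).prod (ν.restrict J)) := by
  rw [refMeasure, jumpSet, ← Measure.prod_restrict, ← Measure.prod_restrict, Measure.restrict_univ,
    Measure.restrict_restrict measurableSet_Icc, Set.inter_eq_left.2 Set.Icc_subset_Ici_self]

theorem refMeasure_jumpSet (t : ℝ) (J : Set ℝ) :
    refMeasure O ν (jumpSet d t J) = ENNReal.ofReal t * (volume (O : Set (Pt d)) * ν J) := by
  rw [← Measure.restrict_apply_univ, refMeasure_restrict_jumpSet, ← Set.univ_prod_univ,
    Measure.prod_prod, ← Set.univ_prod_univ, Measure.prod_prod]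
  simp

theorem lintegral_jumpSet (t : ℝ) (J : Set ℝ) {F : ℝ × Pt d → ℝ≥0∞} (hF : Measurable F) :
    ∫⁻ x in jumpSet d t J, ‖x.2.2‖ₑ * F (x.1, x.2.1) ∂refMeasure O ν =
      (∫⁻ σ in J, ‖σ‖ₑ ∂ν) *
        ∫⁻ r in Set.Icc 0 t, ∫⁻ ξ in (O : Set (Pt d)), F (r, ξ) := by
  rw [refMeasure_restrict_jumpSet, lintegral_prod _ (by fun_prop),
    ← lintegral_const_mul _ (hF.lintegral_prod_right')]
  refine lintegral_congr fun r => ?_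
  rw [lintegral_prod _ (by fun_prop), ← lintegral_const_mul _ (by fun_prop)]
  refine lintegral_congr fun ξ => ?_
  simp only
  rw [lintegral_mul_const _ (by fun_prop)]

end RefMeasure

/-! ### Noise kernels -/

section NoiseKernelBounds

variable {d : ℕ} {O : Opens (Pt d)}

/-- An `L²(O)`-valued function `G` on `O` such that, for every bounded operator `E`, the square
integral of `E G` over `O` is at most `c` times the weighted Hilbert-Schmidt norm of `E`. A jump of
size `σ` at `ξ` changes the driving noise by `σ G(ξ)`, where `G(ξ)` is `Q^{1/2} δ_ξ` or an
approximation of it. -/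
structure IsNoiseKernel (e : HilbertBasis ℕ ℝ (L2 O)) (w : ℕ → ℝ) (c : ℝ≥0∞)
    (G : Pt d → L2 O) : Prop where
  stronglyMeasurable : StronglyMeasurable G
  lintegral_lt_top : ∫⁻ ξ in (O : Set (Pt d)), ‖G ξ‖ₑ < ∞
  lintegral_sq_le : ∀ E : L2 O →L[ℝ] L2 O,
    ∫⁻ ξ in (O : Set (Pt d)), ENNReal.ofReal (‖E (G ξ)‖ ^ 2) ≤ c * weightedHS e w E

theorem isNoiseKernel_ext_diracDelta (hO : Bornology.IsBounded (O : Set (Pt d))) {s : ℝ}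
    (hs : (d : ℝ) / 2 < s) {R : L2 O →L[ℝ] L2 O} {Rext : NegSobolev O s →L[ℝ] L2 O}
    (hR : IsSelfAdjoint R) (hRext : ∀ u : L2 O, Rext (toNegSobolev O hs u) = R u)
    (e : HilbertBasis ℕ ℝ (L2 O)) {w : ℕ → ℝ} (hw : ∀ k, 0 ≤ w k) {c : ℝ≥0∞}
    (hc : ∀ x, ENNReal.ofReal (‖R x‖ ^ 2) ≤ c * ∑' k, ENNReal.ofReal (w k * ⟪e k, x⟫_ℝ ^ 2)) :
    IsNoiseKernel e w c fun ξ => Rext (diracDelta O hs ξ) where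
  stronglyMeasurable := Rext.continuous.comp_stronglyMeasurable (stronglyMeasurable_diracDelta hs)
  lintegral_lt_top := by
    refine (lintegral_mono fun ξ => ?_).trans_lt
      (b := ∫⁻ _ in (O : Set (Pt d)), ENNReal.ofReal
        (‖Rext‖ * (∫ k : Pt d, (1 + ‖k‖ ^ 2) ^ (-s)) ^ (1 / 2 : ℝ))) ?_
    · rw [← ofReal_norm]
      exact ENNReal.ofReal_le_ofReal ((Rext.le_opNorm _).trans
        (mul_le_mul_of_nonneg_left (norm_diracDelta_le hs ξ) (norm_nonneg _)))
    · rw [lintegral_const, Measure.restrict_apply_univ]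
      exact ENNReal.mul_lt_top ENNReal.ofReal_lt_top hO.measure_lt_top
  lintegral_sq_le E := by
    rw [lintegral_norm_sq_ext_diracDelta hO hs hR hRext e E]
    exact tsum_norm_comp_sq_le e e hw hR hc E

/-- The partial sums of the expansion of `Q^{1/2} δ_ξ` satisfy the bound of a noise kernel uniformly
in `n`. -/
theorem isNoiseKernel_sum_basis (hO : Bornology.IsBounded (O : Set (Pt d)))
    {R : L2 O →L[ℝ] L2 O} (hR : IsSelfAdjoint R)
    (e b : HilbertBasis ℕ ℝ (L2 O)) {w : ℕ → ℝ} (hw : ∀ k, 0 ≤ w k) {c : ℝ≥0∞}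
    (hc : ∀ x, ENNReal.ofReal (‖R x‖ ^ 2) ≤ c * ∑' k, ENNReal.ofReal (w k * ⟪e k, x⟫_ℝ ^ 2))
    (n : ℕ) :
    IsNoiseKernel e w c fun ξ => ∑ k ∈ Finset.range n, b k ξ • R (b k) where
  stronglyMeasurable := Finset.stronglyMeasurable_fun_sum _ fun k _ =>
    (Lp.stronglyMeasurable (b k)).smul_const _
  lintegral_lt_top :=
    (integrable_finsetSum _ fun k _ => (L2.integrable_of_isBounded hO (b k)).smul_const _).2
  lintegral_sq_le E :=
    (lintegral_norm_sq_sum_basis_le R b n E).trans (tsum_norm_comp_sq_le b e hw hR hc E)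

/-- A strongly measurable family of operators may be applied to a strongly measurable function: the
expansion in an orthonormal basis is a pointwise limit of measurable functions. -/
theorem stronglyMeasurable_clm_apply {X H : Type*} [MeasurableSpace X] [NormedAddCommGroup H]
    [InnerProductSpace ℝ H] (e : HilbertBasis ℕ ℝ H) {E : ℝ → H →L[ℝ] H}
    (hE : ∀ u, StronglyMeasurable fun r => E r u) {G : X → H} (hG : StronglyMeasurable G) :
    StronglyMeasurable fun p : ℝ × X => E p.1 (G p.2) := by
  refine stronglyMeasurable_of_tendsto atTop
    (f := fun n p => ∑ k ∈ Finset.range n, ⟪e k, G p.2⟫_ℝ • E p.1 (e k)) (fun n => ?_) ?_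
  · refine Finset.stronglyMeasurable_fun_sum _ fun k _ => ?_
    exact (stronglyMeasurable_const.inner (hG.comp_measurable measurable_snd)).smul
      ((hE (e k)).comp_measurable measurable_fst)
  · rw [tendsto_pi_nhds]
    intro p
    have h := ((e.hasSum_repr (G p.2)).mapL (E p.1)).tendsto_sum_nat
    simpa [e.repr_apply_apply] using h

theorem stronglyMeasurable_jump {E : ℝ → L2 O →L[ℝ] L2 O} (e : HilbertBasis ℕ ℝ (L2 O))
    (hE : ∀ u, StronglyMeasurable fun r => E r u) {G : Pt d → L2 O} (hG : StronglyMeasurable G) :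
    StronglyMeasurable fun x : ℝ × Pt d × ℝ => x.2.2 • E x.1 (G x.2.1) := by
  have h : Measurable fun x : ℝ × Pt d × ℝ => (x.1, x.2.1) := by fun_prop
  exact (measurable_snd.comp measurable_snd).stronglyMeasurable.smul
    ((stronglyMeasurable_clm_apply e hE hG).comp_measurable h)

theorem lintegral_enorm_jump (ν : Measure ℝ) [SigmaFinite ν] {E : ℝ → L2 O →L[ℝ] L2 O}
    (e : HilbertBasis ℕ ℝ (L2 O)) (hE : ∀ u, StronglyMeasurable fun r => E r u)
    {G : Pt d → L2 O} (hG : StronglyMeasurable G) (t : ℝ) (J : Set ℝ) :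
    ∫⁻ x in jumpSet d t J, ‖x.2.2 • E x.1 (G x.2.1)‖ₑ ∂refMeasure O ν =
      (∫⁻ σ in J, ‖σ‖ₑ ∂ν) *
        ∫⁻ r in Set.Icc 0 t, ∫⁻ ξ in (O : Set (Pt d)), ‖E r (G ξ)‖ₑ := by
  rw [← lintegral_jumpSet O ν t J (F := fun p => ‖E p.1 (G p.2)‖ₑ)
    (stronglyMeasurable_clm_apply e hE hG).enorm]
  simp_rw [enorm_smul]

theorem integrableOn_jump {ν : Measure ℝ} [SigmaFinite ν] {E : ℝ → L2 O →L[ℝ] L2 O}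
    (e : HilbertBasis ℕ ℝ (L2 O)) (hE : ∀ u, StronglyMeasurable fun r => E r u) {C : ℝ}
    (hC : ∀ r u, ‖E r u‖ ≤ C * ‖u‖) {G : Pt d → L2 O} (hG : StronglyMeasurable G)
    (hGi : ∫⁻ ξ in (O : Set (Pt d)), ‖G ξ‖ₑ < ∞) (t : ℝ) {J : Set ℝ}
    (hJ : ∫⁻ σ in J, ‖σ‖ₑ ∂ν < ∞) :
    IntegrableOn (fun x : ℝ × Pt d × ℝ => x.2.2 • E x.1 (G x.2.1)) (jumpSet d t J)
      (refMeasure O ν) := by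
  refine ⟨(stronglyMeasurable_jump e hE hG).aestronglyMeasurable, ?_⟩
  rw [HasFiniteIntegral, lintegral_enorm_jump ν e hE hG]
  refine ENNReal.mul_lt_top hJ ((lintegral_mono fun r => lintegral_mono fun ξ => ?_).trans_lt
    (b := ∫⁻ _ in Set.Icc 0 t, ∫⁻ ξ in (O : Set (Pt d)), ENNReal.ofReal C * ‖G ξ‖ₑ) ?_)
  · have h0 : 0 ≤ C ∨ G ξ = 0 := by
      by_contra! h
      have h1 := (norm_nonneg _).trans (hC r (G ξ))
      have h2 := norm_pos_iff.2 h.2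
      nlinarith [h.1]
    rcases h0 with h0 | h0
    · rw [← ofReal_norm, ← ofReal_norm, ← ENNReal.ofReal_mul h0]
      exact ENNReal.ofReal_le_ofReal (hC r (G ξ))
    · simp [h0]
  · rw [lintegral_const, lintegral_const_mul _ hG.enorm]
    exact ENNReal.mul_lt_top (ENNReal.mul_lt_top ENNReal.ofReal_lt_top hGi) (by simp)

theorem IsNoiseKernel.lintegral_enorm_le {e : HilbertBasis ℕ ℝ (L2 O)} {w : ℕ → ℝ} {c : ℝ≥0∞}
    {G : Pt d → L2 O} (hG : IsNoiseKernel e w c G) (E : L2 O →L[ℝ] L2 O) :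
    ∫⁻ ξ in (O : Set (Pt d)), ‖E (G ξ)‖ₑ ≤
      (c * weightedHS e w E) ^ (1 / 2 : ℝ) * volume (O : Set (Pt d)) ^ (1 / 2 : ℝ) := by
  have h1 := ENNReal.lintegral_mul_le_Lp_mul_Lq (volume.restrict (O : Set (Pt d)))
    Real.HolderConjugate.two_two
    (f := fun ξ => ‖E (G ξ)‖ₑ) (g := fun _ => 1)
    (E.continuous.comp_stronglyMeasurable hG.stronglyMeasurable).enorm.aemeasurable
    aemeasurable_const
  simp only [Pi.mul_apply, mul_one, ENNReal.one_rpow, lintegral_const, one_mul,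
    Measure.restrict_apply_univ] at h1
  refine h1.trans (mul_le_mul' (ENNReal.rpow_le_rpow ?_ (by norm_num)) le_rfl)
  refine le_trans (le_of_eq (lintegral_congr fun ξ => ?_)) (hG.lintegral_sq_le E)
  rw [ENNReal.rpow_two, ← ofReal_norm, ENNReal.ofReal_pow (norm_nonneg _)]

/-- The integral over all jumps of a family of operators whose weighted Hilbert-Schmidt norm has
the singularity `(T - r)^{-2p}` at the final time. -/
theorem IsNoiseKernel.lintegral_enorm_jump_le (ν : Measure ℝ) [SigmaFinite ν]
    {e : HilbertBasis ℕ ℝ (L2 O)} {w : ℕ → ℝ} {c : ℝ≥0∞}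
    {G : Pt d → L2 O} (hG : IsNoiseKernel e w c G) {E : ℝ → L2 O →L[ℝ] L2 O}
    (hE : ∀ u, StronglyMeasurable fun r => E r u) {T D p : ℝ} (hD : 0 ≤ D)
    (hb : ∀ r ∈ Set.Ioo 0 T, weightedHS e w (E r) ≤ ENNReal.ofReal (D ^ 2 * (T - r) ^ (-(2 * p))))
    (J : Set ℝ) :
    ∫⁻ x in jumpSet d T J, ‖x.2.2 • E x.1 (G x.2.1)‖ₑ ∂refMeasure O ν ≤
      (∫⁻ σ in J, ‖σ‖ₑ ∂ν) * (ENNReal.ofReal D *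
        (c ^ (1 / 2 : ℝ) * volume (O : Set (Pt d)) ^ (1 / 2 : ℝ) *
          ∫⁻ r in Set.Ioo 0 T, ENNReal.ofReal ((T - r) ^ (-p)))) := by
  rw [lintegral_enorm_jump ν e hE hG.stronglyMeasurable]
  refine mul_le_mul' le_rfl ?_
  rw [setLIntegral_congr Ioo_ae_eq_Icc.symm,
    ← lintegral_const_mul _ (by fun_prop), ← lintegral_const_mul _ (by fun_prop)]
  refine setLIntegral_mono (by fun_prop) fun r hr => (hG.lintegral_enorm_le (E r)).trans ?_
  have hr0 : 0 ≤ T - r := by linarith [hr.2]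
  have h1 : ENNReal.ofReal (D ^ 2 * (T - r) ^ (-(2 * p))) ^ (1 / 2 : ℝ) =
      ENNReal.ofReal D * ENNReal.ofReal ((T - r) ^ (-p)) := by
    rw [← ENNReal.ofReal_mul hD, ENNReal.ofReal_rpow_of_nonneg (by positivity) (by norm_num)]
    congr 1
    rw [show -(2 * p) = -p * 2 by ring, Real.rpow_mul hr0, Real.rpow_two, ← mul_pow,
      ← Real.rpow_natCast, ← Real.rpow_mul (by positivity)]
    norm_num
  calc (c * weightedHS e w (E r)) ^ (1 / 2 : ℝ) * volume (O : Set (Pt d)) ^ (1 / 2 : ℝ)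
      ≤ (c * ENNReal.ofReal (D ^ 2 * (T - r) ^ (-(2 * p)))) ^ (1 / 2 : ℝ) *
          volume (O : Set (Pt d)) ^ (1 / 2 : ℝ) :=
        mul_le_mul' (ENNReal.rpow_le_rpow (mul_le_mul' le_rfl (hb r hr)) (by norm_num)) le_rfl
    _ = _ := by
        rw [ENNReal.mul_rpow_of_nonneg _ _ (by norm_num), h1]
        ring

theorem lintegral_rpow_sub_lt_top (T : ℝ) {p : ℝ} (hp : p < 1) :
    ∫⁻ r in Set.Ioo 0 T, ENNReal.ofReal ((T - r) ^ (-p)) < ∞ := by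
  rcases le_or_gt T 0 with hT | hT
  · simp [Set.Ioo_eq_empty (not_lt.2 hT)]
  have h1 : IntervalIntegrable (fun r : ℝ => r ^ (-p)) volume 0 T :=
    intervalIntegral.intervalIntegrable_rpow' (by linarith)
  have h2 := h1.comp_sub_left T
  simp only [sub_zero, sub_self] at h2
  have h3 := (intervalIntegrable_iff_integrableOn_Ioo_of_le hT.le).1 h2.symm
  refine lt_of_le_of_lt (lintegral_mono fun r => ?_) h3.2
  rw [← ofReal_norm]
  exact ENNReal.ofReal_le_ofReal (le_abs_self _)

end NoiseKernelBounds

/-! ### Sums of increments as integrals of step functions -/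

section Step

variable {d : ℕ} {H K : Type*} [NormedAddCommGroup H] [NormedSpace ℝ H]
  [NormedAddCommGroup K] [NormedSpace ℝ K]

/-- The operator valued step function equal to `L j` on the interval `(j τ, (j + 1) τ]`, `j < N`. -/
noncomputable def stepFun (τ : ℝ) (N : ℕ) (L : ℕ → H →L[ℝ] K) (r : ℝ) : H →L[ℝ] K :=
  ∑ j ∈ Finset.range N, (Set.Ioc (j * τ) ((j + 1 : ℕ) * τ)).indicator (fun _ => L j) r

theorem stepFun_eq {τ : ℝ} (hτ : 0 ≤ τ) {N : ℕ} (L : ℕ → H →L[ℝ] K) {j : ℕ} (hj : j < N) {r : ℝ}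
    (hr : r ∈ Set.Ioc (j * τ) ((j + 1 : ℕ) * τ)) : stepFun τ N L r = L j := by
  rw [stepFun, Finset.sum_eq_single_of_mem j (Finset.mem_range.2 hj), Set.indicator_of_mem hr]
  intro i _ hij
  refine Set.indicator_of_notMem (fun hi => hij ?_) _
  rcases lt_or_gt_of_ne hij with h | h
  · have : ((i + 1 : ℕ) : ℝ) * τ ≤ j * τ :=
      mul_le_mul_of_nonneg_right (by exact_mod_cast h) hτ
    linarith [hi.2, hr.1]
  · have : ((j + 1 : ℕ) : ℝ) * τ ≤ i * τ :=
      mul_le_mul_of_nonneg_right (by exact_mod_cast h) hτ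
    linarith [hr.2, hi.1]

theorem stronglyMeasurable_stepFun (τ : ℝ) (N : ℕ) (L : ℕ → H →L[ℝ] K) (u : H) :
    StronglyMeasurable fun r => stepFun τ N L r u := by
  have h : (fun r => stepFun τ N L r u) = fun r => ∑ j ∈ Finset.range N,
      (Set.Ioc (j * τ) ((j + 1 : ℕ) * τ)).indicator (fun _ => L j u) r := by
    ext r
    rw [stepFun, sum_apply]
    refine Finset.sum_congr rfl fun j _ => ?_
    by_cases hr : r ∈ Set.Ioc (j * τ) ((j + 1 : ℕ) * τ)
    · rw [Set.indicator_of_mem hr, Set.indicator_of_mem hr]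
    · rw [Set.indicator_of_notMem hr, Set.indicator_of_notMem hr]
      rfl
  rw [h]
  exact Finset.stronglyMeasurable_fun_sum _ fun j _ =>
    stronglyMeasurable_const.indicator measurableSet_Ioc

/-- `∑_j L_j (N_{(j+1)τ} - N_{jτ})` for the process `N_t = ∫_{[0,t] × ℝ^d × J} F dm`. -/
theorem sum_setIntegral_jumpSet_sub [CompleteSpace H] [CompleteSpace K]
    {m : Measure (ℝ × Pt d × ℝ)} {F : ℝ × Pt d × ℝ → H} {J : Set ℝ} (hJ : MeasurableSet J)
    {τ : ℝ} (hτ : 0 ≤ τ) (N : ℕ) (L : ℕ → H →L[ℝ] K) (hF : IntegrableOn F (jumpSet d (N * τ) J) m) :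
    IntegrableOn (fun x => stepFun τ N L x.1 (F x)) (jumpSet d (N * τ) J) m ∧
    ∑ j ∈ Finset.range N, L j (∫ x in jumpSet d ((j + 1 : ℕ) * τ) J, F x ∂m -
        ∫ x in jumpSet d (j * τ) J, F x ∂m) =
      ∫ x in jumpSet d (N * τ) J, stepFun τ N L x.1 (F x) ∂m := by
  set S : ℕ → Set (ℝ × Pt d × ℝ) := fun j =>
    jumpSet d ((j + 1 : ℕ) * τ) J \ jumpSet d (j * τ) J with hS
  have hmono : ∀ {i j : ℕ}, i ≤ j → jumpSet d (i * τ) J ⊆ jumpSet d (j * τ) J := fun hij =>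
    jumpSet_mono (mul_le_mul_of_nonneg_right (by exact_mod_cast hij) hτ) subset_rfl
  have hSm : ∀ j, MeasurableSet (S j) := fun j =>
    (measurableSet_jumpSet _ hJ).diff (measurableSet_jumpSet _ hJ)
  have hSN : ∀ j < N, S j ⊆ jumpSet d (N * τ) J := fun j hj =>
    Set.sdiff_subset.trans (hmono hj)
  have hmem : ∀ j (x : ℝ × Pt d × ℝ), x ∈ jumpSet d (N * τ) J →
      (x ∈ S j ↔ x.1 ∈ Set.Ioc (j * τ) ((j + 1 : ℕ) * τ)) := fun j x hx => by
    obtain ⟨h1, -, h2⟩ := hx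
    simp only [hS, jumpSet, Set.mem_sdiff, Set.mem_prod, Set.mem_Icc, Set.mem_univ, true_and, h2,
      h1.1, and_true, not_le, Set.mem_Ioc]
    tauto
  have hfun : ∀ x ∈ jumpSet d (N * τ) J, stepFun τ N L x.1 (F x) =
      ∑ j ∈ Finset.range N, (S j).indicator (fun x => L j (F x)) x := fun x hx => by
    rw [stepFun, sum_apply]
    refine Finset.sum_congr rfl fun j _ => ?_
    by_cases h : x ∈ S j
    · rw [Set.indicator_of_mem h, Set.indicator_of_mem ((hmem j x hx).1 h)]
    · rw [Set.indicator_of_notMem h, Set.indicator_of_notMem (mt (hmem j x hx).2 h)]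
      rfl
  have hint : ∀ j ∈ Finset.range N,
      IntegrableOn ((S j).indicator fun x => L j (F x)) (jumpSet d (N * τ) J) m := fun j _ =>
    ((L j).integrable_comp hF).indicator (hSm j)
  have hmN := measurableSet_jumpSet (d := d) (N * τ) hJ
  refine ⟨(integrable_finsetSum _ hint).congr ?_, ?_⟩
  · filter_upwards [ae_restrict_mem hmN] with x hx
    rw [hfun x hx]
  · rw [setIntegral_congr_fun hmN hfun, integral_finsetSum _ hint]
    refine Finset.sum_congr rfl fun j hj => ?_
    have hj' := Finset.mem_range.1 hj
    rw [setIntegral_indicator (hSm j), Set.inter_eq_right.2 (hSN j hj'),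
      ContinuousLinearMap.integral_comp_comm _ (hF.mono_set (hSN j hj')),
      ← setIntegral_sdiff (measurableSet_jumpSet _ hJ) (hF.mono_set (hmono hj'))
        (hmono j.le_succ)]

end Step

/-! ### Measurability of the jump processes -/

section JumpMeasurability

variable {d : ℕ} {O : Opens (Pt d)} {s : ℝ} {Ω : Type*} [MeasurableSpace Ω] {P : Measure Ω}
  {π : Ω → Measure (ℝ × Pt d × ℝ)}

theorem jumpSet_inter_le {t t' : ℝ} (h : t ≤ t') (J : Set ℝ) :
    jumpSet d t' J ∩ {x | x.1 ≤ t} = jumpSet d t J := by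
  ext x
  simp only [jumpSet, Set.mem_inter_iff, Set.mem_prod, Set.mem_Icc, Set.mem_univ, true_and,
    Set.mem_ofPred_eq]
  constructor
  · rintro ⟨⟨⟨h1, -⟩, h2⟩, h3⟩
    exact ⟨⟨h1, h3⟩, h2⟩
  · rintro ⟨⟨h1, h3⟩, h2⟩
    exact ⟨⟨⟨h1, h3.trans h⟩, h2⟩, h3⟩

theorem aestronglyMeasurable_jumpProcess {μ : Measure (ℝ × Pt d × ℝ)}
    (h : IsPoissonRandomMeasure P π μ) (hs : (d : ℝ) / 2 < s) {J : Set ℝ}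
    (hJ : MeasurableSet J) {T : ℝ} (hμ : μ (jumpSet d T J) ≠ ∞) {a : Ω → ℝ} (ha : Measurable a)
    (haT : ∀ ω, a ω ≤ T) :
    AEStronglyMeasurable (fun ω => jumpProcess O hs π J (a ω) ω) P := by
  have hS : MeasurableSet {p : Ω × ℝ × Pt d × ℝ | p.2.1 ≤ a p.1} :=
    measurableSet_le (by fun_prop) (by fun_prop)
  have hδ : StronglyMeasurable fun p : Ω × ℝ × Pt d × ℝ => p.2.2.2 • diracDelta O hs p.2.2.1 := by
    have h1 : Measurable fun p : Ω × ℝ × Pt d × ℝ => p.2.2.2 := by fun_prop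
    have h2 : Measurable fun p : Ω × ℝ × Pt d × ℝ => p.2.2.1 := by fun_prop
    exact h1.stronglyMeasurable.smul ((stronglyMeasurable_diracDelta hs).comp_measurable h2)
  have h1 := h.aestronglyMeasurable_setIntegral (measurableSet_jumpSet T hJ) hμ
    (f := fun ω x => {x : ℝ × Pt d × ℝ | x.1 ≤ a ω}.indicator
      (fun x => x.2.2 • diracDelta O hs x.2.1) x) (hδ.indicator hS)
  refine h1.congr (Eventually.of_forall fun ω => ?_)
  simp only
  rw [setIntegral_indicator (measurableSet_le measurable_fst measurable_const),
    jumpSet_inter_le (haT ω)]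
  rfl

theorem bigJumpTime_nonneg (π : Ω → Measure (ℝ × Pt d × ℝ)) (T m : ℝ) (ω : Ω) :
    0 ≤ bigJumpTime d π T m ω := by
  refine le_sInf ?_
  rintro a ⟨t, ht, rfl, -⟩
  exact_mod_cast ht.1

theorem measurable_bigJumpTime (hπ : ∀ B, MeasurableSet B → Measurable fun ω => π ω B) (T m : ℝ) :
    Measurable (bigJumpTime d π T m) := by
  have hJ : MeasurableSet {σ : ℝ | m < |σ|} := measurableSet_lt measurable_const (by fun_prop)
  refine measurable_of_Iio fun c => ?_
  -- by monotonicity in time, rational times capped at `T` suffice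
  have h1 : bigJumpTime d π T m ⁻¹' Set.Iio c = ⋃ q : ℚ, {ω | 0 ≤ min (q : ℝ) T ∧
      ((min (q : ℝ) T : ℝ) : EReal) < c ∧ 0 < π ω (jumpSet d (min (q : ℝ) T) {σ | m < |σ|})} := by
    ext ω
    simp only [Set.mem_preimage, Set.mem_Iio, bigJumpTime, sInf_lt_iff, Set.mem_ofPred_eq,
      Set.mem_iUnion]
    constructor
    · rintro ⟨a, ⟨t, ht, rfl, h2⟩, h3⟩
      obtain ⟨q, hq1, hq2⟩ := EReal.lt_iff_exists_rat_btwn.1 h3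
      have hq1' : t < q := by exact_mod_cast hq1
      have ht' : t ≤ min (q : ℝ) T := le_min hq1'.le ht.2
      refine ⟨q, ht.1.trans ht', lt_of_le_of_lt ?_ hq2, h2.trans_le ?_⟩
      · exact_mod_cast min_le_left _ _
      · exact measure_mono (jumpSet_mono ht' subset_rfl)
    · rintro ⟨q, h1, h2, h3⟩
      exact ⟨_, ⟨min (q : ℝ) T, ⟨h1, min_le_right _ _⟩, rfl, h3⟩, h2⟩
  rw [h1]
  refine MeasurableSet.iUnion fun q => ?_
  refine (MeasurableSet.const _).inter ((MeasurableSet.const _).inter ?_)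
  exact measurableSet_lt measurable_const (hπ _ (measurableSet_jumpSet _ hJ))

theorem aestronglyMeasurable_stoppedJumpProcess {μ : Measure (ℝ × Pt d × ℝ)}
    (h : IsPoissonRandomMeasure P π μ) (hs : (d : ℝ) / 2 < s) {T t : ℝ} (ht : t ≤ T)
    (ht0 : 0 ≤ t) (hμ : μ (jumpSet d T {σ | 1 < |σ|}) ≠ ∞) (m : ℝ) :
    AEStronglyMeasurable (stoppedJumpProcess O hs π T m t) P := by
  have hJ : MeasurableSet {σ : ℝ | 1 < |σ|} := measurableSet_lt measurable_const (by fun_prop)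
  refine aestronglyMeasurable_jumpProcess h hs hJ hμ
    (a := fun ω => (min (t : EReal) (bigJumpTime d π T m ω)).toReal)
    (measurable_const.min (measurable_bigJumpTime h.measurable T m)).ereal_toReal fun ω => ?_
  have h0 : (0 : EReal) ≤ min (t : EReal) (bigJumpTime d π T m ω) :=
    le_min (by exact_mod_cast ht0) (bigJumpTime_nonneg π T m ω)
  have h1 := EReal.toReal_le_toReal (min_le_left (t : EReal) (bigJumpTime d π T m ω))
    (fun h => by rw [h] at h0; simp at h0) (EReal.coe_ne_top t)
  rw [EReal.toReal_coe] at h1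
  exact h1.trans ht

/-- If `π` has no jump larger than `m`, integrals over jumps larger than one are integrals over the
jumps with `1 < |σ| ≤ m`. -/
theorem setIntegral_jumpSet_eq_of_measure_eq_zero {F : Type*} [NormedAddCommGroup F]
    [NormedSpace ℝ F] {p : Measure (ℝ × Pt d × ℝ)} {T t m : ℝ} (ht : t ≤ T)
    (hp : p (jumpSet d T {σ | m < |σ|}) = 0) (f : ℝ × Pt d × ℝ → F) :
    ∫ x in jumpSet d t {σ | 1 < |σ|}, f x ∂p =
      ∫ x in jumpSet d t {σ | 1 < |σ| ∧ |σ| ≤ m}, f x ∂p := by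
  refine setIntegral_congr_set (Filter.EventuallyLE.antisymm
    (ae_le_set.2 (measure_mono_null ?_ hp))
    (LE.le.eventuallyLE (jumpSet_mono le_rfl fun σ hσ => hσ.1)))
  rintro x ⟨⟨h1, -, h2⟩, h3⟩
  refine ⟨⟨h1.1, h1.2.trans ht⟩, trivial, ?_⟩
  by_contra h4
  exact h3 ⟨h1, trivial, h2, not_lt.1 h4⟩

theorem bigJumpTime_eq_top {T m : ℝ} {ω : Ω} (h : π ω (jumpSet d T {σ | m < |σ|}) = 0) :
    bigJumpTime d π T m ω = ⊤ := by
  refine sInf_eq_top.2 ?_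
  rintro a ⟨t, ht, -, h1⟩
  exact absurd (measure_mono_null (jumpSet_mono ht.2 subset_rfl) h) h1.ne'

theorem stoppedJumpProcess_eq_truncatedJumpProcess (hs : (d : ℝ) / 2 < s) {T t m : ℝ} (ht : t ≤ T)
    {ω : Ω} (h : π ω (jumpSet d T {σ | m < |σ|}) = 0) :
    stoppedJumpProcess O hs π T m t ω = truncatedJumpProcess O hs π m t ω := by
  rw [stoppedJumpProcess, bigJumpTime_eq_top h, min_top_right, EReal.toReal_coe,
    truncatedJumpProcess, jumpProcess, jumpProcess,
    setIntegral_jumpSet_eq_of_measure_eq_zero ht h]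

end JumpMeasurability

/-! ### The error of the stochastic integrals -/

section NoiseError

variable {d : ℕ} {O : Opens (Pt d)} {s : ℝ} {Ω : Type*} [MeasurableSpace Ω] {P : Measure Ω}
  {π : Ω → Measure (ℝ × Pt d × ℝ)} {ν : Measure ℝ} [SigmaFinite ν]

/-- The difference between the operators by which a jump at time `r` enters the discrete and the
exact solution at time `T`. -/
noncomputable def stepError {H : Type*} [NormedAddCommGroup H] [InnerProductSpace ℝ H]
    (e : HilbertBasis ℕ ℝ H) (lam : ℕ → ℝ) (T τ : ℝ) (N : ℕ) (L : ℕ → H →L[ℝ] H) (r : ℝ) :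
    H →L[ℝ] H :=
  stepFun τ N L r - heatSemigroup e lam (max (T - r) 0)

theorem stronglyMeasurable_heatSemigroup_sub {H : Type*} [NormedAddCommGroup H]
    [InnerProductSpace ℝ H] (e : HilbertBasis ℕ ℝ H) {lam : ℕ → ℝ}
    (hlam : ∀ k, 0 < lam k) (T : ℝ) (u : H) :
    StronglyMeasurable fun r : ℝ => heatSemigroup e lam (max (T - r) 0) u :=
  (stronglyMeasurable_heatSemigroup e hlam u).comp_measurable (measurable_const.sub measurable_id)

theorem stronglyMeasurable_stepError {H : Type*} [NormedAddCommGroup H] [InnerProductSpace ℝ H]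
    (e : HilbertBasis ℕ ℝ H) {lam : ℕ → ℝ}
    (hlam : ∀ k, 0 < lam k) (T τ : ℝ) (N : ℕ) (L : ℕ → H →L[ℝ] H) (u : H) :
    StronglyMeasurable fun r => stepError e lam T τ N L r u :=
  (stronglyMeasurable_stepFun τ N L u).sub (stronglyMeasurable_heatSemigroup_sub e hlam T u)

/-- For a single measure in place of the noise, the error of the stochastic convolution is the
integral of `stepError`. -/
theorem sum_sub_setIntegral_eq {m : Measure (ℝ × Pt d × ℝ)} {G : Pt d → L2 O} {J : Set ℝ}
    (hJ : MeasurableSet J) (e : HilbertBasis ℕ ℝ (L2 O)) (lam : ℕ → ℝ) {T τ : ℝ} (hτ : 0 ≤ τ)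
    {N : ℕ} (hN : N * τ = T) (L : ℕ → L2 O →L[ℝ] L2 O)
    (hF : IntegrableOn (fun x => x.2.2 • G x.2.1) (jumpSet d T J) m)
    (hX : IntegrableOn (fun x => x.2.2 • heatSemigroup e lam (max (T - x.1) 0) (G x.2.1))
      (jumpSet d T J) m) :
    ∑ j ∈ Finset.range N, L j (∫ x in jumpSet d ((j + 1 : ℕ) * τ) J, x.2.2 • G x.2.1 ∂m -
        ∫ x in jumpSet d (j * τ) J, x.2.2 • G x.2.1 ∂m) -
      ∫ x in jumpSet d T J, x.2.2 • heatSemigroup e lam (max (T - x.1) 0) (G x.2.1) ∂m =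
    ∫ x in jumpSet d T J, x.2.2 • stepError e lam T τ N L x.1 (G x.2.1) ∂m := by
  subst hN
  obtain ⟨h1, h2⟩ := sum_setIntegral_jumpSet_sub hJ hτ N L hF
  rw [h2, ← integral_sub h1 hX]
  refine integral_congr_ae (Eventually.of_forall fun x => ?_)
  simp only [stepError, sub_apply, map_smul, smul_sub]

theorem measurableSet_lt_abs_le (m : ℝ) : MeasurableSet {σ : ℝ | 1 < |σ| ∧ |σ| ≤ m} :=
  MeasurableSet.inter (s₁ := {σ : ℝ | 1 < |σ|}) (s₂ := {σ : ℝ | |σ| ≤ m})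
    (measurableSet_lt measurable_const (by fun_prop)) (measurableSet_le (by fun_prop)
      measurable_const)

theorem IsPoissonRandomMeasure.ae_integrableOn {X F : Type*} [MeasurableSpace X]
    [NormedAddCommGroup F] {ϖ : Ω → Measure X} {μ : Measure X} [SigmaFinite μ]
    (h : IsPoissonRandomMeasure P ϖ μ) {K : Set X} (hK : MeasurableSet K) {f : X → F}
    (hf : IntegrableOn f K μ) : ∀ᵐ ω ∂P, IntegrableOn f K (ϖ ω) := by
  filter_upwards [h.ae_integrable ((integrable_indicator_iff hK).2 hf)] with ω hω
  exact (integrable_indicator_iff hK).1 hω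

theorem lintegral_abs_lt_top_of_subset_Icc {ν : Measure ℝ}
    (hν : Integrable (fun σ : ℝ => min |σ| 1) ν) (m : ℕ) {J : Set ℝ}
    (hJ : J ⊆ Set.Icc (-(m : ℝ)) m) : ∫⁻ σ in J, ‖σ‖ₑ ∂ν < ∞ := by
  refine (lintegral_mono_set hJ).trans_lt ?_
  have h1 : ∫⁻ σ in Set.Icc (-(m : ℝ)) m, ‖(m + 1 : ℝ) * min |σ| 1‖ₑ ∂ν < ∞ :=
    ((hν.const_mul (m + 1 : ℝ)).mono_measure Measure.restrict_le_self).2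
  refine (setLIntegral_mono (by fun_prop) fun σ hσ => ?_).trans_lt h1
  rw [← ofReal_norm, ← ofReal_norm]
  refine ENNReal.ofReal_le_ofReal ?_
  have h2 : |σ| ≤ m := abs_le.2 hσ
  rw [Real.norm_eq_abs, Real.norm_of_nonneg (by positivity)]
  have h3 : (0 : ℝ) ≤ m := by positivity
  rcases min_cases |σ| 1 with h | h
  · rw [h.1]; nlinarith [abs_nonneg σ]
  · rw [h.1]; linarith

theorem measure_lt_abs_lt_top {ν : Measure ℝ} (hν : Integrable (fun σ : ℝ => min |σ| 1) ν)
    {m : ℝ} (hm : 1 ≤ m) : ν {σ | m < |σ|} < ∞ := by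
  refine (measure_mono fun σ hσ => ?_).trans_lt (hν.measure_ge_lt_top one_pos)
  exact le_min (hm.trans (le_of_lt hσ)) le_rfl

theorem integrableOn_smul_diracDelta (hs : (d : ℝ) / 2 < s) (m : ℕ) (T : ℝ)
    {μ : Measure (ℝ × Pt d × ℝ)} (hμ : μ (jumpSet d T {σ | 1 < |σ| ∧ |σ| ≤ m}) ≠ ∞) :
    IntegrableOn (fun x : ℝ × Pt d × ℝ => x.2.2 • diracDelta O hs x.2.1)
      (jumpSet d T {σ | 1 < |σ| ∧ |σ| ≤ m}) μ := by
  have h1 : Measurable fun p : ℝ × Pt d × ℝ => p.2.1 := by fun_prop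
  have h2 : Measurable fun p : ℝ × Pt d × ℝ => p.2.2 := by fun_prop
  refine Measure.integrableOn_of_bounded
    (M := m * (∫ k : Pt d, (1 + ‖k‖ ^ 2) ^ (-s)) ^ (1 / 2 : ℝ)) hμ
    (h2.stronglyMeasurable.smul
      ((stronglyMeasurable_diracDelta hs).comp_measurable h1)).aestronglyMeasurable ?_
  filter_upwards [ae_restrict_mem (measurableSet_jumpSet T (measurableSet_lt_abs_le m))] with x hx
  rw [norm_smul]
  exact mul_le_mul hx.2.2.2 (norm_diracDelta_le hs _) (norm_nonneg _) (by positivity)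

theorem ext_truncatedJumpProcess (hs : (d : ℝ) / 2 < s) (Rext : NegSobolev O s →L[ℝ] L2 O) (m : ℕ)
    {t T : ℝ} (ht : t ≤ T) {ω : Ω}
    (h : IntegrableOn (fun x : ℝ × Pt d × ℝ => x.2.2 • diracDelta O hs x.2.1)
      (jumpSet d T {σ | 1 < |σ| ∧ |σ| ≤ m}) (π ω)) :
    Rext (truncatedJumpProcess O hs π m t ω) =
      ∫ x in jumpSet d t {σ | 1 < |σ| ∧ |σ| ≤ m}, x.2.2 • Rext (diracDelta O hs x.2.1) ∂(π ω) := by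
  rw [truncatedJumpProcess, jumpProcess, ← ContinuousLinearMap.integral_comp_comm _
    (h.mono_set (jumpSet_mono ht subset_rfl))]
  simp_rw [map_smul]

/-- The error caused by the jumps with `1 < |σ| ≤ m`. -/
theorem lintegral_enorm_largeJumps_le [IsProbabilityMeasure P]
    (h : IsPoissonRandomMeasure P π (refMeasure O ν))
    (hO : Bornology.IsBounded (O : Set (Pt d)))
    (hν : Integrable (fun σ : ℝ => min |σ| 1) ν)
    (hs : (d : ℝ) / 2 < s) {Rext : NegSobolev O s →L[ℝ] L2 O}
    {e : HilbertBasis ℕ ℝ (L2 O)} {lam : ℕ → ℝ} (hlam : ∀ k, 0 < lam k)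
    {w : ℕ → ℝ} {c : ℝ≥0∞} (hG : IsNoiseKernel e w c fun ξ => Rext (diracDelta O hs ξ))
    {T τ : ℝ} (hτ : 0 ≤ τ) {N : ℕ} (hN : N * τ = T) (L : ℕ → L2 O →L[ℝ] L2 O) (m : ℕ) :
    ∫⁻ ω, ‖∑ j ∈ Finset.range N, L j (Rext (truncatedJumpProcess O hs π m ((j + 1 : ℕ) * τ) ω -
          truncatedJumpProcess O hs π m (j * τ) ω)) -
        ∫ x in jumpSet d T {σ | 1 < |σ| ∧ |σ| ≤ m},
          heatSemigroup e lam (T - x.1) (Rext (x.2.2 • diracDelta O hs x.2.1)) ∂(π ω)‖ₑ ∂P ≤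
      ∫⁻ x in jumpSet d T {σ | 1 < |σ| ∧ |σ| ≤ m},
        ‖x.2.2 • stepError e lam T τ N L x.1 (Rext (diracDelta O hs x.2.1))‖ₑ ∂refMeasure O ν := by
  set J : Set ℝ := {σ | 1 < |σ| ∧ |σ| ≤ m} with hJdef
  have hJ : MeasurableSet J := measurableSet_lt_abs_le m
  have hJm : J ⊆ Set.Icc (-(m : ℝ)) m := fun σ hσ => abs_le.1 hσ.2
  have hJi := lintegral_abs_lt_top_of_subset_Icc hν m hJm
  have hK := measurableSet_jumpSet (d := d) T hJ
  have hJf : ν J ≠ ∞ := ((measure_mono fun σ hσ => hσ.1).trans_lt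
    (measure_lt_abs_lt_top hν le_rfl)).ne
  have hKf : refMeasure O ν (jumpSet d T J) ≠ ∞ := by
    rw [refMeasure_jumpSet]
    exact ENNReal.mul_ne_top ENNReal.ofReal_ne_top (ENNReal.mul_ne_top hO.measure_lt_top.ne hJf)
  have hT : 0 ≤ T := by rw [← hN]; positivity
  have hid := integrableOn_jump (O := O) (ν := ν) e
    (E := fun _ => ContinuousLinearMap.id ℝ (L2 O))
    (fun u => stronglyMeasurable_const) (C := 1) (fun r u => by simp) hG.stronglyMeasurable
    hG.lintegral_lt_top T hJi
  have hheat := integrableOn_jump (O := O) (ν := ν) e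
    (stronglyMeasurable_heatSemigroup_sub e hlam T)
    (C := 1) (fun r u => by
      rw [one_mul]; exact norm_heatSemigroup_apply_le e hlam (le_max_right _ _) u)
    hG.stronglyMeasurable hG.lintegral_lt_top T hJi
  have hδ := integrableOn_smul_diracDelta (O := O) hs m T hKf
  have hmeas : AEMeasurable (fun x : ℝ × Pt d × ℝ => (jumpSet d T J).indicator
      (fun x => ‖x.2.2 • stepError e lam T τ N L x.1 (Rext (diracDelta O hs x.2.1))‖ₑ) x)
      (refMeasure O ν) :=
    ((stronglyMeasurable_jump e (stronglyMeasurable_stepError e hlam T τ N L)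
      hG.stronglyMeasurable).enorm.indicator hK).aemeasurable
  rw [← lintegral_indicator hK, ← h.lintegral_lintegral hmeas]
  refine lintegral_mono_ae ?_
  filter_upwards [h.ae_integrableOn hK hid, h.ae_integrableOn hK hheat,
    h.ae_integrableOn hK hδ] with ω h1 h2 h3
  rw [lintegral_indicator hK]
  refine le_trans (le_of_eq (congrArg _ ?_)) (enorm_integral_le_lintegral_enorm _)
  refine Eq.trans ?_ (sum_sub_setIntegral_eq (G := fun ξ => Rext (diracDelta O hs ξ))
    hJ e lam hτ hN L h1 h2)
  congr 1
  · refine Finset.sum_congr rfl fun j hj => ?_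
    have hj' := Finset.mem_range.1 hj
    have ht : ∀ i : ℕ, i ≤ N → i * τ ≤ T := fun i hi => by
      rw [← hN]; exact mul_le_mul_of_nonneg_right (by exact_mod_cast hi) hτ
    rw [map_sub, ext_truncatedJumpProcess hs Rext m (ht (j + 1) hj') h3,
      ext_truncatedJumpProcess hs Rext m (ht j hj'.le) h3]
  · refine setIntegral_congr_fun hK fun x hx => ?_
    rw [max_eq_left (by linarith [hx.1.2]), map_smul, map_smul]

end NoiseError

/-! ### The error of the compensated small jumps -/

section SmallJumps

variable {d : ℕ} {O : Opens (Pt d)} {s : ℝ} {Ω : Type*} [MeasurableSpace Ω] {P : Measure Ω}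
  [IsProbabilityMeasure P] {π : Ω → Measure (ℝ × Pt d × ℝ)} {ν : Measure ℝ} [SigmaFinite ν]

theorem integrable_jumpSet_indicator_mul (hO : Bornology.IsBounded (O : Set (Pt d))) (u : L2 O)
    (t : ℝ) {J : Set ℝ} (hJm : MeasurableSet J) (hJ : ∫⁻ σ in J, ‖σ‖ₑ ∂ν < ∞) :
    Integrable ((jumpSet d t J).indicator fun x => u x.2.1 * x.2.2) (refMeasure O ν) := by
  rw [integrable_indicator_iff (measurableSet_jumpSet t hJm), IntegrableOn,
    refMeasure_restrict_jumpSet]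
  have h1 : Integrable (fun σ : ℝ => σ) (ν.restrict J) :=
    ⟨measurable_id.aestronglyMeasurable, hJ⟩
  have h2 := (L2.integrable_of_isBounded hO u).mul_prod h1
  have h3 : Integrable (fun _ : ℝ => (1 : ℝ)) (volume.restrict (Set.Icc 0 t)) :=
    integrable_const _
  refine (h3.mul_prod h2).congr (Eventually.of_forall fun x => ?_)
  simp

/-- Partial sums of the cylindrical noise are compensated integrals of a noise kernel. -/
theorem sum_smul_ae_eq (h : IsPoissonRandomMeasure P π (refMeasure O ν))
    (hO : Bornology.IsBounded (O : Set (Pt d))) (R : L2 O →L[ℝ] L2 O) (b : ℕ → L2 O)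
    (t : ℝ) {J : Set ℝ} (hJm : MeasurableSet J) (hJ : ∫⁻ σ in J, ‖σ‖ₑ ∂ν < ∞) {Z : ℕ → Ω → ℝ}
    (hZ : ∀ k, IsCompensatedIntegral P π (refMeasure O ν)
      ((jumpSet d t J).indicator fun x => b k x.2.1 * x.2.2) (Z k)) (n : ℕ) :
    ∀ᵐ ω ∂P, ∑ k ∈ Finset.range n, Z k ω • R (b k) =
      ∫ x in jumpSet d t J, x.2.2 • ∑ k ∈ Finset.range n, b k x.2.1 • R (b k) ∂(π ω) -
      ∫ x in jumpSet d t J, x.2.2 • ∑ k ∈ Finset.range n, b k x.2.1 • R (b k)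
        ∂(refMeasure O ν) := by
  have hK := measurableSet_jumpSet (d := d) t hJm
  have hi := fun k => integrable_jumpSet_indicator_mul (ν := ν) hO (b k) t hJm hJ
  have key : ∀ p : Measure (ℝ × Pt d × ℝ),
      (∀ k, Integrable ((jumpSet d t J).indicator fun x => b k x.2.1 * x.2.2) p) →
      ∫ x in jumpSet d t J, x.2.2 • ∑ k ∈ Finset.range n, b k x.2.1 • R (b k) ∂p =
        ∑ k ∈ Finset.range n,
          (∫ x, (jumpSet d t J).indicator (fun x => b k x.2.1 * x.2.2) x ∂p) • R (b k) := by
    intro p hp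
    have h1 : ∀ x : ℝ × Pt d × ℝ, x.2.2 • ∑ k ∈ Finset.range n, b k x.2.1 • R (b k) =
        ∑ k ∈ Finset.range n, (b k x.2.1 * x.2.2) • R (b k) := fun x => by
      rw [Finset.smul_sum]
      refine Finset.sum_congr rfl fun k _ => ?_
      rw [smul_smul, mul_comm]
    simp_rw [h1]
    rw [integral_finsetSum _ fun k _ =>
      (((integrable_indicator_iff hK).1 (hp k)).smul_const (R (b k)))]
    refine Finset.sum_congr rfl fun k _ => ?_
    rw [integral_indicator hK, integral_smul_const]
  filter_upwards [ae_all_iff.2 fun k => h.ae_eq_of_isCompensatedIntegral (hZ k) (hi k),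
    ae_all_iff.2 fun k => h.ae_integrable (hi k)] with ω h1 h2
  rw [key _ h2, key _ hi, ← Finset.sum_sub_distrib]
  refine Finset.sum_congr rfl fun k _ => ?_
  rw [h1 k, sub_smul]

/-- Partial sums of the stochastic convolution are compensated integrals. -/
theorem sum_convolution_ae_eq (h : IsPoissonRandomMeasure P π (refMeasure O ν))
    (hO : Bornology.IsBounded (O : Set (Pt d))) (R : L2 O →L[ℝ] L2 O) (b : ℕ → L2 O)
    (e : HilbertBasis ℕ ℝ (L2 O)) {lam : ℕ → ℝ} (hlam : ∀ k, 0 < lam k)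
    (T : ℝ) {J : Set ℝ} (hJm : MeasurableSet J) (hJ : ∫⁻ σ in J, ‖σ‖ₑ ∂ν < ∞)
    {Z : ℕ → Ω → L2 O}
    (hZ : ∀ k, IsCompensatedIntegral P π (refMeasure O ν)
      ((jumpSet d T J).indicator fun x =>
        (b k x.2.1 * x.2.2) • (heatSemigroup e lam (T - x.1) ∘L R) (b k)) (Z k)) (n : ℕ) :
    ∀ᵐ ω ∂P, ∑ k ∈ Finset.range n, Z k ω =
      ∫ x in jumpSet d T J, x.2.2 • heatSemigroup e lam (max (T - x.1) 0)
        (∑ k ∈ Finset.range n, b k x.2.1 • R (b k)) ∂(π ω) -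
      ∫ x in jumpSet d T J, x.2.2 • heatSemigroup e lam (max (T - x.1) 0)
        (∑ k ∈ Finset.range n, b k x.2.1 • R (b k)) ∂(refMeasure O ν) := by
  have hK := measurableSet_jumpSet (d := d) T hJm
  have hf : ∀ k, ((jumpSet d T J).indicator fun x : ℝ × Pt d × ℝ =>
        (b k x.2.1 * x.2.2) • (heatSemigroup e lam (T - x.1) ∘L R) (b k)) =
      (jumpSet d T J).indicator fun x : ℝ × Pt d × ℝ =>
        x.2.2 • heatSemigroup e lam (max (T - x.1) 0) (b k x.2.1 • R (b k)) := fun k => by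
    refine Set.indicator_congr fun x hx => ?_
    rw [max_eq_left (by linarith [hx.1.2]), map_smul, smul_smul, mul_comm,
      ContinuousLinearMap.comp_apply]
  have hi : ∀ k, IntegrableOn (fun x : ℝ × Pt d × ℝ =>
      x.2.2 • heatSemigroup e lam (max (T - x.1) 0) (b k x.2.1 • R (b k))) (jumpSet d T J)
      (refMeasure O ν) := fun k =>
    integrableOn_jump e (stronglyMeasurable_heatSemigroup_sub e hlam T) (C := 1) (fun r u => by
      rw [one_mul]; exact norm_heatSemigroup_apply_le e hlam (le_max_right _ _) u)
      (G := fun ξ => b k ξ • R (b k)) ((Lp.stronglyMeasurable (b k)).smul_const _)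
      ((L2.integrable_of_isBounded hO (b k)).smul_const (R (b k))).2 T hJ
  have key : ∀ p : Measure (ℝ × Pt d × ℝ),
      (∀ k, IntegrableOn (fun x : ℝ × Pt d × ℝ =>
        x.2.2 • heatSemigroup e lam (max (T - x.1) 0) (b k x.2.1 • R (b k))) (jumpSet d T J) p) →
      ∫ x in jumpSet d T J, x.2.2 • heatSemigroup e lam (max (T - x.1) 0)
          (∑ k ∈ Finset.range n, b k x.2.1 • R (b k)) ∂p =
        ∑ k ∈ Finset.range n, ∫ x in jumpSet d T J,
          x.2.2 • heatSemigroup e lam (max (T - x.1) 0) (b k x.2.1 • R (b k)) ∂p := by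
    intro p hp
    simp_rw [map_sum, Finset.smul_sum]
    exact integral_finsetSum _ fun k _ => hp k
  simp_rw [hf] at hZ
  filter_upwards [ae_all_iff.2 fun k => h.ae_eq_of_isCompensatedIntegral (hZ k)
      ((integrable_indicator_iff hK).2 (hi k)),
    ae_all_iff.2 fun k => h.ae_integrableOn hK (hi k)] with ω h1 h2
  rw [key _ h2, key _ hi, ← Finset.sum_sub_distrib]
  refine Finset.sum_congr rfl fun k _ => ?_
  rw [h1 k, integral_indicator hK, integral_indicator hK]

/-- The error of the partial sums of the compensated small jumps. -/
theorem lintegral_enorm_partialSum_le (h : IsPoissonRandomMeasure P π (refMeasure O ν))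
    (hO : Bornology.IsBounded (O : Set (Pt d))) (R : L2 O →L[ℝ] L2 O) (b : ℕ → L2 O)
    (e : HilbertBasis ℕ ℝ (L2 O)) {lam : ℕ → ℝ} (hlam : ∀ k, 0 < lam k)
    {J : Set ℝ} (hJm : MeasurableSet J) (hJ : ∫⁻ σ in J, ‖σ‖ₑ ∂ν < ∞)
    {T τ : ℝ} (hτ : 0 ≤ τ) {N : ℕ} (hN : N * τ = T) (L : ℕ → L2 O →L[ℝ] L2 O)
    {Z : ℕ → ℕ → Ω → ℝ} {Y : ℕ → Ω → L2 O}
    (hZ : ∀ j ≤ N, ∀ k, IsCompensatedIntegral P π (refMeasure O ν)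
      ((jumpSet d (j * τ) J).indicator fun x => b k x.2.1 * x.2.2) (Z j k))
    (hY : ∀ k, IsCompensatedIntegral P π (refMeasure O ν)
      ((jumpSet d T J).indicator fun x =>
        (b k x.2.1 * x.2.2) • (heatSemigroup e lam (T - x.1) ∘L R) (b k)) (Y k)) (n : ℕ) :
    ∫⁻ ω, ‖∑ j ∈ Finset.range N, L j (∑ k ∈ Finset.range n, Z (j + 1) k ω • R (b k) -
        ∑ k ∈ Finset.range n, Z j k ω • R (b k)) - ∑ k ∈ Finset.range n, Y k ω‖ₑ ∂P ≤
      2 * ∫⁻ x in jumpSet d T J, ‖x.2.2 • stepError e lam T τ N L x.1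
        (∑ k ∈ Finset.range n, b k x.2.1 • R (b k))‖ₑ ∂refMeasure O ν := by
  set G : Pt d → L2 O := fun ξ => ∑ k ∈ Finset.range n, b k ξ • R (b k) with hG
  have hK := measurableSet_jumpSet (d := d) T hJm
  have hGm : StronglyMeasurable G := Finset.stronglyMeasurable_fun_sum _ fun k _ =>
    (Lp.stronglyMeasurable (b k)).smul_const _
  have hGi : ∫⁻ ξ in (O : Set (Pt d)), ‖G ξ‖ₑ < ∞ :=
    (integrable_finsetSum _ fun k _ => (L2.integrable_of_isBounded hO (b k)).smul_const _).2
  have hid : IntegrableOn (fun x : ℝ × Pt d × ℝ => x.2.2 • G x.2.1) (jumpSet d T J)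
      (refMeasure O ν) :=
    integrableOn_jump (O := O) (ν := ν) e (E := fun _ => ContinuousLinearMap.id ℝ (L2 O))
      (fun u => stronglyMeasurable_const) (C := 1) (fun r u => by simp) hGm hGi T hJ
  have hheat := integrableOn_jump (O := O) (ν := ν) e
    (stronglyMeasurable_heatSemigroup_sub e hlam T)
    (C := 1) (fun r u => by
      rw [one_mul]; exact norm_heatSemigroup_apply_le e hlam (le_max_right _ _) u) hGm hGi T hJ
  have hm := stronglyMeasurable_jump e (stronglyMeasurable_stepError e hlam T τ N L) hGm
  have h1 := h.lintegral_enorm_integral_sub_le (f := (jumpSet d T J).indicator fun x =>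
    x.2.2 • stepError e lam T τ N L x.1 (G x.2.1)) (hm.indicator hK).aestronglyMeasurable
  simp_rw [integral_indicator hK, enorm_indicator_eq_indicator_enorm] at h1
  rw [lintegral_indicator hK] at h1
  refine le_trans (lintegral_mono_ae ?_) h1
  have hZ' : ∀ᵐ ω ∂P, ∀ j, j ≤ N → ∑ k ∈ Finset.range n, Z j k ω • R (b k) =
      ∫ x in jumpSet d (j * τ) J, x.2.2 • G x.2.1 ∂(π ω) -
      ∫ x in jumpSet d (j * τ) J, x.2.2 • G x.2.1 ∂(refMeasure O ν) := by
    refine ae_all_iff.2 fun j => ?_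
    by_cases hj : j ≤ N
    · filter_upwards [sum_smul_ae_eq h hO R b (j * τ) hJm hJ (hZ j hj) n] with ω hω _ using hω
    · exact Eventually.of_forall fun ω hj' => absurd hj' hj
  filter_upwards [hZ', sum_convolution_ae_eq h hO R b e hlam T hJm hJ hY n,
    h.ae_integrableOn hK hid, h.ae_integrableOn hK hheat] with ω h2 h3 h4 h5
  refine le_of_eq (congrArg _ ?_)
  rw [h3, ← sum_sub_setIntegral_eq hJm e lam hτ hN L h4 h5,
    ← sum_sub_setIntegral_eq hJm e lam hτ hN L hid hheat]
  have h6 : ∀ j ∈ Finset.range N, L j (∑ k ∈ Finset.range n, Z (j + 1) k ω • R (b k) -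
        ∑ k ∈ Finset.range n, Z j k ω • R (b k)) =
      L j (∫ x in jumpSet d ((j + 1 : ℕ) * τ) J, x.2.2 • G x.2.1 ∂(π ω) -
        ∫ x in jumpSet d (j * τ) J, x.2.2 • G x.2.1 ∂(π ω)) -
      L j (∫ x in jumpSet d ((j + 1 : ℕ) * τ) J, x.2.2 • G x.2.1 ∂(refMeasure O ν) -
        ∫ x in jumpSet d (j * τ) J, x.2.2 • G x.2.1 ∂(refMeasure O ν)) := fun j hj => by
    have hj' := Finset.mem_range.1 hj
    rw [h2 (j + 1) hj', h2 j hj'.le, ← map_sub]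
    congr 1
    abel
  rw [Finset.sum_congr rfl h6, Finset.sum_sub_distrib]
  abel

theorem tendsto_lintegral_enorm_of_tendsto_eLpNorm {F : Type*} [NormedAddCommGroup F]
    {f : ℕ → Ω → F} (hf : ∀ n, AEStronglyMeasurable (f n) P)
    (h : Tendsto (fun n => eLpNorm (f n) 2 P) atTop (𝓝 0)) :
    Tendsto (fun n => ∫⁻ ω, ‖f n ω‖ₑ ∂P) atTop (𝓝 0) := by
  refine tendsto_of_tendsto_of_tendsto_of_le_of_le tendsto_const_nhds h (fun _ => zero_le)
    fun n => ?_
  simp only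
  rw [← eLpNorm_one_eq_lintegral_enorm]
  exact eLpNorm_le_eLpNorm_of_exponent_le one_le_two (hf n)

/-- The error caused by the compensated jumps with `|σ| ≤ 1`. -/
theorem lintegral_enorm_smallJumps_le (h : IsPoissonRandomMeasure P π (refMeasure O ν))
    (hO : Bornology.IsBounded (O : Set (Pt d))) (hs : (d : ℝ) / 2 < s)
    {R : L2 O →L[ℝ] L2 O} {Rext : NegSobolev O s →L[ℝ] L2 O}
    (hRext : ∀ u : L2 O, Rext (toNegSobolev O hs u) = R u)
    (b e : HilbertBasis ℕ ℝ (L2 O)) {lam : ℕ → ℝ} (hlam : ∀ k, 0 < lam k)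
    {J : Set ℝ} (hJm : MeasurableSet J) (hJ : ∫⁻ σ in J, ‖σ‖ₑ ∂ν < ∞)
    {T τ : ℝ} (hτ : 0 ≤ τ) {N : ℕ} (hN : N * τ = T) (L : ℕ → L2 O →L[ℝ] L2 O)
    {M : ℝ → Ω → NegSobolev O s} (hM : IsImpulsiveCylindrical O hs ν P π b J T M)
    {I : Ω → L2 O}
    (hI : IsCylindricalIntegral O ν P π b J T (fun r => heatSemigroup e lam (T - r) ∘L R) I)
    {B : ℝ≥0∞}
    (hB : ∀ n, ∫⁻ x in jumpSet d T J, ‖x.2.2 • stepError e lam T τ N L x.1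
        (∑ k ∈ Finset.range n, b k x.2.1 • R (b k))‖ₑ ∂refMeasure O ν ≤ B) :
    ∫⁻ ω, ‖∑ j ∈ Finset.range N, L j (Rext (M ((j + 1 : ℕ) * τ) ω - M (j * τ) ω)) - I ω‖ₑ ∂P ≤
      2 * B := by
  have hmem : ∀ j : ℕ, j ≤ N → (j : ℝ) * τ ∈ Set.Icc 0 T := fun j hj =>
    ⟨by positivity, by rw [← hN]; exact mul_le_mul_of_nonneg_right (by exact_mod_cast hj) hτ⟩
  have hM' : ∀ j : ℕ, ∃ Z : ℕ → Ω → ℝ, j ≤ N →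
      (∀ k, IsCompensatedIntegral P π (refMeasure O ν)
        ((jumpSet d (j * τ) J).indicator fun x => b k x.2.1 * x.2.2) (Z k)) ∧
      Tendsto (fun n => ∫⁻ ω, ‖M (j * τ) ω -
        ∑ k ∈ Finset.range n, Z k ω • toNegSobolev O hs (b k)‖ₑ ∂P) atTop (𝓝 0) := fun j => by
    by_cases hj : j ≤ N
    · obtain ⟨h1, Z, hZ, hlim⟩ := hM _ (hmem j hj)
      refine ⟨Z, fun _ => ⟨hZ, tendsto_lintegral_enorm_of_tendsto_eLpNorm (fun n => ?_) hlim⟩⟩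
      exact h1.1.sub (Finset.aestronglyMeasurable_fun_sum _ fun k _ => (hZ k).2.1.1.smul_const _)
    · exact ⟨fun _ _ => 0, fun hj' => absurd hj' hj⟩
  choose Z hZ using hM'
  obtain ⟨hI2, Y, hY, hYlim⟩ := hI
  have hYm : ∀ n, AEStronglyMeasurable (fun ω => I ω - ∑ k ∈ Finset.range n, Y k ω) P := fun n =>
    hI2.1.sub (Finset.aestronglyMeasurable_fun_sum _ fun k _ => (hY k).2.1.1)
  have hYlim' := tendsto_lintegral_enorm_of_tendsto_eLpNorm hYm hYlim
  set δ : ℕ → ℕ → ℝ≥0∞ := fun j n => ∫⁻ ω, ‖M (j * τ) ω -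
        ∑ k ∈ Finset.range n, Z j k ω • toNegSobolev O hs (b k)‖ₑ ∂P with hδ
  have hZm : ∀ j ≤ N, ∀ n, AEMeasurable (fun ω => ‖M (j * τ) ω -
        ∑ k ∈ Finset.range n, Z j k ω • toNegSobolev O hs (b k)‖ₑ) P := fun j hj n =>
    ((hM _ (hmem j hj)).1.1.sub (Finset.aestronglyMeasurable_fun_sum _ fun k _ =>
      ((hZ j hj).1 k).2.1.1.smul_const _)).enorm
  have hZa : ∀ j < N, ∀ n, AEMeasurable (fun ω =>
      ‖M ((j + 1 : ℕ) * τ) ω - ∑ k ∈ Finset.range n, Z (j + 1) k ω • toNegSobolev O hs (b k)‖ₑ +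
        ‖M (j * τ) ω - ∑ k ∈ Finset.range n, Z j k ω • toNegSobolev O hs (b k)‖ₑ) P :=
    fun j hj n => (hZm (j + 1) hj n).add (hZm j hj.le n)
  -- replace `M` and the stochastic convolution by their `n`-th partial sums
  have hbound : ∀ n, ∫⁻ ω, ‖∑ j ∈ Finset.range N,
        L j (Rext (M ((j + 1 : ℕ) * τ) ω - M (j * τ) ω)) - I ω‖ₑ ∂P ≤
      ∑ j ∈ Finset.range N, ‖L j ∘L Rext‖ₑ * (δ (j + 1) n + δ j n) +
        2 * B + ∫⁻ ω, ‖I ω - ∑ k ∈ Finset.range n, Y k ω‖ₑ ∂P := fun n => by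
    have h1 := (lintegral_enorm_partialSum_le h hO R b e hlam hJm hJ hτ hN L
      (fun j hj k => (hZ j hj).1 k) hY n).trans (mul_le_mul' le_rfl (hB n))
    have h2 : ∑ j ∈ Finset.range N, ‖L j ∘L Rext‖ₑ * (δ (j + 1) n + δ j n) =
        ∫⁻ ω, ∑ j ∈ Finset.range N, ‖L j ∘L Rext‖ₑ *
          (‖M ((j + 1 : ℕ) * τ) ω -
              ∑ k ∈ Finset.range n, Z (j + 1) k ω • toNegSobolev O hs (b k)‖ₑ +
            ‖M (j * τ) ω - ∑ k ∈ Finset.range n, Z j k ω • toNegSobolev O hs (b k)‖ₑ) ∂P := by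
      rw [lintegral_finsetSum' _ fun j hj => ?_]
      · refine Finset.sum_congr rfl fun j hj => ?_
        have hj' := Finset.mem_range.1 hj
        rw [lintegral_const_mul'' _ (hZa j hj' n),
          lintegral_add_left' (hZm (j + 1) hj' n)]
      · exact (hZa j (Finset.mem_range.1 hj) n).const_mul _
    refine le_trans ?_ (add_le_add (add_le_add h2.ge h1) le_rfl)
    rw [← lintegral_add_left' ?_, ← lintegral_add_right' _ (hYm n).enorm]
    · refine lintegral_mono fun ω => ?_
      have h3 : ∑ j ∈ Finset.range N, L j (Rext (M ((j + 1 : ℕ) * τ) ω - M (j * τ) ω)) - I ω =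
          ∑ j ∈ Finset.range N, (L j ∘L Rext) ((M ((j + 1 : ℕ) * τ) ω -
              ∑ k ∈ Finset.range n, Z (j + 1) k ω • toNegSobolev O hs (b k)) -
            (M (j * τ) ω - ∑ k ∈ Finset.range n, Z j k ω • toNegSobolev O hs (b k))) +
          (∑ j ∈ Finset.range N, L j (∑ k ∈ Finset.range n, Z (j + 1) k ω • R (b k) -
            ∑ k ∈ Finset.range n, Z j k ω • R (b k)) - ∑ k ∈ Finset.range n, Y k ω) -
          (I ω - ∑ k ∈ Finset.range n, Y k ω) := by
        have h4 : ∀ j, (L j ∘L Rext) ((M ((j + 1 : ℕ) * τ) ω -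
              ∑ k ∈ Finset.range n, Z (j + 1) k ω • toNegSobolev O hs (b k)) -
            (M (j * τ) ω - ∑ k ∈ Finset.range n, Z j k ω • toNegSobolev O hs (b k))) =
            L j (Rext (M ((j + 1 : ℕ) * τ) ω - M (j * τ) ω)) -
            L j (∑ k ∈ Finset.range n, Z (j + 1) k ω • R (b k) -
              ∑ k ∈ Finset.range n, Z j k ω • R (b k)) := fun j => by
          simp only [ContinuousLinearMap.comp_apply, map_sub, map_sum, map_smul, hRext]
          abel
        simp_rw [h4]
        rw [Finset.sum_sub_distrib]
        abel
      rw [h3]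
      refine enorm_sub_le.trans (add_le_add ((enorm_add_le _ _).trans (add_le_add ?_ le_rfl))
        le_rfl)
      refine (enorm_sum_le _ _).trans (Finset.sum_le_sum fun j _ => ?_)
      exact (ContinuousLinearMap.le_opENorm _ _).trans (mul_le_mul' le_rfl enorm_sub_le)
    · exact Finset.aemeasurable_fun_sum _ fun j hj =>
        (hZa j (Finset.mem_range.1 hj) n).const_mul _
  -- the errors of the truncated expansions vanish as `n → ∞`
  refine ge_of_tendsto' (x := atTop) ?_ hbound
  have h1 : Tendsto (fun n => ∑ j ∈ Finset.range N, ‖L j ∘L Rext‖ₑ * (δ (j + 1) n + δ j n))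
      atTop (𝓝 (∑ j ∈ Finset.range N, ‖L j ∘L Rext‖ₑ * (0 + 0))) :=
    tendsto_finsetSum _ fun j hj => ENNReal.Tendsto.const_mul
      (((hZ (j + 1) (Finset.mem_range.1 hj)).2).add (hZ j (Finset.mem_range.1 hj).le).2)
      (Or.inr enorm_ne_top)
  simpa using (h1.add_const (2 * B)).add hYlim'

end SmallJumps

/-! ### Weak error for Lipschitz test functions -/

section WeakError

theorem IsC2bHS.exists_lipschitz {H : Type*} [NormedAddCommGroup H] [InnerProductSpace ℝ H]
    [CompleteSpace H] {e : HilbertBasis ℕ ℝ H} {φ : H → ℝ} (hφ : IsC2bHS e φ) :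
    ∃ L : ℝ, 0 ≤ L ∧ ∀ x y, |φ x - φ y| ≤ L * ‖x - y‖ := by
  obtain ⟨K, hK⟩ := hφ.bounded
  refine ⟨K, (norm_nonneg _).trans (hK 0).2.1, fun x y => ?_⟩
  have hd : ∀ z ∈ Set.univ, DifferentiableAt ℝ φ z := fun z _ =>
    (hφ.contDiff.differentiable two_ne_zero) z
  refine Convex.norm_image_sub_le_of_norm_fderiv_le hd (fun z _ => ?_) convex_univ
    (Set.mem_univ y) (Set.mem_univ x)
  have h := (hK z).2.1
  rwa [gradient, LinearIsometryEquiv.norm_map] at h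

theorem IsC2bHS.abs_le_iSup {H : Type*} [NormedAddCommGroup H] [InnerProductSpace ℝ H]
    [CompleteSpace H] {e : HilbertBasis ℕ ℝ H} {φ : H → ℝ} (hφ : IsC2bHS e φ) (x : H) :
    |φ x| ≤ ⨆ x, |φ x| := by
  obtain ⟨K, hK⟩ := hφ.bounded
  exact le_ciSup (f := fun x => |φ x|) ⟨K, by rintro _ ⟨y, rfl⟩; exact (hK y).1⟩ x

/-- Two random variables which are close in mean outside a set `A` have close expectations of
bounded Lipschitz functions. -/
theorem abs_integral_sub_integral_le_of_lipschitz {Ω H : Type*} [MeasurableSpace Ω] {P : Measure Ω}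
    [IsProbabilityMeasure P] [NormedAddCommGroup H] {φ : H → ℝ} {B L K : ℝ} (hL : 0 ≤ L)
    (hK : 0 ≤ K) (hB : ∀ x, |φ x| ≤ B) (hφ : ∀ x y, |φ x - φ y| ≤ L * ‖x - y‖) {F G : Ω → H}
    (hF : AEStronglyMeasurable F P) (hG : AEStronglyMeasurable G P) {A : Set Ω}
    (hA : MeasurableSet A) {D : Ω → ℝ≥0∞} (hD : ∀ᵐ ω ∂P, ω ∉ A → ‖F ω - G ω‖ₑ ≤ D ω)
    (hDK : ∫⁻ ω, D ω ∂P ≤ ENNReal.ofReal K) :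
    |∫ ω, φ (F ω) ∂P - ∫ ω, φ (G ω) ∂P| ≤ L * K + 2 * B * P.real A := by
  have hφc : Continuous φ := by
    refine (LipschitzWith.of_dist_le_mul (K := L.toNNReal) fun x y => ?_).continuous
    rw [Real.coe_toNNReal _ hL, Real.dist_eq, dist_eq_norm]
    exact hφ x y
  have hB0 : 0 ≤ B := (abs_nonneg _).trans (hB 0)
  have hFi : Integrable (fun ω => φ (F ω)) P :=
    Integrable.of_bound (hφc.comp_aestronglyMeasurable hF) B (Eventually.of_forall fun _ => hB _)
  have hGi : Integrable (fun ω => φ (G ω)) P :=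
    Integrable.of_bound (hφc.comp_aestronglyMeasurable hG) B (Eventually.of_forall fun _ => hB _)
  have hR : 0 ≤ L * K + 2 * B * P.real A := by positivity
  rw [← integral_sub hFi hGi, ← Real.norm_eq_abs, ← ENNReal.ofReal_le_ofReal_iff hR, ofReal_norm]
  calc ‖∫ ω, (φ (F ω) - φ (G ω)) ∂P‖ₑ ≤ ∫⁻ ω, ‖φ (F ω) - φ (G ω)‖ₑ ∂P :=
        enorm_integral_le_lintegral_enorm _
    _ ≤ ∫⁻ ω, (ENNReal.ofReal L * D ω + A.indicator (fun _ => ENNReal.ofReal (2 * B)) ω) ∂P := by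
        refine lintegral_mono_ae ?_
        filter_upwards [hD] with ω hω
        by_cases h : ω ∈ A
        · rw [Set.indicator_of_mem h, ← ofReal_norm]
          refine (ENNReal.ofReal_le_ofReal ?_).trans le_add_self
          refine (norm_sub_le _ _).trans ?_
          have h1 := hB (F ω)
          have h2 := hB (G ω)
          rw [Real.norm_eq_abs, Real.norm_eq_abs]
          linarith
        · rw [Set.indicator_of_notMem h, add_zero, ← ofReal_norm]
          refine (ENNReal.ofReal_le_ofReal (hφ _ _)).trans ?_
          rw [ENNReal.ofReal_mul hL, ofReal_norm]
          exact mul_le_mul' le_rfl (hω h)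
    _ = ENNReal.ofReal L * ∫⁻ ω, D ω ∂P + ENNReal.ofReal (2 * B) * P A := by
        rw [lintegral_add_right _ (measurable_const.indicator hA),
          lintegral_const_mul' _ _ ENNReal.ofReal_ne_top, lintegral_indicator hA,
          setLIntegral_const]
    _ ≤ ENNReal.ofReal L * ENNReal.ofReal K + ENNReal.ofReal (2 * B) * P A :=
        add_le_add (mul_le_mul' le_rfl hDK) le_rfl
    _ = ENNReal.ofReal (L * K + 2 * B * P.real A) := by
        rw [ENNReal.ofReal_add (by positivity) (by positivity), ENNReal.ofReal_mul hL,
          ENNReal.ofReal_mul (p := 2 * B) (by positivity), ofReal_measureReal]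

end WeakError

/-! ### The scheme as a discretized convolution -/

section SchemeError

variable {d : ℕ} {O : Opens (Pt d)}

theorem thetaScheme_eq {H : Type*} [NormedAddCommGroup H] [InnerProductSpace ℝ H] [CompleteSpace H]
    (e : HilbertBasis ℕ ℝ H) (lam : ℕ → ℝ) (V : Submodule ℝ H) [FiniteDimensional ℝ V]
    (hV : V ≤ (fracPow e lam (1 / 2)).domain) (θ Δt : ℝ) (x₀ : H) (η : ℕ → H) (N : ℕ) :
    thetaScheme e lam V hV θ Δt x₀ η N = liftOp V (stepS e lam V hV θ Δt ^ N) x₀ +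
      ∑ j ∈ Finset.range N,
        liftOp V (stepS e lam V hV θ Δt ^ (N - j - 1) * stepT e lam V hV θ Δt) (η j) := by
  rw [thetaScheme, Submodule.coe_add, Submodule.coe_sum]
  rfl

/-- The singularity of `stepError` at the final time, from the error of the operators
`S^n T` on the time interval `[n τ, (n + 1) τ)`. -/
theorem weightedHS_stepError_le {H : Type*} [NormedAddCommGroup H] [InnerProductSpace ℝ H]
    (e : HilbertBasis ℕ ℝ H) (lam w : ℕ → ℝ)
    {T τ : ℝ} (hτ : 0 < τ) {N : ℕ} (hN : N * τ = T) {L : ℕ → H →L[ℝ] H} {g : ℝ → ℝ≥0∞}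
    (hL : ∀ (t : ℝ) (n : ℕ), 0 < t → n * τ ≤ t → t < (n + 1) * τ →
      weightedHS e w (L n - heatSemigroup e lam t) ≤ g t) {r : ℝ} (hr : r ∈ Set.Ioo 0 T) :
    weightedHS e w (stepError e lam T τ N (fun j => L (N - j - 1)) r) ≤ g (T - r) := by
  have hpos : 0 < ⌈r / τ⌉₊ := Nat.ceil_pos.2 (div_pos hr.1 hτ)
  obtain ⟨j, hj⟩ := Nat.exists_eq_succ_of_ne_zero hpos.ne'
  have h1 : r ≤ (j + 1 : ℕ) * τ := by
    rw [← div_le_iff₀ hτ]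
    have := Nat.le_ceil (r / τ)
    rw [hj] at this
    exact_mod_cast this
  have h2 : j * τ < r := by
    rw [← lt_div_iff₀ hτ]
    exact Nat.lt_ceil.1 (by rw [hj]; exact Nat.lt_succ_self j)
  have hjN : j < N := by
    have h3 : (j : ℝ) * τ < N * τ := by rw [hN]; exact h2.trans hr.2
    exact_mod_cast lt_of_mul_lt_mul_right h3 hτ.le
  rw [stepError, stepFun_eq hτ.le _ hjN ⟨h2, h1⟩, max_eq_left (by linarith [hr.2])]
  obtain ⟨n, rfl⟩ : ∃ n, N = n + j + 1 := ⟨N - j - 1, by omega⟩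
  have hn : n + j + 1 - j - 1 = n := by omega
  rw [hn]
  push_cast at hN h1
  exact hL (T - r) n (by linarith [hr.2]) (by nlinarith) (by nlinarith)

end SchemeError

/-! ### The weak error of the scheme -/

section Assembly

variable {d : ℕ} {O : Opens (Pt d)} {s : ℝ} {Ω : Type*} [MeasurableSpace Ω] {P : Measure Ω}
  {π : Ω → Measure (ℝ × Pt d × ℝ)} {ν : Measure ℝ} [SigmaFinite ν]

theorem compl_Icc_neg_eq (m : ℝ) : (Set.Icc (-m) m)ᶜ = {σ : ℝ | m < |σ|} := by
  ext σ
  rw [Set.mem_compl_iff, Set.mem_Icc, ← abs_le, not_le]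
  rfl

/-- The probability that a jump larger than `m` occurs up to time `T`. -/
theorem measureReal_jump_ne_zero_le [IsProbabilityMeasure P]
    (h : IsPoissonRandomMeasure P π (refMeasure O ν)) (hO : Bornology.IsBounded (O : Set (Pt d)))
    (hν : Integrable (fun σ : ℝ => min |σ| 1) ν) {T m : ℝ} (hT : 0 ≤ T) (hm : 1 ≤ m) :
    P.real {ω | π ω (jumpSet d T {σ | m < |σ|}) ≠ 0} ≤
      min (T * volume.real (O : Set (Pt d)) * ν.real (Set.Icc (-m) m)ᶜ) 1 := by
  have hJ : MeasurableSet {σ : ℝ | m < |σ|} := measurableSet_lt measurable_const (by fun_prop)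
  have hμ : refMeasure O ν (jumpSet d T {σ | m < |σ|}) ≠ ∞ := by
    rw [refMeasure_jumpSet]
    exact ENNReal.mul_ne_top ENNReal.ofReal_ne_top
      (ENNReal.mul_ne_top hO.measure_lt_top.ne (measure_lt_abs_lt_top hν hm).ne)
  refine le_min ?_ measureReal_le_one
  have h1 := ENNReal.toReal_mono hμ (h.measure_ne_zero_le (measurableSet_jumpSet T hJ) hμ)
  rw [refMeasure_jumpSet, ENNReal.toReal_mul, ENNReal.toReal_mul, ENNReal.toReal_ofReal hT,
    ← mul_assoc] at h1
  rw [compl_Icc_neg_eq]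
  exact h1

theorem lintegral_abs_Icc_eq {m : ℕ} (hm : 1 ≤ m) :
    ∫⁻ σ in Set.Icc (-(m : ℝ)) m, ‖σ‖ₑ ∂ν =
      ∫⁻ σ in Set.Icc (-1 : ℝ) 1, ‖σ‖ₑ ∂ν + ∫⁻ σ in {σ : ℝ | 1 < |σ| ∧ |σ| ≤ m}, ‖σ‖ₑ ∂ν := by
  have hm1 : (1 : ℝ) ≤ m := by exact_mod_cast hm
  rw [← lintegral_union (measurableSet_lt_abs_le m)]
  · congr 2
    ext σ
    simp only [Set.mem_union, Set.mem_ofPred_eq, Set.mem_Icc, ← abs_le]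
    constructor
    · intro h
      rcases le_or_gt |σ| 1 with h1 | h1
      · exact Or.inl h1
      · exact Or.inr ⟨h1, h⟩
    · rintro (h | h)
      · exact h.trans hm1
      · exact h.2
  · refine Set.disjoint_left.2 fun σ h1 h2 => ?_
    exact absurd (abs_le.2 h1) (not_le.2 h2.1)

theorem ofReal_integral_abs_Icc {ν : Measure ℝ} (hν : Integrable (fun σ : ℝ => min |σ| 1) ν)
    (m : ℕ) : ENNReal.ofReal (∫ σ in Set.Icc (-(m : ℝ)) m, |σ| ∂ν) =
      ∫⁻ σ in Set.Icc (-(m : ℝ)) m, ‖σ‖ₑ ∂ν := by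
  have hi : Integrable (fun σ : ℝ => σ) (ν.restrict (Set.Icc (-(m : ℝ)) m)) :=
    ⟨measurable_id.aestronglyMeasurable, lintegral_abs_lt_top_of_subset_Icc hν m subset_rfl⟩
  exact ofReal_integral_norm_eq_lintegral_enorm hi

/-- The mild solution is a measurable random variable. -/
theorem IsMildSolution.aestronglyMeasurable [IsProbabilityMeasure P]
    (h : IsPoissonRandomMeasure P π (refMeasure O ν)) (hO : Bornology.IsBounded (O : Set (Pt d)))
    (hν : Integrable (fun σ : ℝ => min |σ| 1) ν) {hs : (d : ℝ) / 2 < s}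
    {e : HilbertBasis ℕ ℝ (L2 O)} {lam : ℕ → ℝ} (hlam : ∀ k, 0 < lam k)
    {R : L2 O →L[ℝ] L2 O} {Rext : NegSobolev O s →L[ℝ] L2 O} {b : HilbertBasis ℕ ℝ (L2 O)}
    {x₀ : L2 O} {T : ℝ} (hT : 0 ≤ T) {X : ℝ → Ω → L2 O}
    (hX : IsMildSolution O hs e lam R Rext ν P π b x₀ T X) : AEStronglyMeasurable (X T) P := by
  obtain ⟨I, hI, hXT⟩ := hX T ⟨hT, le_rfl⟩
  have hJ : MeasurableSet {σ : ℝ | 1 < |σ|} := measurableSet_lt measurable_const (by fun_prop)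
  have hK := measurableSet_jumpSet (d := d) T hJ
  have hμ : refMeasure O ν (jumpSet d T {σ | 1 < |σ|}) ≠ ∞ := by
    rw [refMeasure_jumpSet]
    exact ENNReal.mul_ne_top ENNReal.ofReal_ne_top
      (ENNReal.mul_ne_top hO.measure_lt_top.ne (measure_lt_abs_lt_top hν le_rfl).ne)
  refine AEStronglyMeasurable.congr ((aestronglyMeasurable_const.add hI.1.1).add ?_) hXT.symm
  have hm := stronglyMeasurable_jump e (stronglyMeasurable_heatSemigroup_sub e hlam T)
    (G := fun ξ => Rext (diracDelta O hs ξ))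
    (Rext.continuous.comp_stronglyMeasurable (stronglyMeasurable_diracDelta hs))
  refine (h.aestronglyMeasurable_setIntegral hK hμ (f := fun _ x =>
    x.2.2 • heatSemigroup e lam (max (T - x.1) 0) (Rext (diracDelta O hs x.2.1)))
    (hm.comp_measurable measurable_snd)).congr (Eventually.of_forall fun ω => ?_)
  refine setIntegral_congr_fun hK fun x hx => ?_
  rw [max_eq_left (by linarith [hx.1.2]), map_smul, map_smul]

/-- The weak error in terms of the error of the initial value and of the singularity of the
operator error at the final time. -/
theorem abs_integral_thetaScheme_sub_le [IsProbabilityMeasure P]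
    (h : IsPoissonRandomMeasure P π (refMeasure O ν)) (hO : Bornology.IsBounded (O : Set (Pt d)))
    (hν : Integrable (fun σ : ℝ => min |σ| 1) ν) (hs : (d : ℝ) / 2 < s)
    {R : L2 O →L[ℝ] L2 O} {Rext : NegSobolev O s →L[ℝ] L2 O}
    (hR : IsSelfAdjoint R) (hRext : ∀ u : L2 O, Rext (toNegSobolev O hs u) = R u)
    (b e : HilbertBasis ℕ ℝ (L2 O)) {lam : ℕ → ℝ} (hlam : ∀ k, 0 < lam k)
    {w : ℕ → ℝ} (hw : ∀ k, 0 ≤ w k) {c : ℝ≥0∞} (hc' : c ≠ ∞)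
    (hc : ∀ x, ENNReal.ofReal (‖R x‖ ^ 2) ≤ c * ∑' k, ENNReal.ofReal (w k * ⟪e k, x⟫_ℝ ^ 2))
    (V : Submodule ℝ (L2 O)) [FiniteDimensional ℝ V] (hV : V ≤ (fracPow e lam (1 / 2)).domain)
    {θ T : ℝ} (hT : 0 < T) {N m : ℕ} (hN : 1 ≤ N) (hm : 1 ≤ m)
    {φ : L2 O → ℝ} {Bφ Lφ : ℝ} (hLφ : 0 ≤ Lφ) (hBφ : ∀ x, |φ x| ≤ Bφ)
    (hφ : ∀ x y, |φ x - φ y| ≤ Lφ * ‖x - y‖) {x₀ : L2 O} {D₀ D p : ℝ}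
    (hD₀ : ‖liftOp V (stepS e lam V hV θ (T / N) ^ N) x₀ - heatSemigroup e lam T x₀‖ ≤ D₀)
    (hD0 : 0 ≤ D) (hp : p < 1)
    (hD : ∀ (t : ℝ) (n : ℕ), 0 < t → n * (T / N) ≤ t → t < (n + 1) * (T / N) →
      weightedHS e w (liftOp V (stepS e lam V hV θ (T / N) ^ n * stepT e lam V hV θ (T / N)) -
        heatSemigroup e lam t) ≤ ENNReal.ofReal (D ^ 2 * t ^ (-(2 * p))))
    {M : ℝ → Ω → NegSobolev O s}
    (hM : IsImpulsiveCylindrical O hs ν P π b (Set.Icc (-1) 1) T M)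
    {X : ℝ → Ω → L2 O} (hX : IsMildSolution O hs e lam R Rext ν P π b x₀ T X)
    {Pm Mm : ℝ → Ω → NegSobolev O s}
    (hPm : Pm = stoppedJumpProcess O hs π T m ∨ Pm = truncatedJumpProcess O hs π m)
    (hMm : ∀ t ω, Mm t ω = Pm t ω - t • meanJump O hs ν m) :
    |(∫ ω, φ (thetaScheme e lam V hV θ (T / N) x₀
          (fun k => Rext ((T / N) • meanJump O hs ν m
            + (M ((k + 1 : ℕ) * (T / N)) ω - M (k * (T / N)) ω)
            + (Mm ((k + 1 : ℕ) * (T / N)) ω - Mm (k * (T / N)) ω))) N) ∂P)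
        - ∫ ω, φ (X T ω) ∂P|
      ≤ Lφ * (D₀ + 2 * (∫ σ in Set.Icc (-(m : ℝ)) m, |σ| ∂ν) * D *
          (c ^ (1 / 2 : ℝ) * volume (O : Set (Pt d)) ^ (1 / 2 : ℝ) *
            ∫⁻ r in Set.Ioo 0 T, ENNReal.ofReal ((T - r) ^ (-p))).toReal) +
        2 * Bφ * min (T * volume.real (O : Set (Pt d)) * ν.real (Set.Icc (-(m : ℝ)) m)ᶜ) 1 := by
  set τ : ℝ := T / N with hτdef
  have hN0 : (0 : ℝ) < N := by exact_mod_cast hN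
  have hm1 : (1 : ℝ) ≤ m := by exact_mod_cast hm
  have hτ : 0 < τ := by positivity
  have hNτ : N * τ = T := by rw [hτdef]; field_simp
  have hle : ∀ i : ℕ, i ≤ N → (i : ℝ) * τ ≤ T := fun i hi => by
    rw [← hNτ]; exact mul_le_mul_of_nonneg_right (by exact_mod_cast hi) hτ.le
  set K : ℝ≥0∞ := c ^ (1 / 2 : ℝ) * volume (O : Set (Pt d)) ^ (1 / 2 : ℝ) *
    ∫⁻ r in Set.Ioo 0 T, ENNReal.ofReal ((T - r) ^ (-p)) with hK
  have hKtop : K ≠ ∞ := ENNReal.mul_ne_top (ENNReal.mul_ne_top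
    (ENNReal.rpow_ne_top_of_nonneg (by norm_num) hc')
    (ENNReal.rpow_ne_top_of_nonneg (by norm_num) hO.measure_lt_top.ne))
    (lintegral_rpow_sub_lt_top T hp).ne
  set L : ℕ → L2 O →L[ℝ] L2 O := fun j =>
    liftOp V (stepS e lam V hV θ τ ^ (N - j - 1) * stepT e lam V hV θ τ) with hL
  set J : Set ℝ := {σ | 1 < |σ| ∧ |σ| ≤ m} with hJdef
  have hE : ∀ r ∈ Set.Ioo 0 T, weightedHS e w (stepError e lam T τ N L r) ≤
      ENNReal.ofReal (D ^ 2 * (T - r) ^ (-(2 * p))) := fun r hr =>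
    weightedHS_stepError_le e lam w hτ hNτ
      (L := fun n => liftOp V (stepS e lam V hV θ τ ^ n * stepT e lam V hV θ τ))
      (g := fun t => ENNReal.ofReal (D ^ 2 * t ^ (-(2 * p)))) hD hr
  have hJi : ∫⁻ σ in Set.Icc (-1 : ℝ) 1, ‖σ‖ₑ ∂ν < ∞ :=
    lintegral_abs_lt_top_of_subset_Icc hν 1 (by simp)
  obtain ⟨I, hI, hXT⟩ := hX T ⟨hT.le, le_rfl⟩
  -- small jumps through partial sums of the expansion of `δ_ξ`, large jumps through `δ_ξ` itself
  have hsmall := lintegral_enorm_smallJumps_le h hO hs hRext b e hlam measurableSet_Icc hJi hτ.le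
    hNτ L hM hI (fun n => (isNoiseKernel_sum_basis hO hR e b hw hc n).lintegral_enorm_jump_le ν
      (stronglyMeasurable_stepError e hlam T τ N L) hD0 hE (Set.Icc (-1) 1))
  have hkernel := isNoiseKernel_ext_diracDelta hO hs hR hRext e hw hc
  have hlarge := (lintegral_enorm_largeJumps_le h hO hν hs hlam hkernel hτ.le hNτ L m).trans
    (hkernel.lintegral_enorm_jump_le ν (stronglyMeasurable_stepError e hlam T τ N L) hD0 hE J)
  set A₁ : Ω → L2 O := fun ω =>
    ∑ j ∈ Finset.range N, L j (Rext (M ((j + 1 : ℕ) * τ) ω - M (j * τ) ω)) - I ω with hA₁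
  set A₂ : Ω → L2 O := fun ω =>
    ∑ j ∈ Finset.range N, L j (Rext (truncatedJumpProcess O hs π m ((j + 1 : ℕ) * τ) ω -
        truncatedJumpProcess O hs π m (j * τ) ω)) -
      ∫ x in jumpSet d T J,
        heatSemigroup e lam (T - x.1) (Rext (x.2.2 • diracDelta O hs x.2.1)) ∂(π ω) with hA₂
  have hMt : ∀ j ≤ N, AEStronglyMeasurable (M (j * τ)) P := fun j hj =>
    (hM _ ⟨by positivity, hle j hj⟩).1.1
  have hPt : ∀ j ≤ N, AEStronglyMeasurable (Pm (j * τ)) P := fun j hj => by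
    rcases hPm with rfl | rfl
    · refine aestronglyMeasurable_stoppedJumpProcess h hs (hle j hj) (by positivity) ?_ m
      rw [refMeasure_jumpSet]
      exact ENNReal.mul_ne_top ENNReal.ofReal_ne_top
        (ENNReal.mul_ne_top hO.measure_lt_top.ne (measure_lt_abs_lt_top hν le_rfl).ne)
    · refine aestronglyMeasurable_jumpProcess h hs (measurableSet_lt_abs_le m) ?_
        (measurable_const (a := (j : ℝ) * τ)) fun _ => hle j hj
      rw [refMeasure_jumpSet]
      exact ENNReal.mul_ne_top ENNReal.ofReal_ne_top (ENNReal.mul_ne_top hO.measure_lt_top.ne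
        ((measure_mono fun σ hσ => hσ.1).trans_lt (measure_lt_abs_lt_top hν le_rfl)).ne)
  -- the drift `u_m` cancels
  have hη : ∀ (ω : Ω) (k : ℕ), τ • meanJump O hs ν m
        + (M ((k + 1 : ℕ) * τ) ω - M (k * τ) ω) + (Mm ((k + 1 : ℕ) * τ) ω - Mm (k * τ) ω) =
      (M ((k + 1 : ℕ) * τ) ω - M (k * τ) ω) + (Pm ((k + 1 : ℕ) * τ) ω - Pm (k * τ) ω) :=
    fun ω k => by
      rw [hMm, hMm]
      push_cast
      module
  have hscheme : ∀ ω, thetaScheme e lam V hV θ τ x₀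
        (fun k => Rext (τ • meanJump O hs ν m
          + (M ((k + 1 : ℕ) * τ) ω - M (k * τ) ω)
          + (Mm ((k + 1 : ℕ) * τ) ω - Mm (k * τ) ω))) N =
      liftOp V (stepS e lam V hV θ τ ^ N) x₀ +
        (∑ j ∈ Finset.range N, L j (Rext (M ((j + 1 : ℕ) * τ) ω - M (j * τ) ω)) +
        ∑ j ∈ Finset.range N, L j (Rext (Pm ((j + 1 : ℕ) * τ) ω - Pm (j * τ) ω))) := fun ω => by
    rw [thetaScheme_eq, ← Finset.sum_add_distrib]
    simp_rw [hη ω, map_add]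
    rfl
  simp_rw [hscheme]
  have hMsum : AEStronglyMeasurable (fun ω =>
      ∑ j ∈ Finset.range N, L j (Rext (M ((j + 1 : ℕ) * τ) ω - M (j * τ) ω))) P :=
    Finset.aestronglyMeasurable_fun_sum _ fun j hj =>
      ((L j).continuous.comp Rext.continuous).comp_aestronglyMeasurable
        ((hMt (j + 1) (Finset.mem_range.1 hj)).sub (hMt j (Finset.mem_range.1 hj).le))
  have hPsum : AEStronglyMeasurable (fun ω =>
      ∑ j ∈ Finset.range N, L j (Rext (Pm ((j + 1 : ℕ) * τ) ω - Pm (j * τ) ω))) P :=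
    Finset.aestronglyMeasurable_fun_sum _ fun j hj =>
      ((L j).continuous.comp Rext.continuous).comp_aestronglyMeasurable
        ((hPt (j + 1) (Finset.mem_range.1 hj)).sub (hPt j (Finset.mem_range.1 hj).le))
  have hJmeas : MeasurableSet {σ : ℝ | (m : ℝ) < |σ|} :=
    measurableSet_lt measurable_const (by fun_prop)
  have hBad : MeasurableSet {ω | π ω (jumpSet d T {σ | (m : ℝ) < |σ|}) ≠ 0} :=
    (h.measurable _ (measurableSet_jumpSet T hJmeas)) (measurableSet_singleton 0).compl
  have hD₀0 : 0 ≤ D₀ := (norm_nonneg _).trans hD₀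
  have hB0 : 0 ≤ Bφ := (abs_nonneg _).trans (hBφ 0)
  have hint0 : 0 ≤ ∫ σ in Set.Icc (-(m : ℝ)) m, |σ| ∂ν := integral_nonneg fun σ => abs_nonneg σ
  refine (abs_integral_sub_integral_le_of_lipschitz hLφ
    (K := D₀ + 2 * (∫ σ in Set.Icc (-(m : ℝ)) m, |σ| ∂ν) * D * K.toReal) (by positivity) hBφ hφ
    (aestronglyMeasurable_const.add (hMsum.add hPsum)) (hX.aestronglyMeasurable h hO hν hlam hT.le)
    hBad (D := fun ω => ENNReal.ofReal D₀ + (‖A₁ ω‖ₑ + ‖A₂ ω‖ₑ)) ?_ ?_).trans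
    (add_le_add le_rfl (mul_le_mul_of_nonneg_left
      (measureReal_jump_ne_zero_le h hO hν hT.le hm1) (by positivity)))
  -- without a jump larger than `m`, both choices of `P^{[m]}` agree with the noise of the solution
  · filter_upwards [hXT] with ω hω hgood
    have hgood' : π ω (jumpSet d T {σ | (m : ℝ) < |σ|}) = 0 := by
      by_contra h0
      exact hgood h0
    have hP : ∀ j ≤ N, Pm (j * τ) ω = truncatedJumpProcess O hs π m (j * τ) ω := fun j hj => by
      rcases hPm with rfl | rfl
      · exact stoppedJumpProcess_eq_truncatedJumpProcess hs (hle j hj) hgood'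
      · rfl
    have hPs : ∑ j ∈ Finset.range N, L j (Rext (Pm ((j + 1 : ℕ) * τ) ω - Pm (j * τ) ω)) =
        ∑ j ∈ Finset.range N, L j (Rext (truncatedJumpProcess O hs π m ((j + 1 : ℕ) * τ) ω -
          truncatedJumpProcess O hs π m (j * τ) ω)) := Finset.sum_congr rfl fun j hj => by
      rw [hP (j + 1) (Finset.mem_range.1 hj), hP j (Finset.mem_range.1 hj).le]
    simp only [Pi.add_apply]
    rw [hPs, hω, setIntegral_jumpSet_eq_of_measure_eq_zero le_rfl hgood']
    have hsplit : ∀ a a' b b' c c' : L2 O, a + (b + c) - (a' + b' + c') =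
        (a - a') + ((b - b') + (c - c')) := fun _ _ _ _ _ _ => by abel
    rw [hsplit]
    refine (enorm_add_le _ _).trans (add_le_add ?_ (enorm_add_le _ _))
    rw [← ofReal_norm]
    exact ENNReal.ofReal_le_ofReal hD₀
  · have hA₁m : AEMeasurable (fun ω => ‖A₁ ω‖ₑ) P := (hMsum.sub hI.1.1).enorm
    rw [lintegral_add_left measurable_const, lintegral_add_left' hA₁m, lintegral_const,
      measure_univ, mul_one, ENNReal.ofReal_add hD₀0 (by positivity)]
    refine add_le_add le_rfl ((add_le_add hsmall hlarge).trans ?_)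
    rw [ENNReal.ofReal_mul (by positivity), ENNReal.ofReal_mul (by positivity),
      ENNReal.ofReal_mul zero_le_two, ENNReal.ofReal_toReal hKtop, ofReal_integral_abs_Icc hν m,
      lintegral_abs_Icc_eq hm, ENNReal.ofReal_ofNat]
    set a := ∫⁻ σ in Set.Icc (-1 : ℝ) 1, ‖σ‖ₑ ∂ν
    set a' := ∫⁻ σ in J, ‖σ‖ₑ ∂ν
    calc 2 * (a * (ENNReal.ofReal D * K)) + a' * (ENNReal.ofReal D * K)
        ≤ 2 * (a * (ENNReal.ofReal D * K)) + 2 * (a' * (ENNReal.ofReal D * K)) :=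
          add_le_add le_rfl (le_mul_of_one_le_left zero_le one_le_two)
      _ = 2 * (a + a') * ENNReal.ofReal D * K := by ring

end Assembly
theorem mainTheorem3 {d : ℕ} (O : Opens (Pt d)) (hObdd : Bornology.IsBounded (O : Set (Pt d)))
    (A : L2 O →ₗ.[ℝ] L2 O) (hA : IsPositiveCompactType A)
    (lam : ℕ → ℝ) (e : HilbertBasis ℕ ℝ (L2 O)) (he : IsEigenbasis A lam e)
    (Q R : L2 O →L[ℝ] L2 O) (hQ : Q.IsPositive) (hR : R.IsPositive) (hRQ : R ∘L R = Q)
    (V : Set.Ioi (0 : ℝ) → Submodule ℝ (L2 O)) [∀ h, FiniteDimensional ℝ (V h)]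
    (hV : ∀ h, V h ≤ (fracPow e lam (1 / 2)).domain)
    (hS1 : ∀ q ∈ Set.Icc (0 : ℝ) 2, ∃ κ : ℝ, 0 < κ ∧ ∀ (h : Set.Ioi (0 : ℝ)) (t : ℝ), 0 < t →
      ‖semigroupError e lam (V h) (hV h) t‖ ≤ κ * (h : ℝ) ^ q * t ^ (-q / 2))
    (hS2 : ∃ κ : ℝ, 0 < κ ∧ ∀ (h : Set.Ioi (0 : ℝ)) (t : ℝ), 0 < t → ∀ x : L2 O,
      ∃ hx : semigroupError e lam (V h) (hV h) t x ∈ (fracPow e lam (1 / 2)).domain,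
        ‖semigroupError e lam (V h) (hV h) t x‖ +
          ‖fracPow e lam (1 / 2) ⟨semigroupError e lam (V h) (hV h) t x, hx⟩‖
          ≤ κ * (h : ℝ) * t⁻¹ * ‖x‖)
    (α β : ℝ) (hα : 0 < α) (hβ : β ∈ Set.Ioc (α - 1) α)
    (hTr : Summable fun k => lam k ^ (-α))
    (hAQ : ∃ B : L2 O →L[ℝ] L2 O, ∀ x : L2 O, ∃ hx : Q x ∈ (fracPow e lam β).domain,
      fracPow e lam β ⟨Q x, hx⟩ = B x)
    (s : ℝ) (hs : (d : ℝ) / 2 < s) (Rext : NegSobolev O s →L[ℝ] L2 O)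
    (hRext : ∀ u : L2 O, Rext (toNegSobolev O hs u) = R u)
    (θ : ℝ) (hθ : θ ∈ Set.Ioc (1 / 2 : ℝ) 1) (T : ℝ) (hT : 1 ≤ T)
    (φ : L2 O → ℝ) (hφ : IsC2bHS e φ) (γ : ℝ) (hγ : γ < 1 - α + β) (ρ : ℝ) :
    ∃ C : ℝ, 0 < C ∧
      ∀ (x₀ : L2 O), ‖x₀‖ ≤ ρ →
      ∀ (ν : Measure ℝ) [SigmaFinite ν], ν {0} = 0 → Integrable (fun σ : ℝ => min |σ| 1) ν →
      ∀ {Ω : Type*} [MeasurableSpace Ω] (P : Measure Ω) [IsProbabilityMeasure P]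
        (π : Ω → Measure (ℝ × Pt d × ℝ)), IsPoissonRandomMeasure P π (refMeasure O ν) →
      ∀ (b : HilbertBasis ℕ ℝ (L2 O)) (M : ℝ → Ω → NegSobolev O s),
        IsImpulsiveCylindrical O hs ν P π b (Set.Icc (-1) 1) T M →
      ∀ (X : ℝ → Ω → L2 O), IsMildSolution O hs e lam R Rext ν P π b x₀ T X →
      ∀ (N m : ℕ) (h : Set.Ioi (0 : ℝ)), 1 ≤ N → 1 ≤ m → T / N ≤ 1 →
      ∀ (Pm Mm : ℝ → Ω → NegSobolev O s),
        (Pm = stoppedJumpProcess O hs π T m ∨ Pm = truncatedJumpProcess O hs π m) →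
        (∀ t ω, Mm t ω = Pm t ω - t • meanJump O hs ν m) →
        |(∫ ω, φ (thetaScheme e lam (V h) (hV h) θ (T / N) x₀
              (fun k => Rext ((T / N) • meanJump O hs ν m
                + (M ((k + 1 : ℕ) * (T / N)) ω - M (k * (T / N)) ω)
                + (Mm ((k + 1 : ℕ) * (T / N)) ω - Mm (k * (T / N)) ω))) N) ∂P)
            - ∫ ω, φ (X T ω) ∂P|
          ≤ C * (1 + ∫ σ in Set.Icc (-(m : ℝ)) m, |σ| ∂ν) * ((h : ℝ) ^ (2 * γ) + (T / N) ^ γ)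
            + 2 * (⨆ x, |φ x|) *
              min (T * volume.real (O : Set (Pt d)) * ν.real (Set.Icc (-(m : ℝ)) m)ᶜ) 1 := by
  have hlam : ∀ k, 0 < lam k := he.pos hA
  -- negative `β` and `γ` are replaced by `0`: boundedness of `Q` and `Δt ≤ 1` suffice there
  set β₀ : ℝ := max β 0 with hβ₀
  set γ₀ : ℝ := max γ 0 with hγ₀
  have hβ0 : 0 ≤ β₀ := le_max_right _ _
  have hββ : β ≤ β₀ := le_max_left _ _
  have hβα : β₀ ≤ α := max_le hβ.2 hα.le
  have hαβ : α - β₀ < 1 := by linarith [hβ.1]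
  have hγ0 : 0 ≤ γ₀ := le_max_right _ _
  have hγa : γ₀ < 1 - (α - β₀) := max_lt (by linarith) (by linarith)
  have hγmem : γ₀ ∈ Set.Icc (0 : ℝ) 1 := ⟨hγ0, by linarith⟩
  obtain ⟨B, hB⟩ : ∃ B : L2 O →L[ℝ] L2 O, ∀ k x, lam k ^ β₀ * ⟪e k, Q x⟫_ℝ = ⟪e k, B x⟫_ℝ := by
    rcases le_total 0 β with h0 | h0
    · obtain ⟨B, hB⟩ := hAQ
      refine ⟨B, fun k x => ?_⟩
      obtain ⟨hx, hBx⟩ := hB x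
      rw [← hBx, inner_fracPow, hβ₀, max_eq_left h0]
    · refine ⟨Q, fun k x => ?_⟩
      rw [hβ₀, max_eq_right h0, Real.rpow_zero, one_mul]
  have hRs : IsSelfAdjoint R := hR.isSelfAdjoint
  have hc := norm_sq_le_of_rpow_comp_bounded e hlam hRs hRQ hB
  obtain ⟨κ, hκ, hE⟩ := hS1 (2 * γ₀) ⟨by linarith, by linarith [hγmem.2]⟩
  obtain ⟨C₁, hC₁, hstep⟩ := exists_weightedHS_step_sub_le hβ0 hβα hαβ.le hγmem hθ e hlam hTr
  obtain ⟨C₂, hC₂, hinit⟩ := exists_norm_stepS_pow_sub_le hγmem hθ e hlam hT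
  obtain ⟨Lφ, hLφ, hlip⟩ := hφ.exists_lipschitz
  set p : ℝ := γ₀ + (α - β₀) / 2 with hp
  set K : ℝ := (ENNReal.ofReal (‖B‖ + 1) ^ (1 / 2 : ℝ) * volume (O : Set (Pt d)) ^ (1 / 2 : ℝ) *
    ∫⁻ r in Set.Ioo 0 T, ENNReal.ofReal ((T - r) ^ (-p))).toReal with hK
  have hK0 : 0 ≤ K := ENNReal.toReal_nonneg
  set C : ℝ := Lφ * (κ + 1) * (C₂ * |ρ| + 2 * √C₁ * K) + 1 with hC
  have hC0 : 0 < C := by positivity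
  refine ⟨2 * C, by positivity, ?_⟩
  intro x₀ hx₀ ν _ _ hν Ω _ P _ π hπ b M hM X hX N m h hN hm hΔ1 Pm Mm hPm hMm
  have hN0 : (0 : ℝ) < N := by exact_mod_cast hN
  have hT0 : 0 < T := by linarith
  have hh : (0 : ℝ) < h := h.2
  have hτ : 0 < T / N := by positivity
  set x : ℝ := (h : ℝ) ^ (2 * γ₀) + (T / N) ^ γ₀ with hx
  have hx0 : 0 ≤ x := by positivity
  have hκh : 0 ≤ κ * (h : ℝ) ^ (2 * γ₀) := by positivity
  have hEh : ∀ t : ℝ, 0 < t →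
      ‖semigroupError e lam (V h) (hV h) t‖ ≤ κ * (h : ℝ) ^ (2 * γ₀) * t ^ (-γ₀) := fun t ht => by
    have h1 := hE h t ht
    rwa [show -(2 * γ₀) / 2 = -γ₀ by ring] at h1
  have hrate : κ * (h : ℝ) ^ (2 * γ₀) + (T / N) ^ γ₀ ≤ (κ + 1) * x := by
    have h1 : (0 : ℝ) ≤ (h : ℝ) ^ (2 * γ₀) := by positivity
    have h2 : (0 : ℝ) ≤ (T / N) ^ γ₀ := by positivity
    rw [hx]
    nlinarith
  have hrate0 : 0 ≤ κ * (h : ℝ) ^ (2 * γ₀) + (T / N) ^ γ₀ := by positivity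
  have hxle : x ≤ 2 * ((h : ℝ) ^ (2 * γ) + (T / N) ^ γ) := by
    have h1 : (0 : ℝ) ≤ (h : ℝ) ^ (2 * γ) := by positivity
    have h2 : (0 : ℝ) ≤ (T / N) ^ γ := by positivity
    rcases le_total 0 γ with h0 | h0
    · rw [hx, hγ₀, max_eq_left h0]
      linarith
    · have h3 := Real.one_le_rpow_of_pos_of_le_one_of_nonpos hτ hΔ1 h0
      rw [hx, hγ₀, max_eq_right h0, mul_zero, Real.rpow_zero, Real.rpow_zero]
      linarith
  have hS0 : 0 ≤ ∫ σ in Set.Icc (-(m : ℝ)) m, |σ| ∂ν := integral_nonneg fun σ => abs_nonneg σ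
  have hmain := abs_integral_thetaScheme_sub_le hπ hObdd hν hs hRs hRext b e hlam
    (fun k => Real.rpow_nonneg (hlam k).le (-β₀)) ENNReal.ofReal_ne_top hc (V h) (hV h) hT0 hN hm
    hLφ hφ.abs_le_iSup hlip
    (D₀ := C₂ * (κ * (h : ℝ) ^ (2 * γ₀) + (T / N) ^ γ₀) * |ρ|)
    (D := √C₁ * (κ * (h : ℝ) ^ (2 * γ₀) + (T / N) ^ γ₀)) (p := p)
    ((hinit (V h) (hV h) _ hκh hEh N hN hΔ1 x₀).trans
      (mul_le_mul_of_nonneg_left (hx₀.trans (le_abs_self ρ)) (by positivity)))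
    (by positivity) (by rw [hp]; linarith)
    (fun t n ht h1 h2 => by
      have h3 := hstep (V h) (hV h) _ hκh hEh (T / N) t n hτ ht h1 h2
      rwa [mul_pow, Real.sq_sqrt hC₁.le, show 2 * p = 2 * γ₀ + (α - β₀) by rw [hp]; ring])
    hM hX hPm hMm
  refine hmain.trans (add_le_add ?_ le_rfl)
  set S : ℝ := ∫ σ in Set.Icc (-(m : ℝ)) m, |σ| ∂ν with hS
  calc Lφ * (C₂ * (κ * (h : ℝ) ^ (2 * γ₀) + (T / N) ^ γ₀) * |ρ| +
        2 * S * (√C₁ * (κ * (h : ℝ) ^ (2 * γ₀) + (T / N) ^ γ₀)) * K)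
      = Lφ * (C₂ * |ρ| + 2 * √C₁ * K * S) * (κ * (h : ℝ) ^ (2 * γ₀) + (T / N) ^ γ₀) := by ring
    _ ≤ Lφ * (C₂ * |ρ| + 2 * √C₁ * K * S) * ((κ + 1) * x) :=
        mul_le_mul_of_nonneg_left hrate (by positivity)
    _ ≤ C * (1 + S) * x := by
        have h1 : Lφ * (κ + 1) * (C₂ * |ρ| + 2 * √C₁ * K * S) ≤ C * (1 + S) := by
          have h2 : 0 ≤ Lφ * (κ + 1) * (2 * √C₁ * K) := by positivity
          have h3 : 0 ≤ Lφ * (κ + 1) * (C₂ * |ρ|) * S := by positivity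
          rw [hC]
          nlinarith
        calc _ = Lφ * (κ + 1) * (C₂ * |ρ| + 2 * √C₁ * K * S) * x := by ring
          _ ≤ _ := mul_le_mul_of_nonneg_right h1 hx0
    _ ≤ C * (1 + S) * (2 * ((h : ℝ) ^ (2 * γ) + (T / N) ^ γ)) :=
        mul_le_mul_of_nonneg_left hxle (by positivity)
    _ = _ := by ring
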